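/- **Setting.** Let $\{F_\theta:\theta\in\mathbb R\}$ be an exponential family on $\mathbb R$ with densities $f_\theta(y)=\exp\{y\theta-b(\theta)+c(y)\}$ with respect to Lebesgue measure or the counting measure (with $f_\theta(y)=0$ where $c(y)=-\infty$). Let $m\ge 1$, let $W^{m,2}[0,1]$ be the space of functions $f:[0,1]\to\mathbb R$ for which $f,f',\dots,f^{(m-1)}$ exist and are absolutely continuous and $\int_0^1|f^{(m)}|^2<\infty$, and let $g_0\in W^{m,2}[0,1]$. For each $n$ let $t_1,\dots,t_n\in[0,1]$ be fixed design points (which may depend on $n$) and let $Y_1,\dots,Y_n$ be independent with $Y_i\sim F_{\theta_{0,i}}$, $\theta_{0,i}=g_0(t_i)$. Let $\widehat\alpha_n$ be random variables, which may depend on the data. For $\alpha>0$ put $l_\alpha(y,\theta)=\int f_\theta^{1+\alpha}-(1+\frac1\alpha)f_\theta^\alpha(y)$ (a sum in the case of counting measure), and for $\lambda>0$ consider the criterion $$L_n(g)=\frac1n\sum_{i=1}^n l_{\widehat\alpha_n}(Y_i,g(t_i))+\lambda\int_0^1|g^{(m)}(t)|^2\,dt,\qquad g\in W^{m,2}[0,1].\tag{5}$$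 Write $\|\cdot\|$ for the $L^2[0,1]$-norm, $\|f\|_{m,\lambda}^2=\|f\|^2+\lambda\|f^{(m)}\|^2$, and $u_\theta(y)=\partial\log f_\theta(y)/\partial\theta$. **Assumptions.** - (A1) The support $\mathcal Y=\overline{\{y:f_\theta(y)>0\}}$ does not depend on $\theta\in\mathbb R$. - (A2) $\widehat\alpha_n\to\alpha_0$ in probability for some $\alpha_0>0$. - (A3) The densities $\{f_\theta(y):\theta\in\mathbb R\}$ are uniformly bounded and there are $\delta>0$ and $M<\infty$ such that $\theta\mapsto f_\theta(y)$ is twice differentiable at $g_0(t)+u$ for all $t\in[0,1]$, $|u|<\delta$ and all $y$, and $$\sup_{t\in[0,1]}\ \sup_{|\alpha-\alpha_0|<\delta,\,|u|<\delta}\ \sup_{y\in\mathcal Y}\left|\frac{\partial f_\theta^\alpha(y)}{\partial\theta}\Big|_{\theta=g_0(t)+u}\log f_{g_0(t)+u}(y)\right|\le M.$$ - (A4) With $\delta$ as in (A3), put $$m_t(u,\alpha)=\int_{\mathcal Y}\frac{\partial^2 f_\theta^{1+\alpha}(y)}{\partial\theta^2}\Big|_{\theta=g_0(t)+u}dy,\qquad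 n_t(u,\alpha,y)=\frac{\partial^2 f_\theta^\alpha(y)}{\partial\theta^2}\Big|_{\theta=g_0(t)+u}$$ (the integral, which is assumed to exist, being a sum in the case of counting measure). For every $\alpha\in(\alpha_0-\delta,\alpha_0+\delta)$ and $y\in\mathcal Y$ the families $\{m_t(\cdot,\alpha):t\in[0,1]\}$ and $\{n_t(\cdot,\alpha,y):t\in[0,1]\}$ are equicontinuous at $u=0$, and there is $M'>0$ with $|m_t(u,\alpha)|+\sup_{y\in\mathcal Y}|n_t(u,\alpha,y)|\le M'$ for all $t\in[0,1]$, $|\alpha-\alpha_0|<\delta$, $|u|<\delta$. - (A5) With $\delta$ as in (A3), there are $0<c_0\le C_0<\infty$ such that $c_0\le\mathbb E\{f_{\theta_{0,i}}^\alpha(Y_i)|u_{\theta_{0,i}}(Y_i)|^2\}\le C_0$ for all $n$, all $i\le n$ and all $\alpha\in(\alpha_0-\delta,\alpha_0+\delta)$. - (A6) There are $n_0$ and $K$ such that for all $n\ge n_0$ and all absolutely continuous $f:[0,1]\to\mathbb R$ with $f'\in L^1[0,1]$, $$\left|\frac1n\sum_{i=1}^n f(t_i)-\int_0^1 f(t)\,dt\right|\le\frac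 Kn\int_0^1|f'(t)|\,dt.$$ **Theorem 1.** Assume (A1)–(A6), and let $\lambda=\lambda_n>0$ be deterministic with $\lambda\to0$, $n\lambda^{1/m}\to\infty$ and $n\lambda^{1/(2m)}\exp[-\lambda^{-1/m}]\to0$ as $n\to\infty$. Then $$\lim_{D\to\infty}\liminf_{n\to\infty}\Pr\Big[\text{there is a local minimizer }\widehat g_n\text{ of (5) over }W^{m,2}[0,1]\text{ with }\|\widehat g_n-g_0\|_{m,\lambda}^2\le D\big(n^{-1}\lambda^{-1/(2m)}+\lambda\big)\Big]=1,$$ where "local minimizer" refers to the topology of the norm $\|\cdot\|_{m,\lambda}$ (which does not depend on $\lambda>0$), and the probability may be taken as inner probability should the event not be measurable. -/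

import Mathlib

open MeasureTheory ProbabilityTheory Set Filter Topology

noncomputable section

/-- A one-parameter exponential family of distributions on `ℝ` with unit dispersion: every
`θ : ℝ` gives the density `exp (y θ - b θ + c y)` for `y ∈ carrier` (and `0` elsewhere) with
respect to a reference measure that is Lebesgue measure or the counting measure. The set
`carrier` plays the role of the points where `c y > -∞`. -/
structure ExponentialFamily where
  /-- the reference measure -/
  ref : Measure ℝ
  ref_eq : ref = volume ∨ ref = Measure.count
  /-- the set where the densities do not vanish -/
  carrier : Set ℝ
  measurableSet_carrier : MeasurableSet carrier
  b : ℝ → ℝ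
  c : ℝ → ℝ
  measurable_c : Measurable c
  lintegral_eq_one : ∀ θ : ℝ, ∫⁻ y, ENNReal.ofReal
    (carrier.indicator (fun y => Real.exp (y * θ - b θ + c y)) y) ∂ref = 1

namespace ExponentialFamily

/-- The density `f_θ(y)`. -/
def density (F : ExponentialFamily) (θ y : ℝ) : ℝ :=
  F.carrier.indicator (fun y => Real.exp (y * θ - F.b θ + F.c y)) y

/-- The distribution `F_θ`. -/
def law (F : ExponentialFamily) (θ : ℝ) : Measure ℝ :=
  F.ref.withDensity (fun y => ENNReal.ofReal (F.density θ y))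

/-- The score `u_θ(y)`, the derivative of the log-density in the canonical parameter. -/
def score (F : ExponentialFamily) (θ y : ℝ) : ℝ :=
  deriv (fun s => Real.log (F.density s y)) θ

/-- The density power divergence loss
`l_α(y, θ) = ∫ f_θ^{1+α} - (1 + 1/α) f_θ(y)^α`, for `α > 0`. -/
def dpdLoss (F : ExponentialFamily) (α y θ : ℝ) : ℝ :=
  (∫ x, F.density θ x ^ (1 + α) ∂F.ref) - (1 + 1 / α) * F.density θ y ^ α

/-- `m_t(u, α)`: the integral over `Y` of the second `θ`-derivative of `f_θ^{1+α}`
at `θ = g₀ t + u`. -/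
def mFun (F : ExponentialFamily) (Y : Set ℝ) (g₀ : ℝ → ℝ) (t u α : ℝ) : ℝ :=
  ∫ y in Y, iteratedDeriv 2 (fun θ => F.density θ y ^ (1 + α)) (g₀ t + u) ∂F.ref

/-- `n_t(u, α, y)`: the second `θ`-derivative of `f_θ(y)^α` at `θ = g₀ t + u`. -/
def nFun (F : ExponentialFamily) (g₀ : ℝ → ℝ) (t u α y : ℝ) : ℝ :=
  iteratedDeriv 2 (fun θ => F.density θ y ^ α) (g₀ t + u)

/-- The common support: the closure of `{y | f_θ(y) > 0}` is `Y` for every `θ`. -/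
def CommonSupport (F : ExponentialFamily) (Y : Set ℝ) : Prop :=
  ∀ θ : ℝ, closure {y | 0 < F.density θ y} = Y

/-- Uniform boundedness, twice differentiability near the true parameter, and the bound on
`∂f_θ^α(y)/∂θ · log f_θ(y)` near the true parameter. -/
def FirstOrderRegular (F : ExponentialFamily) (Y : Set ℝ) (g₀ : ℝ → ℝ) (α₀ δ : ℝ) : Prop :=
  (∃ B : ℝ, ∀ θ y, F.density θ y ≤ B) ∧
  (∀ t ∈ Icc (0 : ℝ) 1, ∀ y u : ℝ, |u| < δ →
    DifferentiableAt ℝ (fun θ => F.density θ y) (g₀ t + u) ∧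
    DifferentiableAt ℝ (deriv (fun θ => F.density θ y)) (g₀ t + u)) ∧
  ∃ M : ℝ, ∀ t ∈ Icc (0 : ℝ) 1, ∀ α u : ℝ, |α - α₀| < δ → |u| < δ → ∀ y ∈ Y,
    |deriv (fun θ => F.density θ y ^ α) (g₀ t + u) * Real.log (F.density (g₀ t + u) y)| ≤ M

/-- Equicontinuity at `u = 0` of the families `m_t(·, α)` and `n_t(·, α, y)`, `t ∈ [0,1]`
(the integrals `m_t` being well defined), and their local uniform boundedness. -/
def SecondOrderRegular (F : ExponentialFamily) (Y : Set ℝ) (g₀ : ℝ → ℝ) (α₀ δ : ℝ) : Prop :=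
  (∀ t ∈ Icc (0 : ℝ) 1, ∀ α u : ℝ, |α - α₀| < δ → |u| < δ →
    IntegrableOn (fun y => iteratedDeriv 2 (fun θ => F.density θ y ^ (1 + α)) (g₀ t + u))
      Y F.ref) ∧
  (∀ α : ℝ, |α - α₀| < δ →
    EquicontinuousAt (fun (t : Icc (0 : ℝ) 1) (u : ℝ) => F.mFun Y g₀ t u α) 0 ∧
    ∀ y ∈ Y, EquicontinuousAt (fun (t : Icc (0 : ℝ) 1) (u : ℝ) => F.nFun g₀ t u α y) 0) ∧
  ∃ M : ℝ, 0 < M ∧ ∀ t ∈ Icc (0 : ℝ) 1, ∀ α u : ℝ, |α - α₀| < δ → |u| < δ → ∀ y ∈ Y,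
    |F.mFun Y g₀ t u α| + |F.nFun g₀ t u α y| ≤ M

/-- The moments `E{f_θ^α(Y_i) |u_θ(Y_i)|²}`, at the true parameters `θ = g₀(t_i)`, are bounded
away from zero and infinity, uniformly in `n`, `i ≤ n` and `α` near `α₀`. -/
def InformationBounds (F : ExponentialFamily) {Ω : Type*} [MeasurableSpace Ω] (P : Measure Ω)
    (t : (n : ℕ) → Fin n → ℝ) (Y : (n : ℕ) → Fin n → Ω → ℝ) (g₀ : ℝ → ℝ) (α₀ δ : ℝ) : Prop :=
  ∃ c₀ C₀ : ℝ, 0 < c₀ ∧ c₀ ≤ C₀ ∧ ∀ α : ℝ, |α - α₀| < δ → ∀ (n : ℕ) (i : Fin n),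
    c₀ ≤ ∫ ω, F.density (g₀ (t n i)) (Y n i ω) ^ α * |F.score (g₀ (t n i)) (Y n i ω)| ^ 2 ∂P ∧
    ∫ ω, F.density (g₀ (t n i)) (Y n i ω) ^ α * |F.score (g₀ (t n i)) (Y n i ω)| ^ 2 ∂P ≤ C₀

end ExponentialFamily

/-- The `k`-th derivative on `[0,1]` (one-sided at the end points); it depends only on the
restriction of `f` to `[0,1]`. -/
def derivOn (k : ℕ) (f : ℝ → ℝ) : ℝ → ℝ := iteratedDerivWithin k f (Icc 0 1)

/-- The Sobolev space `W^{m,p}([0,1])`, for `m ≥ 1`: `f, f', …, f^{(m-1)}` exist on `[0,1]`,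
`f^{(m-1)}` is absolutely continuous (hence so are the lower derivatives, which are `C¹`), and
its almost everywhere derivative `f^{(m)}` is in `L^p`. Only the values of `f` on `[0,1]`
matter. -/
def MemSobolev (m : ℕ) (p : ENNReal) (f : ℝ → ℝ) : Prop :=
  ContDiffOn ℝ ((m - 1 : ℕ) : ℕ∞) f (Icc 0 1) ∧
  AbsolutelyContinuousOnInterval (derivOn (m - 1) f) 0 1 ∧
  MemLp (derivOn m f) p (volume.restrict (Icc 0 1))

/-- The norm `‖f‖_{m,lam} = (‖f‖² + lam ‖f^{(m)}‖²)^{1/2}`, with `L²([0,1])`-norms. -/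
def sobolevNorm (m : ℕ) (lam : ℝ) (f : ℝ → ℝ) : ℝ :=
  Real.sqrt ((∫ x in Icc (0 : ℝ) 1, f x ^ 2) + lam * ∫ x in Icc (0 : ℝ) 1, derivOn m f x ^ 2)

/-- Asymptotically quasi-uniform design: from some `n₀` on, the quadrature error of every
`f ∈ W^{1,1}([0,1])` is at most `K / n` times the `L¹`-norm of `f'`. -/
def QuasiUniformDesign (t : (n : ℕ) → Fin n → ℝ) : Prop :=
  ∃ (n₀ : ℕ) (K : ℝ), ∀ n ≥ n₀, ∀ f : ℝ → ℝ, MemSobolev 1 1 f →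
    |(1 / (n : ℝ)) * ∑ i, f (t n i) - ∫ x in Icc (0 : ℝ) 1, f x| ≤
      K / n * ∫ x in Icc (0 : ℝ) 1, |derivOn 1 f x|

/-- The penalized density power divergence criterion
`(1/n) ∑ l_α(y_i, g(t_i)) + lam ∫ |g^{(m)}|²`. -/
def dpdCriterion (F : ExponentialFamily) (m : ℕ) (lam α : ℝ) {n : ℕ} (t y : Fin n → ℝ)
    (g : ℝ → ℝ) : ℝ :=
  (1 / (n : ℝ)) * ∑ i, F.dpdLoss α (y i) (g (t i)) +
    lam * ∫ x in Icc (0 : ℝ) 1, |derivOn m g x| ^ 2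

/-- `g` is a local minimizer of `L` over `W^{m,2}([0,1])`. For `lam > 0` the norms
`‖·‖_{m,lam}` are equivalent, so the choice of `lam > 0` does not matter. -/
def IsSobolevLocalMin (m : ℕ) (lam : ℝ) (L : (ℝ → ℝ) → ℝ) (g : ℝ → ℝ) : Prop :=
  MemSobolev m 2 g ∧ ∃ r > 0, ∀ h : ℝ → ℝ, MemSobolev m 2 h →
    sobolevNorm m lam (fun x => h x - g x) < r → L g ≤ L h

/-- The inner probability of an event: it equals `P E` for measurable `E`, and for a general
`E` it is the largest probability of a measurable event contained in `E` (so at most `P E`,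
the outer probability). -/
def innerProb {Ω : Type*} [MeasurableSpace Ω] (P : Measure Ω) (E : Set Ω) : ENNReal :=
  1 - P Eᶜ

end

/-
On the sphere of radius `R` around `g₀`, with `R` of the order of the rate, the criterion exceeds
its value at `g₀` by at least a positive multiple of `R²`. Indeed the loss decomposes into its
expectation, which has a nondegenerate quadratic minimum at the true parameter, and a noise term.
The quadratic minimum carries over to the norm `‖·‖_{m,λ}` since averages over the design points
are close to integrals and the penalty supplies the derivative part. The noise is linear in
`g - g₀` up to a remainder; since evaluation at a point has norm `O(λ^{-1/(4m)})`, the representer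
of the linear part is an average of independent centered vectors in a Hilbert space, and its second
moment is `O(n⁻¹ λ^{-1/(2m)})`. A minimizer over the ball exists by compactness, cannot lie on the
sphere, and is therefore a local minimizer.

The tuning parameter enters the noise through integrals of functions whose derivative in `α` is
bounded, so the randomness of `αhat` costs nothing beyond its consistency.
-/

noncomputable section

/-- Lebesgue measure on `[0,1]`. -/
abbrev unitVolume : Measure ℝ := volume.restrict (Icc (0 : ℝ) 1)

instance : IsProbabilityMeasure unitVolume := ⟨by simp [unitVolume]⟩

lemma ae_unitVolume_of_forall_mem {P : ℝ → Prop} (h : ∀ x ∈ Icc (0 : ℝ) 1, P x) :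
    ∀ᵐ x ∂unitVolume, P x :=
  (ae_restrict_iff' measurableSet_Icc).2 (ae_of_all _ h)

lemma ae_unitVolume_mem_Ioo : ∀ᵐ x ∂unitVolume, x ∈ Ioo (0 : ℝ) 1 := by
  rw [unitVolume, ← restrict_Ioo_eq_restrict_Icc]
  exact ae_restrict_mem measurableSet_Ioo

lemma memLp_unitVolume_of_continuousOn {f : ℝ → ℝ} (hf : ContinuousOn f (Icc 0 1))
    (r : ENNReal) : MemLp f r unitVolume := by
  obtain ⟨C, hC⟩ := isCompact_Icc.exists_bound_of_continuousOn hf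
  exact MemLp.of_bound (hf.aestronglyMeasurable measurableSet_Icc) C
    (ae_unitVolume_of_forall_mem hC)

lemma abs_intervalIntegral_le_unitVolume {p : ℝ → ℝ} (hp : Integrable p unitVolume) {x y : ℝ}
    (hx : x ∈ Icc (0 : ℝ) 1) (hy : y ∈ Icc (0 : ℝ) 1) :
    |∫ z in x..y, p z| ≤ ∫ z in Icc (0 : ℝ) 1, |p z| := by
  refine (intervalIntegral.norm_integral_le_integral_norm_uIoc (f := p)).trans ?_
  exact setIntegral_mono_set hp.abs (ae_of_all _ fun _ => abs_nonneg _)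
    (uIoc_subset_uIcc.trans (uIcc_subset_Icc hx hy)).eventuallyLE

/-- The squared `L²([0,1])`-norm. -/
def sqNorm (f : ℝ → ℝ) : ℝ := ∫ x in Icc (0 : ℝ) 1, f x ^ 2

lemma sqNorm_nonneg (f : ℝ → ℝ) : 0 ≤ sqNorm f := integral_nonneg fun _ => sq_nonneg _

lemma sqNorm_congr {f g : ℝ → ℝ} (h : f =ᵐ[unitVolume] g) : sqNorm f = sqNorm g :=
  integral_congr_ae (by filter_upwards [h] with x hx; rw [hx])

lemma two_mul_integral_abs_mul_le {f p : ℝ → ℝ} (hf : MemLp f 2 unitVolume)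
    (hp : MemLp p 2 unitVolume) {s : ℝ} (hs : 0 < s) :
    2 * ∫ x in Icc (0 : ℝ) 1, |f x * p x| ≤ (sqNorm f + s ^ 2 * sqNorm p) / s := by
  have amgm (x : ℝ) : 2 * |f x * p x| ≤ f x ^ 2 / s + s * p x ^ 2 := by
    rw [abs_mul, ← sq_abs (f x), ← sq_abs (p x), div_add' _ _ _ hs.ne', le_div_iff₀ hs]
    linarith [sq_nonneg (|f x| - s * |p x|)]
  have hf2 := hf.integrable_sq.div_const s
  have hp2 := hp.integrable_sq.const_mul s
  calc 2 * ∫ x in Icc (0 : ℝ) 1, |f x * p x| = ∫ x in Icc (0 : ℝ) 1, 2 * |f x * p x| :=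
        (integral_const_mul _ _).symm
    _ ≤ ∫ x in Icc (0 : ℝ) 1, (f x ^ 2 / s + s * p x ^ 2) :=
        integral_mono ((hf.integrable_mul hp).abs.const_mul 2) (hf2.add hp2) amgm
    _ = (sqNorm f + s ^ 2 * sqNorm p) / s := by
        rw [integral_add hf2 hp2, integral_div, integral_const_mul, sqNorm, sqNorm]
        field_simp

/-- `f` belongs to `W^{1,2}([0,1])`, with weak derivative `p`: it is absolutely continuous on
`[0,1]` and its almost everywhere derivative `p` is square integrable. Unlike `MemSobolev`, this
allows the derivative to be prescribed up to null sets. -/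
structure HasL2Deriv (f p : ℝ → ℝ) : Prop where
  ac : AbsolutelyContinuousOnInterval f 0 1
  ae_hasDerivAt : ∀ᵐ x ∂unitVolume, HasDerivAt f (p x) x
  memLp_deriv : MemLp p 2 unitVolume

namespace HasL2Deriv

variable {f g p q : ℝ → ℝ}

lemma continuousOn (h : HasL2Deriv f p) : ContinuousOn f (Icc 0 1) := by
  simpa using h.ac.continuousOn

lemma memLp (h : HasL2Deriv f p) (r : ENNReal) : MemLp f r unitVolume :=
  memLp_unitVolume_of_continuousOn h.continuousOn r

lemma integrable_deriv (h : HasL2Deriv f p) : Integrable p unitVolume :=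
  h.memLp_deriv.integrable (by norm_num)

lemma integral_eq_sub (h : HasL2Deriv f p) {x y : ℝ} (hx : x ∈ Icc (0 : ℝ) 1)
    (hy : y ∈ Icc (0 : ℝ) 1) : ∫ z in x..y, p z = f y - f x := by
  have hac : AbsolutelyContinuousOnInterval f x y :=
    h.ac.mono (by rw [uIcc_of_le zero_le_one]; exact uIcc_subset_Icc hx hy)
  rw [← hac.integral_deriv_eq_sub]
  refine intervalIntegral.integral_congr_ae ?_
  have hp := (ae_restrict_iff' measurableSet_Icc).1 h.ae_hasDerivAt
  filter_upwards [hp] with z hz hzm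
  exact (hz (uIcc_subset_Icc hx hy (uIoc_subset_uIcc hzm))).deriv.symm

lemma congr (h : HasL2Deriv f p) (hfg : EqOn f g (Icc 0 1)) (hpq : p =ᵐ[unitVolume] q) :
    HasL2Deriv g q := by
  refine ⟨?_, ?_, (memLp_congr_ae hpq).1 h.memLp_deriv⟩
  · have hac := h.ac
    rw [absolutelyContinuousOnInterval_iff] at hac ⊢
    intro ε hε
    obtain ⟨δ, hδ, H⟩ := hac ε hε
    refine ⟨δ, hδ, fun E hE hd => lt_of_eq_of_lt (Finset.sum_congr rfl fun i hi => ?_) (H E hE hd)⟩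
    have hmem := hE.1 i hi
    rw [uIcc_of_le zero_le_one] at hmem
    rw [hfg hmem.1, hfg hmem.2]
  · filter_upwards [h.ae_hasDerivAt, hpq, ae_unitVolume_mem_Ioo] with x hx hxq hmem
    rw [← hxq]
    exact hx.congr_of_eventuallyEq
      (hfg.symm.eventuallyEq_of_mem (Icc_mem_nhds hmem.1 hmem.2))

lemma add (hf : HasL2Deriv f p) (hg : HasL2Deriv g q) : HasL2Deriv (f + g) (p + q) :=
  ⟨hf.ac.add hg.ac, by
    filter_upwards [hf.ae_hasDerivAt, hg.ae_hasDerivAt] with x hx hx' using hx.add hx',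
    hf.memLp_deriv.add hg.memLp_deriv⟩

lemma const_smul (hf : HasL2Deriv f p) (a : ℝ) : HasL2Deriv (a • f) (a • p) :=
  ⟨hf.ac.const_smul a, by filter_upwards [hf.ae_hasDerivAt] with x hx using hx.const_smul a,
    hf.memLp_deriv.const_smul a⟩

lemma mul (hf : HasL2Deriv f p) (hg : HasL2Deriv g q) :
    HasL2Deriv (fun x => f x * g x) (fun x => p x * g x + f x * q x) :=
  ⟨hf.ac.fun_mul hg.ac, by
    filter_upwards [hf.ae_hasDerivAt, hg.ae_hasDerivAt] with x hx hx' using hx.mul hx',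
    ((hg.memLp ⊤).mul hf.memLp_deriv).add (hg.memLp_deriv.mul (hf.memLp ⊤))⟩

lemma sq (hf : HasL2Deriv f p) : HasL2Deriv (fun x => f x ^ 2) (fun x => 2 * (f x * p x)) :=
  (hf.mul hf).congr (fun x _ => (pow_two _).symm) (ae_of_all _ fun x => by ring)

lemma const_add_integral (hp : MemLp p 2 unitVolume) (a : ℝ) :
    HasL2Deriv (fun x => a + ∫ z in (0 : ℝ)..x, p z) p := by
  have hint : IntervalIntegrable p volume 0 1 :=
    (intervalIntegrable_iff_integrableOn_Icc_of_le zero_le_one).2 (hp.integrable (by norm_num))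
  refine ⟨?_, (ae_restrict_iff' measurableSet_Icc).2 ?_, hp⟩
  · have hconst : AbsolutelyContinuousOnInterval (fun _ : ℝ => a) 0 1 :=
      contDiffOn_const.absolutelyContinuousOnInterval
    exact hconst.fun_add (hint.absolutelyContinuousOnInterval_intervalIntegral (by simp))
  · filter_upwards [hint.ae_hasDerivAt_integral] with x hx hmem
    rw [uIcc_of_le zero_le_one] at hx
    exact (hx hmem 0 (by simp)).const_add a

lemma sq_le (h : HasL2Deriv f p) {t : ℝ} (ht : t ∈ Icc (0 : ℝ) 1) :
    f t ^ 2 ≤ sqNorm f + 2 * ∫ x in Icc (0 : ℝ) 1, |f x * p x| := by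
  set I := ∫ x in Icc (0 : ℝ) 1, |f x * p x|
  have increment : ∀ x ∈ Icc (0 : ℝ) 1, f t ^ 2 ≤ f x ^ 2 + 2 * I := by
    intro x hx
    have hle := (le_abs_self _).trans
      (abs_intervalIntegral_le_unitVolume h.sq.integrable_deriv hx ht)
    simp only [abs_mul (2 : ℝ), abs_two] at hle
    rw [h.sq.integral_eq_sub hx ht, integral_const_mul] at hle
    linarith
  have hf2 := (h.memLp 2).integrable_sq
  calc f t ^ 2 = ∫ _x in Icc (0 : ℝ) 1, f t ^ 2 := by simp
    _ ≤ ∫ x in Icc (0 : ℝ) 1, (f x ^ 2 + 2 * I) :=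
        integral_mono_ae (integrable_const _) (hf2.add (integrable_const _))
          (ae_unitVolume_of_forall_mem increment)
    _ = sqNorm f + 2 * I := by
        rw [integral_add hf2 (integrable_const _)]
        simp [sqNorm]

lemma sq_le_of_scale (h : HasL2Deriv f p) {t : ℝ} (ht : t ∈ Icc (0 : ℝ) 1) {s : ℝ} (hs : 0 < s)
    (hs1 : s ≤ 1) : f t ^ 2 ≤ 2 / s * (sqNorm f + s ^ 2 * sqNorm p) := by
  have hamgm := two_mul_integral_abs_mul_le (h.memLp 2) h.memLp_deriv hs
  have hp : 0 ≤ s ^ 2 * sqNorm p := mul_nonneg (sq_nonneg _) (sqNorm_nonneg p)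
  have hf : sqNorm f ≤ (sqNorm f + s ^ 2 * sqNorm p) / s := by
    rw [le_div_iff₀ hs]
    nlinarith [sqNorm_nonneg f]
  calc f t ^ 2 ≤ (sqNorm f + s ^ 2 * sqNorm p) / s + (sqNorm f + s ^ 2 * sqNorm p) / s := by
        linarith [h.sq_le ht]
    _ = 2 / s * (sqNorm f + s ^ 2 * sqNorm p) := by ring

lemma sqNorm_deriv_eq (hf : HasL2Deriv f p) (hp : HasL2Deriv p q) :
    sqNorm p = f 1 * p 1 - f 0 * p 0 - ∫ x in Icc (0 : ℝ) 1, f x * q x := by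
  have hpp : Integrable (fun x => p x * p x) unitVolume :=
    hf.memLp_deriv.integrable_mul (hp.memLp 2)
  have hfq : Integrable (fun x => f x * q x) unitVolume :=
    (hf.memLp 2).integrable_mul hp.memLp_deriv
  have hparts := (hf.mul hp).integral_eq_sub (x := 0) (y := 1) (by simp) (by simp)
  rw [intervalIntegral.integral_of_le zero_le_one, ← integral_Icc_eq_integral_Ioc,
    integral_add hpp hfq] at hparts
  simp only [sqNorm, pow_two]
  linarith

-- The boundary terms of the integration by parts are absorbed by evaluating `f` at a scale
-- much smaller than `s`.
lemma sqNorm_deriv_le (hf : HasL2Deriv f p) (hp : HasL2Deriv p q) {s : ℝ} (hs : 0 < s)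
    (hs1 : s ≤ 1) : sqNorm p ≤ 12000 / s ^ 2 * sqNorm f + s ^ 2 * sqNorm q := by
  have hf0 : 0 ≤ sqNorm f / s ^ 2 := div_nonneg (sqNorm_nonneg f) (sq_nonneg s)
  have hq0 : 0 ≤ s ^ 2 * sqNorm q := mul_nonneg (sq_nonneg s) (sqNorm_nonneg q)
  have boundary : ∀ t ∈ Icc (0 : ℝ) 1, |f t * p t| ≤
      4096 * (sqNorm f / s ^ 2) + sqNorm p / 8 + s ^ 2 * sqNorm q / 16 := by
    intro t ht
    have hft := hf.sq_le_of_scale ht (s := s / 256) (by positivity) (by linarith)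
    have hpt := hp.sq_le_of_scale ht hs hs1
    have amgm : 2 * |f t * p t| ≤ 16 / s * f t ^ 2 + s / 16 * p t ^ 2 := by
      rw [abs_mul, ← sq_abs (f t), ← sq_abs (p t)]
      have : 0 ≤ 16 / s * (|f t| - s / 16 * |p t|) ^ 2 := by positivity
      have e : 16 / s * (|f t| - s / 16 * |p t|) ^ 2 =
        16 / s * |f t| ^ 2 + s / 16 * |p t| ^ 2 - 2 * (|f t| * |p t|) := by field_simp; ring
      linarith
    calc |f t * p t| ≤ (16 / s * f t ^ 2 + s / 16 * p t ^ 2) / 2 := by linarith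
      _ ≤ (16 / s * (2 / (s / 256) * (sqNorm f + (s / 256) ^ 2 * sqNorm p)) +
          s / 16 * (2 / s * (sqNorm p + s ^ 2 * sqNorm q))) / 2 := by gcongr
      _ = 4096 * (sqNorm f / s ^ 2) + sqNorm p / 8 + s ^ 2 * sqNorm q / 16 := by
          field_simp; ring
  have interior : |∫ x in Icc (0 : ℝ) 1, f x * q x| ≤
      (sqNorm f / s ^ 2 + s ^ 2 * sqNorm q) / 2 := by
    have hamgm := two_mul_integral_abs_mul_le (hf.memLp 2) hp.memLp_deriv (s := s ^ 2)
      (by positivity)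
    have e : (sqNorm f + (s ^ 2) ^ 2 * sqNorm q) / s ^ 2 = sqNorm f / s ^ 2 + s ^ 2 * sqNorm q := by
      field_simp
    linarith [abs_integral_le_integral_abs (μ := unitVolume) (f := fun x => f x * q x)]
  have hparts := hf.sqNorm_deriv_eq hp
  have h0 := boundary 0 (by simp)
  have h1 := boundary 1 (by simp)
  rw [abs_le] at h0 h1 interior
  rw [div_mul_eq_mul_div, mul_div_assoc]
  linarith [h0.1, h1.2, interior.1]

end HasL2Deriv

lemma uniqueDiffOn_unitInterval : UniqueDiffOn ℝ (Icc (0 : ℝ) 1) := uniqueDiffOn_Icc zero_lt_one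

lemma derivOn_zero (f : ℝ → ℝ) : derivOn 0 f = f := iteratedDerivWithin_zero

lemma derivOn_one (f : ℝ → ℝ) : derivOn 1 f = derivWithin f (Icc 0 1) := iteratedDerivWithin_one

lemma derivOn_succ (k : ℕ) (f : ℝ → ℝ) : derivOn (k + 1) f = derivOn 1 (derivOn k f) := by
  rw [derivOn_one]
  exact iteratedDerivWithin_succ

lemma derivOn_succ' (k : ℕ) (f : ℝ → ℝ) : derivOn (k + 1) f = derivOn k (derivOn 1 f) := by
  rw [derivOn_one]
  exact iteratedDerivWithin_succ'

lemma derivOn_congr {f g : ℝ → ℝ} (h : EqOn f g (Icc 0 1)) (k : ℕ) :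
    EqOn (derivOn k f) (derivOn k g) (Icc 0 1) := iteratedDerivWithin_congr h

lemma derivOn_const_smul (k : ℕ) (a : ℝ) (f : ℝ → ℝ) : derivOn k (a • f) = a • derivOn k f := by
  ext x
  exact iteratedDerivWithin_const_smul_field a f

lemma derivOn_fun_zero (k : ℕ) : derivOn k 0 = 0 := by
  simpa only [zero_smul] using derivOn_const_smul k 0 0

namespace HasL2Deriv

variable {f p : ℝ → ℝ}

lemma derivOn_ae_eq (h : HasL2Deriv f p) : derivOn 1 f =ᵐ[unitVolume] p := by
  filter_upwards [h.ae_hasDerivAt, ae_unitVolume_mem_Ioo] with x hx hmem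
  rw [derivOn_one]
  exact hx.hasDerivWithinAt.derivWithin (uniqueDiffOn_unitInterval x (Ioo_subset_Icc_self hmem))

lemma hasL2Deriv_derivOn (h : HasL2Deriv f p) : HasL2Deriv f (derivOn 1 f) :=
  h.congr (eqOn_refl _ _) h.derivOn_ae_eq.symm

lemma hasDerivWithinAt (h : HasL2Deriv f p) (hp : ContinuousOn p (Icc 0 1)) {x : ℝ}
    (hx : x ∈ Icc (0 : ℝ) 1) : HasDerivWithinAt f (p x) (Icc 0 1) x := by
  have hint : IntervalIntegrable p volume 0 x :=
    (hp.mono (uIcc_subset_Icc (by simp) hx)).intervalIntegrable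
  have : Fact (x ∈ Icc (0 : ℝ) 1) := ⟨hx⟩
  have hderiv := (intervalIntegral.integral_hasDerivWithinAt_right hint
    (s := Icc 0 1) (t := Icc 0 1)
    (hp.stronglyMeasurableAtFilter_nhdsWithin measurableSet_Icc x) (hp x hx)).const_add (f 0)
  have heq : EqOn f (fun y => f 0 + ∫ z in (0 : ℝ)..y, p z) (Icc 0 1) := fun y hy => by
    simp only [h.integral_eq_sub (left_mem_Icc.2 zero_le_one) hy, add_sub_cancel]
  exact hderiv.congr heq (heq hx)

end HasL2Deriv

lemma hasL2Deriv_of_absolutelyContinuousOnInterval {f : ℝ → ℝ}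
    (hf : AbsolutelyContinuousOnInterval f 0 1) (hf' : MemLp (derivOn 1 f) 2 unitVolume) :
    HasL2Deriv f (derivOn 1 f) := by
  refine ⟨hf, ?_, hf'⟩
  have hdiff : ∀ᵐ x ∂unitVolume, DifferentiableAt ℝ f x := by
    rw [ae_restrict_iff' measurableSet_Icc, ← uIcc_of_le (zero_le_one' ℝ)]
    exact hf.ae_differentiableAt
  filter_upwards [hdiff, ae_unitVolume_mem_Ioo] with x hx hmem
  rw [derivOn_one, hx.derivWithin (uniqueDiffOn_unitInterval x (Ioo_subset_Icc_self hmem))]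
  exact hx.hasDerivAt

lemma memSobolev_succ_iff {k : ℕ} {f : ℝ → ℝ} : MemSobolev (k + 1) 2 f ↔
    ContDiffOn ℝ k f (Icc 0 1) ∧ HasL2Deriv (derivOn k f) (derivOn (k + 1) f) := by
  refine ⟨fun ⟨hcont, hac, hmem⟩ => ⟨hcont, ?_⟩, fun ⟨hcont, h⟩ => ⟨hcont, h.ac, h.memLp_deriv⟩⟩
  rw [derivOn_succ] at hmem ⊢
  exact hasL2Deriv_of_absolutelyContinuousOnInterval hac hmem

lemma memSobolev_one_iff {f : ℝ → ℝ} : MemSobolev 1 2 f ↔ HasL2Deriv f (derivOn 1 f) := by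
  rw [memSobolev_succ_iff (k := 0), derivOn_zero]
  exact and_iff_right_of_imp fun h => contDiffOn_zero.2 h.continuousOn

lemma memSobolev_add_two_iff {k : ℕ} {f : ℝ → ℝ} : MemSobolev (k + 2) 2 f ↔
    DifferentiableOn ℝ f (Icc 0 1) ∧ MemSobolev (k + 1) 2 (derivOn 1 f) := by
  simp only [memSobolev_succ_iff, derivOn_succ' k f, derivOn_succ' (k + 1) f]
  rw [Nat.cast_succ, contDiffOn_succ_iff_derivWithin uniqueDiffOn_unitInterval, derivOn_one]
  simp [and_assoc]

namespace MemSobolev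

variable {m : ℕ} {f g : ℝ → ℝ}

lemma hasL2Deriv (hm : 1 ≤ m) (hf : MemSobolev m 2 f) : HasL2Deriv f (derivOn 1 f) := by
  obtain _ | _ | k := m
  · omega
  · exact memSobolev_one_iff.1 hf
  · have hcont : ContDiffOn ℝ 1 f (Icc 0 1) := hf.1.of_le (by norm_cast; omega)
    have hac : AbsolutelyContinuousOnInterval f 0 1 :=
      ContDiffOn.absolutelyContinuousOnInterval (by rwa [uIcc_of_le zero_le_one])
    refine hasL2Deriv_of_absolutelyContinuousOnInterval hac (memLp_unitVolume_of_continuousOn ?_ 2)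
    rw [derivOn_one]
    exact hcont.continuousOn_derivWithin uniqueDiffOn_unitInterval le_rfl

lemma memLp (hf : MemSobolev m 2 f) : MemLp f 2 unitVolume :=
  memLp_unitVolume_of_continuousOn hf.1.continuousOn 2

lemma congr {k : ℕ} (hf : MemSobolev (k + 1) 2 f) (h : EqOn f g (Icc 0 1)) :
    MemSobolev (k + 1) 2 g :=
  memSobolev_succ_iff.2 ⟨hf.1.congr h.symm, (memSobolev_succ_iff.1 hf).2.congr (derivOn_congr h k)
    (ae_unitVolume_of_forall_mem (derivOn_congr h (k + 1)))⟩

lemma add (hf : MemSobolev m 2 f) (hg : MemSobolev m 2 g) : MemSobolev m 2 (f + g) ∧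
    derivOn m (f + g) =ᵐ[unitVolume] derivOn m f + derivOn m g := by
  obtain _ | k := m
  · exact ⟨⟨hf.1.add hg.1, hf.2.1.add hg.2.1, hf.2.2.add hg.2.2⟩, .rfl⟩
  rw [memSobolev_succ_iff] at hf hg
  have hderiv : EqOn (derivOn k f + derivOn k g) (derivOn k (f + g)) (Icc 0 1) := fun x hx =>
    (iteratedDerivWithin_add hx uniqueDiffOn_unitInterval (hf.1 x hx) (hg.1 x hx)).symm
  have h := (hf.2.add hg.2).congr hderiv .rfl
  have hae : derivOn (k + 1) (f + g) =ᵐ[unitVolume] derivOn (k + 1) f + derivOn (k + 1) g := by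
    rw [derivOn_succ]
    exact h.derivOn_ae_eq
  exact ⟨memSobolev_succ_iff.2 ⟨hf.1.add hg.1, h.congr (eqOn_refl _ _) hae.symm⟩, hae⟩

lemma const_smul (hf : MemSobolev m 2 f) (a : ℝ) : MemSobolev m 2 (a • f) := by
  refine ⟨hf.1.const_smul a, ?_, ?_⟩ <;> rw [derivOn_const_smul]
  exacts [hf.2.1.const_smul a, hf.2.2.const_smul a]

lemma zero : MemSobolev m 2 0 := by
  refine ⟨contDiffOn_const, ?_, ?_⟩ <;> rw [derivOn_fun_zero]
  exacts [contDiffOn_const.absolutelyContinuousOnInterval, MemLp.zero]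

end MemSobolev

lemma sobolevNorm_sq {m : ℕ} {lam : ℝ} (hl : 0 ≤ lam) (f : ℝ → ℝ) :
    sobolevNorm m lam f ^ 2 = sqNorm f + lam * sqNorm (derivOn m f) :=
  Real.sq_sqrt (add_nonneg (sqNorm_nonneg f) (mul_nonneg hl (sqNorm_nonneg _)))

lemma sobolevNorm_nonneg (m : ℕ) (lam : ℝ) (f : ℝ → ℝ) : 0 ≤ sobolevNorm m lam f :=
  Real.sqrt_nonneg _

namespace MemSobolev

lemma exists_sqNorm_derivOn_one_le (k : ℕ) : ∃ C ≥ 1, ∀ f : ℝ → ℝ, MemSobolev (k + 1) 2 f →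
    ∀ s : ℝ, 0 < s → s ≤ 1 → s ^ 2 * sqNorm (derivOn 1 f) ≤
      C * (sqNorm f + s ^ (2 * (k + 1)) * sqNorm (derivOn (k + 1) f)) := by
  induction k with
  | zero =>
    refine ⟨1, le_rfl, fun f _ s _ _ => ?_⟩
    simpa using sqNorm_nonneg f
  | succ k ih =>
    obtain ⟨C, hC1, hC⟩ := ih
    refine ⟨96000 * C ^ 2, by nlinarith, fun f hf s hs hs1 => ?_⟩
    have hf' := (memSobolev_add_two_iff.1 hf).2
    have hη : s / (2 * C) ≤ 1 := by rw [div_le_one (by positivity)]; linarith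
    have hIH := hC _ hf' s hs hs1
    have hinterp := (hf.hasL2Deriv (by omega)).sqNorm_deriv_le (hf'.hasL2Deriv (by omega))
      (s := s / (2 * C)) (by positivity) hη
    rw [← derivOn_succ' (k + 1)] at hIH
    set A := sqNorm f
    set B := sqNorm (derivOn 1 f)
    set E := sqNorm (derivOn 1 (derivOn 1 f))
    set G := s ^ (2 * (k + 1)) * sqNorm (derivOn (k + 1 + 1) f) with hG
    have hB : 0 ≤ B := sqNorm_nonneg _
    have hG0 : 0 ≤ G := mul_nonneg (by positivity) (sqNorm_nonneg _)
    have hlower : s ^ 2 * B ≤ 48000 * C ^ 2 * A + s ^ 2 * (s ^ 2 * E) / (4 * C ^ 2) :=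
      calc s ^ 2 * B
          ≤ s ^ 2 * (12000 / (s / (2 * C)) ^ 2 * A + (s / (2 * C)) ^ 2 * E) := by gcongr
        _ = _ := by field_simp; ring
    have hupper : s ^ 2 * (s ^ 2 * E) / (4 * C ^ 2) ≤ (s ^ 2 * B + s ^ 2 * G) / 4 :=
      calc s ^ 2 * (s ^ 2 * E) / (4 * C ^ 2) ≤ s ^ 2 * (C * (B + G)) / (4 * C ^ 2) := by gcongr
        _ = (s ^ 2 * B + s ^ 2 * G) / 4 / C := by field_simp
        _ ≤ (s ^ 2 * B + s ^ 2 * G) / 4 := div_le_self (by positivity) hC1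
    have hsG : s ^ (2 * (k + 1 + 1)) * sqNorm (derivOn (k + 1 + 1) f) = s ^ 2 * G := by
      rw [hG]; ring
    have hGC : s ^ 2 * G ≤ C ^ 2 * (s ^ 2 * G) := le_mul_of_one_le_left (by positivity)
      (one_le_pow₀ hC1)
    rw [hsG]
    linarith [mul_nonneg (sq_nonneg s) hB, mul_nonneg (sq_nonneg s) hG0]

lemma exists_sobolevNorm_one_le {m : ℕ} (hm : 1 ≤ m) : ∃ C ≥ 1, ∀ f : ℝ → ℝ,
    MemSobolev m 2 f → ∀ s : ℝ, 0 < s → s ≤ 1 →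
      sobolevNorm 1 (s ^ 2) f ≤ C * sobolevNorm m (s ^ (2 * m)) f := by
  obtain ⟨k, rfl⟩ := Nat.exists_eq_add_of_le' hm
  obtain ⟨C, hC1, hC⟩ := exists_sqNorm_derivOn_one_le k
  refine ⟨C + 1, by linarith, fun f hf s hs hs1 => ?_⟩
  have hN := sobolevNorm_nonneg (k + 1) (s ^ (2 * (k + 1))) f
  refine abs_le_of_sq_le_sq' ?_ (by positivity) |>.2
  rw [mul_pow, sobolevNorm_sq (by positivity), sobolevNorm_sq (by positivity)]
  have hderiv := hC f hf s hs hs1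
  have hsq : 0 ≤ s ^ (2 * (k + 1)) * sqNorm (derivOn (k + 1) f) :=
    mul_nonneg (by positivity) (sqNorm_nonneg _)
  calc sqNorm f + s ^ 2 * sqNorm (derivOn 1 f)
      ≤ (C + 1) * (sqNorm f + s ^ (2 * (k + 1)) * sqNorm (derivOn (k + 1) f)) := by linarith
    _ ≤ (C + 1) ^ 2 * (sqNorm f + s ^ (2 * (k + 1)) * sqNorm (derivOn (k + 1) f)) := by
        gcongr
        · exact add_nonneg (sqNorm_nonneg f) hsq
        · nlinarith

lemma abs_le_sobolevNorm_one {f : ℝ → ℝ} (hf : MemSobolev 1 2 f) {t : ℝ}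
    (ht : t ∈ Icc (0 : ℝ) 1) {s : ℝ} (hs : 0 < s) (hs1 : s ≤ 1) :
    |f t| ≤ √(2 / s) * sobolevNorm 1 (s ^ 2) f := by
  rw [sobolevNorm, ← Real.sqrt_mul (by positivity)]
  exact Real.abs_le_sqrt ((memSobolev_one_iff.1 hf).sq_le_of_scale ht hs hs1)

lemma sobolevNorm_one_sq_le {f : ℝ → ℝ} (hf : MemSobolev 1 2 f) {s : ℝ} (hs : 0 < s)
    (hs1 : s ≤ 1) : sobolevNorm 1 (s ^ 2) (fun x => f x ^ 2) ≤
      2 * √(2 / s) * sobolevNorm 1 (s ^ 2) f ^ 2 := by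
  have h := memSobolev_one_iff.1 hf
  set N := sobolevNorm 1 (s ^ 2) f
  set b := √(2 / s) * N with hb
  have hb0 : 0 ≤ b := mul_nonneg (Real.sqrt_nonneg _) (sobolevNorm_nonneg _ _ _)
  have sqNorm_mul_le : ∀ g : ℝ → ℝ, MemLp g 2 unitVolume →
      sqNorm (fun x => f x * g x) ≤ b ^ 2 * sqNorm g := fun g hg => by
    rw [sqNorm, sqNorm, ← integral_const_mul]
    refine integral_mono_of_nonneg (ae_of_all _ fun x => sq_nonneg _)
      (hg.integrable_sq.const_mul _) (ae_unitVolume_of_forall_mem fun x hx => ?_)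
    simp only [mul_pow]
    gcongr ?_ * _
    exact sq_le_sq.2 ((hf.abs_le_sobolevNorm_one hx hs hs1).trans (le_abs_self b))
  have hsq : sqNorm (fun x => f x ^ 2) ≤ b ^ 2 * sqNorm f := by
    simpa only [pow_two] using sqNorm_mul_le f (h.memLp 2)
  have hderiv : sqNorm (derivOn 1 fun x => f x ^ 2) ≤ 4 * (b ^ 2 * sqNorm (derivOn 1 f)) := by
    rw [sqNorm_congr h.sq.derivOn_ae_eq]
    simp only [sqNorm, mul_pow (2 : ℝ), integral_const_mul]
    norm_num
    exact sqNorm_mul_le _ h.memLp_deriv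
  rw [show 2 * √(2 / s) * N ^ 2 = 2 * b * N by rw [hb]; ring]
  refine abs_le_of_sq_le_sq' ?_ (by positivity [sobolevNorm_nonneg 1 (s ^ 2) f]) |>.2
  rw [mul_pow, sobolevNorm_sq (sq_nonneg s), sobolevNorm_sq (sq_nonneg s)]
  nlinarith [mul_nonneg (sq_nonneg b) (sqNorm_nonneg f), mul_le_mul_of_nonneg_left hderiv
    (sq_nonneg s)]

end MemSobolev

/-- The space `W^{m,2}([0,1])` of functions as in `MemSobolev`; its elements are functions on
`ℝ`, of which only the restriction to `[0,1]` matters. -/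
def sobolevSpace (m : ℕ) : Submodule ℝ (ℝ → ℝ) where
  carrier := {f | MemSobolev m 2 f}
  add_mem' hf hg := (hf.add hg).1
  zero_mem' := MemSobolev.zero
  smul_mem' a _ hf := hf.const_smul a

/-- The Hilbert space `L²([0,1])`. -/
abbrev UnitL2 : Type := Lp ℝ 2 unitVolume

namespace sobolevSpace

variable {m : ℕ}

/-- The inclusion of `W^{m,2}([0,1])` into `L²([0,1])`. -/
def toL2 (m : ℕ) : sobolevSpace m →ₗ[ℝ] UnitL2 where
  toFun f := f.2.memLp.toLp f
  map_add' _ _ := rfl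
  map_smul' _ _ := rfl

/-- The derivative of order `m`, from `W^{m,2}([0,1])` to `L²([0,1])`. -/
def derivL2 (m : ℕ) : sobolevSpace m →ₗ[ℝ] UnitL2 where
  toFun f := f.2.2.2.toLp (derivOn m f)
  map_add' f g := by
    rw [← MemLp.toLp_add, MemLp.toLp_eq_toLp_iff]
    exact (f.2.add g.2).2
  map_smul' a f := by
    rw [RingHom.id_apply, ← MemLp.toLp_const_smul, MemLp.toLp_eq_toLp_iff]
    exact .of_eq (derivOn_const_smul m a f)

/-- The map `f ↦ (f, lam^{1/2} f^{(m)})`, an isometric realization of the norm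
`‖·‖_{m,lam}` in a Hilbert space. -/
def embedding (m : ℕ) (lam : ℝ) : sobolevSpace m →ₗ[ℝ] WithLp 2 (UnitL2 × UnitL2) :=
  (WithLp.linearEquiv 2 ℝ (UnitL2 × UnitL2)).symm.toLinearMap ∘ₗ
    (toL2 m).prod (√lam • derivL2 m)

end sobolevSpace

lemma sq_norm_toLp_unitVolume {f : ℝ → ℝ} (hf : MemLp f 2 unitVolume) :
    ‖hf.toLp f‖ ^ 2 = sqNorm f := by
  rw [← real_inner_self_eq_norm_sq, L2.inner_def]
  refine integral_congr_ae ?_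
  filter_upwards [hf.coeFn_toLp] with x hx
  rw [hx, real_inner_self_eq_norm_sq, Real.norm_eq_abs, sq_abs]

namespace sobolevSpace

variable {m : ℕ}

lemma coeFn_toL2 (f : sobolevSpace m) : toL2 m f =ᵐ[unitVolume] f := f.2.memLp.coeFn_toLp

lemma coeFn_derivL2 (f : sobolevSpace m) : derivL2 m f =ᵐ[unitVolume] derivOn m f :=
  f.2.2.2.coeFn_toLp

lemma derivL2_eq_of_ae {k : ℕ} {f : sobolevSpace m} {g : sobolevSpace k}
    (h : derivOn m f =ᵐ[unitVolume] derivOn k g) : derivL2 m f = derivL2 k g :=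
  Lp.ext ((coeFn_derivL2 f).trans (h.trans (coeFn_derivL2 g).symm))

lemma sq_norm_snd_embedding {lam : ℝ} (hl : 0 ≤ lam) (f : sobolevSpace m) :
    ‖(embedding m lam f).snd‖ ^ 2 = lam * sqNorm (derivOn m f) := by
  change ‖√lam • derivL2 m f‖ ^ 2 = _
  rw [norm_smul, mul_pow, derivL2, LinearMap.coe_mk, AddHom.coe_mk, sq_norm_toLp_unitVolume,
    Real.norm_eq_abs, sq_abs, Real.sq_sqrt hl]

lemma norm_embedding {lam : ℝ} (hl : 0 ≤ lam) (f : sobolevSpace m) :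
    ‖embedding m lam f‖ = sobolevNorm m lam f := by
  rw [← sq_eq_sq₀ (norm_nonneg _) (sobolevNorm_nonneg _ _ _), sobolevNorm_sq hl,
    WithLp.prod_norm_sq_eq_of_L2, sq_norm_snd_embedding hl]
  exact congrArg (· + _) (sq_norm_toLp_unitVolume f.2.memLp)

end sobolevSpace

lemma HasL2Deriv.exists_of_tendsto {f p : ℕ → ℝ → ℝ} (h : ∀ j, HasL2Deriv (f j) (p j))
    {F P : UnitL2} (hF : Tendsto (fun j => ((h j).memLp 2).toLp (f j)) atTop (𝓝 F))
    (hP : Tendsto (fun j => (h j).memLp_deriv.toLp (p j)) atTop (𝓝 P)) :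
    ∃ f' : ℝ → ℝ, HasL2Deriv f' P ∧ f' =ᵐ[unitVolume] F := by
  have tendsto_integral : ∀ x ∈ Icc (0 : ℝ) 1,
      Tendsto (fun j => ∫ z in (0 : ℝ)..x, p j z) atTop (𝓝 (∫ z in (0 : ℝ)..x, P z)) := by
    intro x hx
    have inner_indicator (q : UnitL2) : inner ℝ (indicatorConstLp 2
        (measurableSet_Ioc (a := 0) (b := x)) (measure_ne_top unitVolume _) (1 : ℝ)) q =
        ∫ z in (0 : ℝ)..x, q z := by
      rw [L2.inner_indicatorConstLp_one, Measure.restrict_restrict measurableSet_Ioc,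
        inter_eq_left.2 (Ioc_subset_Icc_self.trans (Icc_subset_Icc_right hx.2)),
        intervalIntegral.integral_of_le hx.1]
    have hinner := (tendsto_const_nhds (x := indicatorConstLp 2
      (measurableSet_Ioc (a := 0) (b := x)) (measure_ne_top unitVolume _) (1 : ℝ))).inner
      (𝕜 := ℝ) hP
    simp only [inner_indicator] at hinner
    refine hinner.congr fun j => intervalIntegral.integral_congr_ae ?_
    filter_upwards [(ae_restrict_iff' measurableSet_Icc).1 (h j).memLp_deriv.coeFn_toLp]
      with z hz hmem
    exact hz (uIcc_subset_Icc (by simp) hx (uIoc_subset_uIcc hmem))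
  obtain ⟨φ, hφ, hlim⟩ := (tendstoInMeasure_of_tendsto_Lp hF).exists_seq_tendsto_ae
  have htendsto : ∀ᵐ x ∂unitVolume, Tendsto (fun j => f (φ j) x) atTop (𝓝 (F x)) := by
    have hcoe : ∀ᵐ x ∂unitVolume, ∀ j, (((h j).memLp 2).toLp (f j)) x = f j x :=
      ae_all_iff.2 fun j => ((h j).memLp 2).coeFn_toLp
    filter_upwards [hlim, hcoe] with x hx hxj
    simpa only [hxj] using hx
  have hinit : ∀ᵐ x ∂unitVolume,
      Tendsto (fun j => f (φ j) 0) atTop (𝓝 (F x - ∫ z in (0 : ℝ)..x, P z)) := by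
    filter_upwards [htendsto, ae_restrict_mem measurableSet_Icc] with x hx hmem
    refine (hx.sub ((tendsto_integral x hmem).comp hφ.tendsto_atTop)).congr fun j => ?_
    simp [(h (φ j)).integral_eq_sub (left_mem_Icc.2 zero_le_one) hmem]
  obtain ⟨x₀, hx₀⟩ := hinit.exists
  refine ⟨_, const_add_integral (Lp.memLp P) (F x₀ - ∫ z in (0 : ℝ)..x₀, P z), ?_⟩
  filter_upwards [hinit] with x hx
  rw [tendsto_nhds_unique hx₀ hx, sub_add_cancel]

namespace sobolevSpace

/-- The derivative `f ↦ f'` from `W^{k+2,2}([0,1])` to `W^{k+1,2}([0,1])`. It is linear only up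
to the values outside `[0,1]`. -/
def derivFun {k : ℕ} (f : sobolevSpace (k + 2)) : sobolevSpace (k + 1) :=
  ⟨derivOn 1 f, (memSobolev_add_two_iff.1 f.2).2⟩

lemma exists_norm_toL2_derivFun_sub_le (k : ℕ) : ∃ C : ℝ, ∀ f g : sobolevSpace (k + 2),
    ‖toL2 (k + 1) (derivFun f) - toL2 (k + 1) (derivFun g)‖ ≤
    C * (‖toL2 (k + 2) f - toL2 (k + 2) g‖ + ‖derivL2 (k + 2) f - derivL2 (k + 2) g‖) := by
  obtain ⟨C, hC1, hC⟩ := MemSobolev.exists_sqNorm_derivOn_one_le (k + 1)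
  refine ⟨C, fun f g => ?_⟩
  have hf := f.2.hasL2Deriv (by omega)
  have hg := g.2.hasL2Deriv (by omega)
  have hsub : derivOn 1 (f - g : sobolevSpace (k + 2)) =ᵐ[unitVolume]
      derivOn 1 f - derivOn 1 g := by
    simpa [sub_eq_add_neg] using (hf.add (hg.const_smul (-1))).derivOn_ae_eq
  have hle := hC _ (f - g).2 1 one_pos le_rfl
  rw [sqNorm_congr hsub, ← sq_norm_toLp_unitVolume (hf.memLp_deriv.sub hg.memLp_deriv),
    hf.memLp_deriv.toLp_sub hg.memLp_deriv, ← sq_norm_toLp_unitVolume (f - g).2.memLp,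
    ← sq_norm_toLp_unitVolume (f - g).2.2.2, one_pow, one_pow, one_mul, one_mul] at hle
  change ‖toL2 (k + 1) (derivFun f) - toL2 (k + 1) (derivFun g)‖ ^ 2 ≤
    C * (‖toL2 (k + 2) (f - g)‖ ^ 2 + ‖derivL2 (k + 2) (f - g)‖ ^ 2) at hle
  rw [map_sub, map_sub] at hle
  refine abs_le_of_sq_le_sq' (hle.trans ?_) (by positivity) |>.2
  rw [mul_pow]
  gcongr
  · exact le_self_pow₀ hC1 two_ne_zero
  · exact pow_add_pow_le (norm_nonneg _) (norm_nonneg _) two_ne_zero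

lemma exists_toL2_eq_and_derivL2_eq_of_tendsto (k : ℕ) (g : ℕ → sobolevSpace (k + 1))
    {F P : UnitL2} (hF : Tendsto (fun j => toL2 (k + 1) (g j)) atTop (𝓝 F))
    (hP : Tendsto (fun j => derivL2 (k + 1) (g j)) atTop (𝓝 P)) :
    ∃ G : sobolevSpace (k + 1), toL2 (k + 1) G = F ∧ derivL2 (k + 1) G = P := by
  induction k generalizing F P with
  | zero =>
    obtain ⟨G, hG, hGF⟩ :=
      HasL2Deriv.exists_of_tendsto (fun j => memSobolev_one_iff.1 (g j).2) hF hP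
    refine ⟨⟨G, memSobolev_one_iff.2 hG.hasL2Deriv_derivOn⟩, ?_, ?_⟩
    · exact Lp.ext ((coeFn_toL2 _).trans hGF)
    · exact Lp.ext ((coeFn_derivL2 _).trans hG.derivOn_ae_eq)
  | succ k ih =>
    obtain ⟨C, hC⟩ := exists_norm_toL2_derivFun_sub_le k
    have hcauchy : CauchySeq fun j => toL2 (k + 1) (derivFun (g j)) := by
      have h0 := cauchySeq_iff_tendsto_dist_atTop_0.1 hF.cauchySeq
      have h1 := cauchySeq_iff_tendsto_dist_atTop_0.1 hP.cauchySeq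
      refine cauchySeq_iff_tendsto_dist_atTop_0.2 (squeeze_zero (fun _ => dist_nonneg)
        (fun j => ?_) (by simpa using (h0.add h1).const_mul C))
      simpa only [dist_eq_norm] using hC (g j.1) (g j.2)
    obtain ⟨F', hF'⟩ := cauchySeq_tendsto_of_complete hcauchy
    have hderiv (f : sobolevSpace (k + 2)) : derivL2 (k + 1) (derivFun f) = derivL2 (k + 2) f :=
      derivL2_eq_of_ae (.of_eq (derivOn_succ' (k + 1) f).symm)
    obtain ⟨G', hG'F, hG'P⟩ := ih (fun j => derivFun (g j)) hF' (by simpa only [hderiv] using hP)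
    obtain ⟨G, hG, hGF⟩ :=
      HasL2Deriv.exists_of_tendsto (fun j => (g j).2.hasL2Deriv (by omega)) hF hF'
    have hG' : HasL2Deriv G G' := hG.congr (eqOn_refl _ _)
      ((Lp.ext_iff.1 hG'F).symm.trans (coeFn_toL2 _))
    have hwithin {x : ℝ} (hx : x ∈ Icc (0 : ℝ) 1) :
        HasDerivWithinAt G ((G' : ℝ → ℝ) x) (Icc 0 1) x :=
      hG'.hasDerivWithinAt G'.2.1.continuousOn hx
    have heq : EqOn G' (derivOn 1 G) (Icc 0 1) := fun x hx => by
      rw [derivOn_one, (hwithin hx).derivWithin (uniqueDiffOn_unitInterval x hx)]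
    have hmem : MemSobolev (k + 2) 2 G := memSobolev_add_two_iff.2
      ⟨fun x hx => (hwithin hx).differentiableWithinAt, G'.2.congr heq⟩
    refine ⟨⟨G, hmem⟩, Lp.ext ((coeFn_toL2 _).trans hGF), ?_⟩
    rw [← hG'P, ← hderiv]
    exact derivL2_eq_of_ae
      (ae_unitVolume_of_forall_mem fun x hx => (derivOn_congr heq (k + 1) hx).symm)

lemma isClosed_range_embedding {m : ℕ} (hm : 1 ≤ m) {lam : ℝ} (hl : 0 < lam) :
    IsClosed (LinearMap.range (embedding m lam) : Set (WithLp 2 (UnitL2 × UnitL2))) := by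
  obtain ⟨k, rfl⟩ := Nat.exists_eq_add_of_le' hm
  refine isClosed_of_closure_subset fun z hz => ?_
  obtain ⟨x, hx, hxz⟩ := mem_closure_iff_seq_limit.1 hz
  choose g hg using hx
  obtain rfl := funext hg
  have hsl : √lam ≠ 0 := (Real.sqrt_pos.2 hl).ne'
  have hfst : Tendsto (fun j => toL2 (k + 1) (g j)) atTop (𝓝 z.fst) :=
    ((WithLp.continuous_fst _ _ _).tendsto z).comp hxz
  have hsnd : Tendsto (fun j => √lam • derivL2 (k + 1) (g j)) atTop (𝓝 z.snd) :=
    ((WithLp.continuous_snd _ _ _).tendsto z).comp hxz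
  obtain ⟨G, hG, hG'⟩ := exists_toL2_eq_and_derivL2_eq_of_tendsto k g hfst
    (by simpa only [inv_smul_smul₀ hsl] using hsnd.const_smul (√lam)⁻¹)
  refine ⟨G, ?_⟩
  change WithLp.toLp 2 (toL2 (k + 1) G, √lam • derivL2 (k + 1) G) = z
  rw [hG, hG', smul_inv_smul₀ hsl]
  rfl

end sobolevSpace

section Hilbert

lemma sq_norm_le_iff_forall_inner {E : Type*} [NormedAddCommGroup E] [InnerProductSpace ℝ E]
    {x : E} {c : ℝ} :
    ‖x‖ ^ 2 ≤ c ↔ ∀ y : E, 2 * inner ℝ x y - ‖y‖ ^ 2 ≤ c := by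
  refine ⟨fun h y => ?_, fun h => ?_⟩
  · linarith [norm_sub_sq_real x y, sq_nonneg ‖x - y‖]
  · linarith [h x, real_inner_self_eq_norm_sq x]

variable {V H X Y : Type*} [AddCommGroup V] [Module ℝ V]
  [NormedAddCommGroup H] [InnerProductSpace ℝ H] [CompleteSpace H]
  [NormedAddCommGroup X] [InnerProductSpace ℝ X] [CompleteSpace X]
  [NormedAddCommGroup Y] [InnerProductSpace ℝ Y] [CompleteSpace Y]

lemma exists_norm_le_inner_eq (T : V →ₗ[ℝ] H) (φ : V →ₗ[ℝ] ℝ) {C : ℝ} (hC : 0 ≤ C)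
    (hφ : ∀ v, |φ v| ≤ C * ‖T v‖) : ∃ e : H, ‖e‖ ≤ C ∧ ∀ v, inner ℝ e (T v) = φ v := by
  have hker : LinearMap.ker T ≤ LinearMap.ker φ := fun v hv => by
    have hle := hφ v
    rwa [LinearMap.mem_ker.1 hv, norm_zero, mul_zero, abs_nonpos_iff] at hle
  let ψ : LinearMap.range T →ₗ[ℝ] ℝ :=
    (LinearMap.ker T).liftQ φ hker ∘ₗ T.quotKerEquivRange.symm.toLinearMap
  have hψ (v : V) : ψ ⟨T v, v, rfl⟩ = φ v :=
    congrArg ((LinearMap.ker T).liftQ φ hker) (T.quotKerEquivRange_symm_apply_image v _)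
  have hbound : ∀ x, ‖ψ x‖ ≤ C * ‖x‖ := by
    rintro ⟨_, v, rfl⟩
    exact hψ v ▸ hφ v
  obtain ⟨ξ, hξ, hξnorm⟩ := exists_extension_norm_eq _ (ψ.mkContinuous C hbound)
  refine ⟨(InnerProductSpace.toDual ℝ H).symm ξ, ?_, fun v => ?_⟩
  · rw [LinearIsometryEquiv.norm_map, hξnorm]
    exact ψ.mkContinuous_norm_le hC hbound
  · rw [InnerProductSpace.toDual_symm_apply, ← hψ]
    exact hξ ⟨T v, v, rfl⟩

/-- The vector representing a bounded linear functional, as a map from the dual space with its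
weak-* topology, in which balls are compact. -/
def rieszVector (ξ : WeakDual ℝ X) : X :=
  (InnerProductSpace.toDual ℝ X).symm (WeakDual.toStrongDual ξ)

lemma continuous_inner_rieszVector (v : X) : Continuous fun ξ => inner ℝ (rieszVector ξ) v := by
  simp only [rieszVector, InnerProductSpace.toDual_symm_apply]
  exact WeakDual.eval_continuous v

lemma lowerSemicontinuous_sq_norm_rieszVector (A : X →L[ℝ] Y) :
    LowerSemicontinuous fun ξ => ‖A (rieszVector ξ)‖ ^ 2 := by
  refine lowerSemicontinuous_iff_isClosed_preimage.2 fun c => ?_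
  simp only [preimage, mem_Iic, sq_norm_le_iff_forall_inner, ofPred_forall,
    ← ContinuousLinearMap.adjoint_inner_right]
  exact isClosed_iInter fun y => isClosed_le
    (((continuous_inner_rieszVector _).const_mul 2).sub continuous_const) continuous_const

lemma exists_isMinOn_closedBall {ι : Type*} (φ : ι → X →L[ℝ] ℝ) {Φ : (ι → ℝ) → ℝ}
    (hΦ : Continuous Φ) (A : X →L[ℝ] Y) (x₀ : X) {R : ℝ} (hR : 0 ≤ R) :
    ∃ x ∈ Metric.closedBall x₀ R,
      IsMinOn (fun x => Φ (fun i => φ i x) + ‖A x‖ ^ 2) (Metric.closedBall x₀ R) x := by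
  let D := InnerProductSpace.toDual ℝ X
  let K : Set (WeakDual ℝ X) := WeakDual.toStrongDual ⁻¹' Metric.closedBall (D x₀) R
  have hK (x : X) : StrongDual.toWeakDual (D x) ∈ K ↔ x ∈ Metric.closedBall x₀ R := by
    change dist (D x) (D x₀) ≤ R ↔ _
    rw [D.dist_map, Metric.mem_closedBall]
  have hφ (i : ι) : Continuous fun ξ : WeakDual ℝ X => φ i (rieszVector ξ) :=
    (continuous_inner_rieszVector (D.symm (φ i))).congr fun ξ => by
      rw [real_inner_comm, InnerProductSpace.toDual_symm_apply]
  obtain ⟨ξ, hξ, hmin⟩ := ((hΦ.comp (continuous_pi hφ)).lowerSemicontinuous.add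
    (lowerSemicontinuous_sq_norm_rieszVector A)).lowerSemicontinuousOn K |>.exists_isMinOn
    ⟨_, (hK x₀).2 (Metric.mem_closedBall_self hR)⟩ (WeakDual.isCompact_closedBall (D x₀) R)
  refine ⟨rieszVector ξ, (hK _).1 (by simpa [D, rieszVector] using hξ), fun x hx => ?_⟩
  simpa [D, rieszVector] using hmin ((hK x).2 hx)

end Hilbert

lemma MemSobolev.exists_abs_le_sobolevNorm {m : ℕ} (hm : 1 ≤ m) {lam : ℝ} (hl : 0 < lam) :
    ∃ C ≥ 0, ∀ f : ℝ → ℝ, MemSobolev m 2 f → ∀ t ∈ Icc (0 : ℝ) 1,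
      |f t| ≤ C * sobolevNorm m lam f := by
  obtain ⟨C, hC1, hC⟩ := exists_sobolevNorm_one_le hm
  refine ⟨√(2 / 1) * (C * √(1 + 1 / lam)), by positivity, fun f hf t ht => ?_⟩
  have hscale : sobolevNorm m 1 f ≤ √(1 + 1 / lam) * sobolevNorm m lam f := by
    rw [sobolevNorm, sobolevNorm, ← Real.sqrt_mul (by positivity)]
    refine Real.sqrt_le_sqrt ?_
    have h0 : 0 ≤ 1 / lam * sqNorm f := mul_nonneg (by positivity) (sqNorm_nonneg f)
    have h1 : 0 ≤ lam * sqNorm (derivOn m f) := mul_nonneg hl.le (sqNorm_nonneg _)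
    calc sqNorm f + 1 * sqNorm (derivOn m f)
        ≤ sqNorm f + 1 * sqNorm (derivOn m f) +
          (1 / lam * sqNorm f + lam * sqNorm (derivOn m f)) := by linarith
      _ = (1 + 1 / lam) * (sqNorm f + lam * sqNorm (derivOn m f)) := by field_simp; ring
  have hmem : MemSobolev 1 2 f := memSobolev_one_iff.2 (hf.hasL2Deriv hm)
  calc |f t| ≤ √(2 / 1) * sobolevNorm 1 (1 ^ 2) f :=
        hmem.abs_le_sobolevNorm_one ht one_pos le_rfl
    _ ≤ √(2 / 1) * (C * (√(1 + 1 / lam) * sobolevNorm m lam f)) := by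
        gcongr
        refine (hC f hf 1 one_pos le_rfl).trans ?_
        rw [one_pow]
        gcongr
    _ = √(2 / 1) * (C * √(1 + 1 / lam)) * sobolevNorm m lam f := by ring

/-- The vectors `e i` represent the evaluations at `t i` on `W^{1,2}([0,1])` with the norm
`‖·‖_{1,s²}`: they obey the bound `√(2 / s)` for the norms of these evaluations, and linear
combinations of evaluations are bounded by those of the `e i`. -/
structure IsEvaluationFamily {ι H : Type*} [Fintype ι] [NormedAddCommGroup H] [NormedSpace ℝ H]
    (s : ℝ) (t : ι → ℝ) (e : ι → H) : Prop where
  norm_le : ∀ i, ‖e i‖ ≤ √(2 / s)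
  abs_sum_le : ∀ (c : ι → ℝ) (f : ℝ → ℝ), MemSobolev 1 2 f →
    |∑ i, c i * f (t i)| ≤ ‖∑ i, c i • e i‖ * sobolevNorm 1 (s ^ 2) f

namespace sobolevSpace

/-- Evaluation at the point `t`. -/
def eval (m : ℕ) (t : ℝ) : sobolevSpace m →ₗ[ℝ] ℝ :=
  LinearMap.proj t ∘ₗ (sobolevSpace m).subtype

lemma exists_isEvaluationFamily {ι : Type*} [Fintype ι] {t : ι → ℝ}
    (ht : ∀ i, t i ∈ Icc (0 : ℝ) 1) {s : ℝ} (hs : 0 < s) (hs1 : s ≤ 1) :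
    ∃ e : ι → WithLp 2 (UnitL2 × UnitL2), IsEvaluationFamily s t e := by
  have hbound (i : ι) (f : sobolevSpace 1) :
      |eval 1 (t i) f| ≤ √(2 / s) * ‖embedding 1 (s ^ 2) f‖ := by
    rw [norm_embedding (sq_nonneg s)]
    exact f.2.abs_le_sobolevNorm_one (ht i) hs hs1
  choose e he heval using fun i =>
    exists_norm_le_inner_eq (embedding 1 (s ^ 2)) (eval 1 (t i)) (Real.sqrt_nonneg _) (hbound i)
  refine ⟨e, he, fun c f hf => ?_⟩
  have hsum : ∑ i, c i * f (t i) =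
      inner ℝ (∑ i, c i • e i) (embedding 1 (s ^ 2) ⟨f, hf⟩) := by
    simp only [sum_inner, real_inner_smul_left, heval]
    rfl
  rw [hsum, ← norm_embedding (sq_nonneg s) ⟨f, hf⟩]
  exact abs_real_inner_le_norm _ _

lemma exists_forall_penalized_le {m : ℕ} (hm : 1 ≤ m) {lam R : ℝ} (hl : 0 < lam) (hR : 0 ≤ R)
    {ι : Type*} {t : ι → ℝ} (ht : ∀ i, t i ∈ Icc (0 : ℝ) 1) {Φ : (ι → ℝ) → ℝ}
    (hΦ : Continuous Φ) {g₀ : ℝ → ℝ} (hg₀ : MemSobolev m 2 g₀) :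
    ∃ g, MemSobolev m 2 g ∧ sobolevNorm m lam (g - g₀) ≤ R ∧
      ∀ h, MemSobolev m 2 h → sobolevNorm m lam (h - g₀) ≤ R →
        Φ (fun i => g (t i)) + lam * sqNorm (derivOn m g) ≤
          Φ (fun i => h (t i)) + lam * sqNorm (derivOn m h) := by
  let X := LinearMap.range (embedding m lam)
  have : CompleteSpace X := (isClosed_range_embedding hm hl).completeSpace_coe
  obtain ⟨C, hC0, hC⟩ := MemSobolev.exists_abs_le_sobolevNorm hm hl
  choose e _ heval using fun i => exists_norm_le_inner_eq (embedding m lam) (eval m (t i)) hC0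
    fun f => by
      rw [norm_embedding hl.le]
      exact hC f f.2 (t i) (ht i)
  let toX (f : sobolevSpace m) : X := ⟨embedding m lam f, f, rfl⟩
  have hdist (f g : sobolevSpace m) : dist (toX f) (toX g) = sobolevNorm m lam (f - g) := by
    rw [Subtype.dist_eq, dist_eq_norm, ← map_sub, norm_embedding hl.le]
    rfl
  obtain ⟨⟨_, g, rfl⟩, hg, hmin⟩ := exists_isMinOn_closedBall
    (fun i => innerSL ℝ (e i) ∘L X.subtypeL) hΦ (WithLp.sndL 2 ℝ UnitL2 UnitL2 ∘L X.subtypeL)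
    (toX ⟨g₀, hg₀⟩) hR
  refine ⟨g, g.2, (hdist g ⟨g₀, hg₀⟩).symm.trans_le hg, fun h hh hhR => ?_⟩
  have hle := hmin (a := toX ⟨h, hh⟩) ((hdist ⟨h, hh⟩ ⟨g₀, hg₀⟩).trans_le hhR)
  simpa [-WithLp.prod_inner_apply, toX, heval, eval, sq_norm_snd_embedding hl.le] using hle

end sobolevSpace

namespace ExponentialFamily

variable (F : ExponentialFamily)

/-- A polynomial weight dominating the derivatives of the powers of the density. -/
def weight (y : ℝ) : ℝ := (1 + |y|) ^ 5

lemma one_le_weight (y : ℝ) : 1 ≤ weight y := one_le_pow₀ (by linarith [abs_nonneg y])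

lemma weight_nonneg (y : ℝ) : 0 ≤ weight y := zero_le_one.trans (one_le_weight y)

lemma measurable_weight : Measurable weight := by unfold weight; fun_prop

lemma density_of_mem {y : ℝ} (hy : y ∈ F.carrier) (θ : ℝ) :
    F.density θ y = Real.exp (y * θ - F.b θ + F.c y) := indicator_of_mem hy _

lemma density_of_notMem {y : ℝ} (hy : y ∉ F.carrier) (θ : ℝ) : F.density θ y = 0 :=
  indicator_of_notMem hy _

lemma density_nonneg (θ y : ℝ) : 0 ≤ F.density θ y :=
  indicator_nonneg (fun _ _ => (Real.exp_pos _).le) _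

lemma measurable_density (θ : ℝ) : Measurable (F.density θ) := by
  have := F.measurable_c
  exact Measurable.indicator (by fun_prop) F.measurableSet_carrier

lemma lintegral_density (θ : ℝ) : ∫⁻ y, ENNReal.ofReal (F.density θ y) ∂F.ref = 1 :=
  F.lintegral_eq_one θ

lemma integrable_density (θ : ℝ) : Integrable (F.density θ) F.ref := by
  refine ⟨(F.measurable_density θ).aestronglyMeasurable, ?_⟩
  rw [hasFiniteIntegral_iff_ofReal (ae_of_all _ (F.density_nonneg θ)), lintegral_density]
  exact ENNReal.one_lt_top

lemma integral_density (θ : ℝ) : ∫ y, F.density θ y ∂F.ref = 1 := by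
  rw [integral_eq_lintegral_of_nonneg_ae (ae_of_all _ (F.density_nonneg θ))
    (F.measurable_density θ).aestronglyMeasurable, lintegral_density, ENNReal.toReal_one]

instance isProbabilityMeasure_law (θ : ℝ) : IsProbabilityMeasure (F.law θ) :=
  ⟨by rw [law, withDensity_apply _ MeasurableSet.univ, setLIntegral_univ, lintegral_density]⟩

lemma integral_law (θ : ℝ) (g : ℝ → ℝ) :
    ∫ y, g y ∂F.law θ = ∫ y, F.density θ y * g y ∂F.ref := by
  rw [law, integral_withDensity_eq_integral_toReal_smul (F.measurable_density θ).ennreal_ofReal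
    (ae_of_all _ fun _ => ENNReal.ofReal_lt_top)]
  simp only [ENNReal.toReal_ofReal (F.density_nonneg θ _), smul_eq_mul]

lemma integrable_law_iff (θ : ℝ) (g : ℝ → ℝ) :
    Integrable g (F.law θ) ↔ Integrable (fun y => F.density θ y * g y) F.ref := by
  rw [law, integrable_withDensity_iff_integrable_smul' (F.measurable_density θ).ennreal_ofReal
    (ae_of_all _ fun _ => ENNReal.ofReal_lt_top)]
  simp only [ENNReal.toReal_ofReal (F.density_nonneg θ _), smul_eq_mul]

lemma density_eq_exp_mul (θ θ' y : ℝ) :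
    F.density θ y = Real.exp (y * (θ - θ') - F.b θ + F.b θ') * F.density θ' y := by
  by_cases hy : y ∈ F.carrier
  · rw [density_of_mem F hy, density_of_mem F hy, ← Real.exp_add]; ring_nf
  · rw [density_of_notMem F hy, density_of_notMem F hy, mul_zero]

lemma density_mul_exp (θ s y : ℝ) :
    F.density θ y * Real.exp (s * y) = Real.exp (F.b (θ + s) - F.b θ) * F.density (θ + s) y := by
  rw [F.density_eq_exp_mul (θ + s) θ, ← mul_assoc, ← Real.exp_add, mul_comm]
  congr 2; ring

lemma integrable_exp_law (θ s : ℝ) : Integrable (fun y => Real.exp (s * y)) (F.law θ) := by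
  rw [integrable_law_iff]
  simp only [density_mul_exp]
  exact (F.integrable_density _).const_mul _

lemma cgf_law_zero (θ : ℝ) : cgf id (F.law 0) θ = F.b θ - F.b 0 := by
  rw [cgf, mgf, integral_law]
  simp only [id, density_mul_exp, zero_add]
  rw [integral_const_mul, integral_density, mul_one, Real.log_exp]

lemma contDiff_b : ContDiff ℝ 3 F.b := by
  have h : integrableExpSet id (F.law 0) = univ :=
    eq_univ_of_forall fun s => F.integrable_exp_law 0 s
  have h1 : ∀ θ, AnalyticAt ℝ (cgf id (F.law 0)) θ := fun θ =>
    analyticAt_cgf (by rw [h, interior_univ]; trivial)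
  have h2 : F.b = fun θ => cgf id (F.law 0) θ + F.b 0 := by
    ext θ; rw [cgf_law_zero]; ring
  rw [h2]
  exact (contDiff_iff_contDiffAt.2 fun θ => (h1 θ).contDiffAt).add contDiff_const

/-- The derivative `b'`, which is the mean of `F_θ`. -/
def b₁ : ℝ → ℝ := deriv F.b

/-- The second derivative `b''`, which is the variance of `F_θ`. -/
def b₂ : ℝ → ℝ := deriv F.b₁

/-- The third derivative `b'''`. -/
def b₃ : ℝ → ℝ := deriv F.b₂

lemma contDiff_b₁ : ContDiff ℝ 2 F.b₁ :=
  (contDiff_succ_iff_deriv (n := 2).1 (by simpa using! F.contDiff_b)).2.2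

lemma contDiff_b₂ : ContDiff ℝ 1 F.b₂ :=
  (contDiff_succ_iff_deriv (n := 1).1 (by simpa using! F.contDiff_b₁)).2.2

lemma continuous_b₃ : Continuous F.b₃ := (contDiff_one_iff_deriv.1 F.contDiff_b₂).2

lemma hasDerivAt_b (θ : ℝ) : HasDerivAt F.b (F.b₁ θ) θ :=
  (F.contDiff_b.differentiable (by norm_num) θ).hasDerivAt

lemma hasDerivAt_b₁ (θ : ℝ) : HasDerivAt F.b₁ (F.b₂ θ) θ :=
  (F.contDiff_b₁.differentiable (by norm_num) θ).hasDerivAt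

lemma hasDerivAt_b₂ (θ : ℝ) : HasDerivAt F.b₂ (F.b₃ θ) θ :=
  (F.contDiff_b₂.differentiable (by norm_num) θ).hasDerivAt

lemma continuous_density (y : ℝ) : Continuous fun θ => F.density θ y := by
  have := F.contDiff_b.continuous
  by_cases hy : y ∈ F.carrier
  · simp only [density_of_mem F hy]; fun_prop
  · simp only [density_of_notMem F hy]; fun_prop

lemma score_of_mem {y : ℝ} (hy : y ∈ F.carrier) (θ : ℝ) : F.score θ y = y - F.b₁ θ := by
  simp only [score, density_of_mem F hy, Real.log_exp]
  have := (((hasDerivAt_id θ).const_mul y).sub (F.hasDerivAt_b θ)).add_const (F.c y)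
  simpa using this.deriv

lemma exists_density_le (A₁ A₂ : ℝ) : ∃ C : ℝ, 0 ≤ C ∧ ∀ θ ∈ Icc A₁ A₂, ∀ y,
    F.density θ y ≤ C * (F.density A₁ y + F.density A₂ y) := by
  obtain ⟨M, hM⟩ := isCompact_Icc.exists_bound_of_continuousOn
    (F.contDiff_b.continuous.continuousOn (s := Icc A₁ A₂))
  refine ⟨Real.exp (2 * M), (Real.exp_pos _).le, fun θ hθ y => ?_⟩
  have h1 := F.density_nonneg A₁ y
  have h2 := F.density_nonneg A₂ y
  have hA : A₁ ≤ A₂ := hθ.1.trans hθ.2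
  have m0 := abs_le.1 (hM θ hθ)
  have m1 := abs_le.1 (hM A₁ ⟨le_rfl, hA⟩)
  have m2 := abs_le.1 (hM A₂ ⟨hA, le_rfl⟩)
  have hC := (Real.exp_pos (2 * M)).le
  rw [mul_add]
  rcases le_total y 0 with hy | hy
  · rw [F.density_eq_exp_mul θ A₁]
    have : Real.exp (y * (θ - A₁) - F.b θ + F.b A₁) ≤ Real.exp (2 * M) := by
      apply Real.exp_le_exp.2
      have := mul_nonpos_of_nonpos_of_nonneg hy (sub_nonneg.2 hθ.1)
      linarith [m0.1, m1.2]
    nlinarith [mul_le_mul_of_nonneg_right this h1, mul_nonneg hC h2]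
  · rw [F.density_eq_exp_mul θ A₂]
    have : Real.exp (y * (θ - A₂) - F.b θ + F.b A₂) ≤ Real.exp (2 * M) := by
      apply Real.exp_le_exp.2
      have := mul_nonpos_of_nonneg_of_nonpos hy (sub_nonpos.2 hθ.2)
      linarith [m0.1, m2.2]
    nlinarith [mul_le_mul_of_nonneg_right this h2, mul_nonneg hC h1]

lemma one_add_abs_pow_le_exp (k : ℕ) (y : ℝ) :
    (1 + |y|) ^ k ≤ k.factorial * Real.exp 1 * (Real.exp (1 * y) + Real.exp (-1 * y)) := by
  have h1 := Real.pow_div_factorial_le_exp (1 + |y|) (by positivity) k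
  rw [div_le_iff₀ (by positivity), Real.exp_add] at h1
  have h2 : Real.exp |y| ≤ Real.exp (1 * y) + Real.exp (-1 * y) := by
    rcases abs_cases y with h | h
    · rw [h.1, one_mul]; linarith [Real.exp_pos (-1 * y)]
    · rw [h.1, neg_one_mul]; linarith [Real.exp_pos (1 * y)]
  calc (1 + |y|) ^ k ≤ k.factorial * Real.exp 1 * Real.exp |y| := by linarith
    _ ≤ _ := by gcongr

lemma integrable_pow_law (k : ℕ) (θ : ℝ) : Integrable (fun y => (1 + |y|) ^ k) (F.law θ) := by
  refine Integrable.mono' (((F.integrable_exp_law θ 1).add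
    (F.integrable_exp_law θ (-1))).const_mul (k.factorial * Real.exp 1))
    (by fun_prop) (ae_of_all _ fun y => ?_)
  rw [Real.norm_eq_abs, abs_of_nonneg (by positivity)]
  exact one_add_abs_pow_le_exp k y

lemma integrable_density_mul_pow (k : ℕ) (θ : ℝ) :
    Integrable (fun y => F.density θ y * (1 + |y|) ^ k) F.ref :=
  (F.integrable_law_iff θ _).1 (F.integrable_pow_law k θ)

lemma exists_moment_le (A₁ A₂ : ℝ) (k : ℕ) : ∃ C : ℝ, 0 ≤ C ∧ ∀ θ ∈ Icc A₁ A₂,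
    ∫ y, (1 + |y|) ^ k ∂F.law θ ≤ C := by
  obtain ⟨C, hC0, hC⟩ := F.exists_density_le A₁ A₂
  have i1 := F.integrable_density_mul_pow k A₁
  have i2 := F.integrable_density_mul_pow k A₂
  refine ⟨∫ y, C * (F.density A₁ y * (1 + |y|) ^ k + F.density A₂ y * (1 + |y|) ^ k) ∂F.ref,
    integral_nonneg fun y => ?_, fun θ hθ => ?_⟩
  · have h1 := F.density_nonneg A₁ y
    have h2 := F.density_nonneg A₂ y
    simp only [Pi.zero_apply]
    positivity
  · rw [integral_law]
    refine integral_mono (F.integrable_density_mul_pow k θ) ((i1.add i2).const_mul C) fun y => ?_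
    simp only
    rw [← add_mul, ← mul_assoc]
    exact mul_le_mul_of_nonneg_right (hC θ hθ y) (by positivity)

end ExponentialFamily

lemma exists_rpow_mul_one_add_abs_log_le (B : ℝ) {p : ℝ} (hp : 0 < p) (q : ℝ) :
    ∃ E ≥ 0, ∀ x, 0 ≤ x → x ≤ B → ∀ a ∈ Icc p q, x ^ a * (1 + |Real.log x|) ≤ E := by
  set D := max B 1
  have hD1 : 1 ≤ D := le_max_right _ _
  refine ⟨D ^ q * (1 + D) + 1 / p, by positivity, fun x hx hxB a ha => ?_⟩
  have ha0 : 0 < a := hp.trans_le ha.1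
  have hxD : x ≤ D := hxB.trans (le_max_left _ _)
  have hpow : x ^ a ≤ D ^ q :=
    (Real.rpow_le_rpow hx hxD ha0.le).trans (Real.rpow_le_rpow_of_exponent_le hD1 ha.2)
  have hlog : x ^ a * |Real.log x| ≤ D ^ q * D + 1 / p := by
    rcases le_total x 1 with h | h
    · rcases hx.eq_or_lt with rfl | hx0
      · simpa using by positivity
      · have := (Real.abs_log_mul_self_rpow_lt x a hx0 h ha0).le
        rw [abs_mul, abs_of_nonneg (by positivity : 0 ≤ x ^ a), mul_comm] at this
        exact (this.trans (one_div_le_one_div_of_le hp ha.1)).trans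
          (le_add_of_nonneg_left (by positivity))
    · have : |Real.log x| ≤ D := by
        rw [abs_of_nonneg (Real.log_nonneg h)]
        exact (Real.log_le_self hx).trans hxD
      exact (mul_le_mul hpow this (abs_nonneg _) (by positivity)).trans
        (le_add_of_nonneg_right (by positivity))
  linarith

lemma abs_sub_sub_mul_le_of_hasDerivAt {g g₁ : ℝ → ℝ} {c κ x₀ x : ℝ}
    (hg : ∀ z, HasDerivAt g (g₁ z) z) (h : ∀ z ∈ uIcc x₀ x, |g₁ z - c| ≤ κ) :
    |g x - g x₀ - c * (x - x₀)| ≤ κ * |x - x₀| := by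
  have hderiv (z : ℝ) : HasDerivAt (fun z => g z - c * z) (g₁ z - c) z :=
    (hg z).sub (by simpa using (hasDerivAt_id z).const_mul c)
  have := (convex_uIcc x₀ x).norm_image_sub_le_of_norm_hasDerivWithin_le
    (fun z _ => (hderiv z).hasDerivWithinAt) h left_mem_uIcc right_mem_uIcc
  simp only [Real.norm_eq_abs] at this
  convert this using 2
  ring

lemma abs_taylor_two_sub_le_of_hasDerivAt {g g₁ g₂ : ℝ → ℝ} {c κ x₀ x : ℝ}
    (hg : ∀ z, HasDerivAt g (g₁ z) z) (hg₁ : ∀ z, HasDerivAt g₁ (g₂ z) z)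
    (hκ : 0 ≤ κ) (h : ∀ z ∈ uIcc x₀ x, |g₂ z - c| ≤ κ) :
    |g x - g x₀ - g₁ x₀ * (x - x₀) - c / 2 * (x - x₀) ^ 2| ≤ κ * (x - x₀) ^ 2 := by
  have hfirst : ∀ z ∈ uIcc x₀ x, |g₁ z - c * (z - x₀) - g₁ x₀| ≤ κ * |x - x₀| := by
    intro z hz
    rw [sub_right_comm]
    exact (abs_sub_sub_mul_le_of_hasDerivAt hg₁ fun y hy =>
      h y (uIcc_subset_uIcc left_mem_uIcc hz hy)).trans
      (mul_le_mul_of_nonneg_left (abs_sub_left_of_mem_uIcc hz) hκ)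
  have hderiv (z : ℝ) :
      HasDerivAt (fun z => g z - c / 2 * (z - x₀) ^ 2) (g₁ z - c * (z - x₀)) z := by
    refine (hg z).sub (((((hasDerivAt_id z).sub_const x₀).pow 2).const_mul (c / 2)).congr_deriv ?_)
    simp only [id, Nat.cast_ofNat, mul_one]
    ring
  have := abs_sub_sub_mul_le_of_hasDerivAt hderiv hfirst
  rw [mul_assoc, abs_mul_abs_self] at this
  convert this using 2 <;> ring

lemma abs_polynomial_le_five_mul_pow {S z v w a : ℝ} (hS : 1 ≤ S) (hz : |z| ≤ S) (hv : |v| ≤ S)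
    (hw : |w| ≤ S) (ha : |a| ≤ S) :
    |z| ≤ 5 * S ^ 5 ∧ |z ^ 2| ≤ 5 * S ^ 5 ∧ |a * z ^ 2 - v| ≤ 5 * S ^ 5 ∧
      |a ^ 2 * z ^ 3 - 3 * a * z * v - w| ≤ 5 * S ^ 5 := by
  have hpow {k : ℕ} (hk : k ≤ 5) : S ^ k ≤ S ^ 5 := pow_le_pow_right₀ hS hk
  have hz2 : |z ^ 2| ≤ S ^ 2 := by rw [abs_pow]; gcongr
  have haz2 : |a * z ^ 2| ≤ S ^ 3 := by
    rw [abs_mul, pow_succ' S 2]; gcongr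
  have haz3 : |a ^ 2 * z ^ 3| ≤ S ^ 5 := by
    rw [abs_mul, abs_pow, abs_pow, pow_add S 2 3]; gcongr
  have hazv : |3 * a * z * v| ≤ 3 * S ^ 3 := by
    rw [abs_mul, abs_mul, abs_mul, abs_of_nonneg (by norm_num : (0 : ℝ) ≤ 3)]
    calc 3 * |a| * |z| * |v| ≤ 3 * S * S * S := by gcongr
      _ = 3 * S ^ 3 := by ring
  have hS1 : S ≤ S ^ 5 := le_self_pow₀ hS (by norm_num)
  have hS2 := hpow (k := 2) (by norm_num)
  have hS3 := hpow (k := 3) (by norm_num)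
  exact ⟨by linarith, by linarith, by linarith [abs_sub (a * z ^ 2) v],
    by linarith [abs_sub (a ^ 2 * z ^ 3) (3 * a * z * v),
      abs_sub (a ^ 2 * z ^ 3 - 3 * a * z * v) w]⟩

namespace ExponentialFamily

variable (F : ExponentialFamily)

/-- The weighted score `f_θ(y)^a u_θ(y)`, which is the derivative of `f_θ(y)^a / a` in `θ`. -/
def powScore (a θ y : ℝ) : ℝ := F.density θ y ^ a * (y - F.b₁ θ)

/-- The derivative of the weighted score in the exponent. -/
def powScoreDeriv (a θ y : ℝ) : ℝ :=
  F.density θ y ^ a * Real.log (F.density θ y) * (y - F.b₁ θ)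

/-- The derivative of the weighted score in `θ`. -/
def powCurv (a θ y : ℝ) : ℝ := F.density θ y ^ a * (a * (y - F.b₁ θ) ^ 2 - F.b₂ θ)

/-- The weighted information density `f_θ(y)^a u_θ(y)²`. -/
def powInfo (a θ y : ℝ) : ℝ := F.density θ y ^ a * (y - F.b₁ θ) ^ 2

lemma measurable_powScore (a θ : ℝ) : Measurable (F.powScore a θ) := by
  have := F.measurable_density θ
  unfold powScore
  fun_prop

lemma measurable_uncurry_powScoreDeriv (θ : ℝ) :
    Measurable (Function.uncurry fun a y => F.powScoreDeriv a θ y) := by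
  have := F.measurable_density θ
  unfold powScoreDeriv Function.uncurry
  fun_prop

lemma measurable_powCurv (a θ : ℝ) : Measurable (F.powCurv a θ) := by
  have := F.measurable_density θ
  unfold powCurv
  fun_prop

lemma measurable_powInfo (a θ : ℝ) : Measurable (F.powInfo a θ) := by
  have := F.measurable_density θ
  unfold powInfo
  fun_prop

lemma density_rpow_nonneg (θ y a : ℝ) : 0 ≤ F.density θ y ^ a :=
  Real.rpow_nonneg (F.density_nonneg θ y) a

lemma density_rpow_of_notMem {y : ℝ} (hy : y ∉ F.carrier) (θ : ℝ) {a : ℝ} (ha : 0 < a) :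
    F.density θ y ^ a = 0 := by
  rw [F.density_of_notMem hy, Real.zero_rpow ha.ne']

lemma density_rpow_one_add (θ y : ℝ) {a : ℝ} (ha : 0 < a) :
    F.density θ y ^ (1 + a) = F.density θ y * F.density θ y ^ a := by
  rw [Real.rpow_add' (F.density_nonneg θ y) (by linarith), Real.rpow_one]

lemma density_rpow_mul_sq_score {a : ℝ} (ha : 0 < a) (θ y : ℝ) :
    F.density θ y ^ a * |F.score θ y| ^ 2 = F.powInfo a θ y := by
  by_cases hy : y ∈ F.carrier
  · rw [F.score_of_mem hy, sq_abs, powInfo]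
  · rw [powInfo, F.density_rpow_of_notMem hy θ ha, zero_mul, zero_mul]

section HasDerivAt

variable {F} {y : ℝ} (hy : y ∈ F.carrier) (a θ : ℝ)
include hy

lemma density_rpow_of_mem :
    F.density θ y ^ a = Real.exp (a * (y * θ - F.b θ + F.c y)) := by
  rw [F.density_of_mem hy, ← Real.exp_mul, mul_comm]

lemma hasDerivAt_density_rpow :
    HasDerivAt (fun θ => F.density θ y ^ a) (a * F.powScore a θ y) θ := by
  simp only [powScore, density_rpow_of_mem hy]
  refine (((((hasDerivAt_id θ).const_mul y).sub (F.hasDerivAt_b θ)).add_const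
    (F.c y)).const_mul a).exp.congr_deriv ?_
  simp only [id, Pi.sub_apply]
  ring

lemma hasDerivAt_powScore_param :
    HasDerivAt (fun θ => F.powScore a θ y) (F.powCurv a θ y) θ := by
  refine ((hasDerivAt_density_rpow hy a θ).mul ((F.hasDerivAt_b₁ θ).const_sub y)).congr_deriv ?_
  simp only [powScore, powCurv]
  ring

lemma hasDerivAt_powCurv_param :
    HasDerivAt (fun θ => F.powCurv a θ y) (F.density θ y ^ a *
      (a ^ 2 * (y - F.b₁ θ) ^ 3 - 3 * a * (y - F.b₁ θ) * F.b₂ θ - F.b₃ θ)) θ := by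
  refine ((hasDerivAt_density_rpow hy a θ).mul (((((F.hasDerivAt_b₁ θ).const_sub y).pow 2).const_mul
    a).sub (F.hasDerivAt_b₂ θ))).congr_deriv ?_
  simp only [powScore, Pi.pow_apply, Pi.sub_apply, Nat.cast_ofNat]
  ring

lemma hasDerivAt_density_rpow_exponent :
    HasDerivAt (fun a => F.density θ y ^ a)
      (F.density θ y ^ a * Real.log (F.density θ y)) a := by
  refine Real.hasStrictDerivAt_const_rpow ?_ a |>.hasDerivAt
  rw [F.density_of_mem hy]
  exact Real.exp_pos _

lemma hasDerivAt_powCurv_exponent :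
    HasDerivAt (fun a => F.powCurv a θ y)
      (F.density θ y ^ a * Real.log (F.density θ y) * (a * (y - F.b₁ θ) ^ 2 - F.b₂ θ) +
        F.density θ y ^ a * (y - F.b₁ θ) ^ 2) a := by
  refine ((hasDerivAt_density_rpow_exponent hy a θ).mul
    (((hasDerivAt_id a).mul_const ((y - F.b₁ θ) ^ 2)).sub_const (F.b₂ θ))).congr_deriv ?_
  simp only [id, one_mul]

end HasDerivAt

lemma hasDerivAt_powScore_exponent {a : ℝ} (ha : 0 < a) (θ y : ℝ) :
    HasDerivAt (fun a => F.powScore a θ y) (F.powScoreDeriv a θ y) a := by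
  by_cases hy : y ∈ F.carrier
  · exact (hasDerivAt_density_rpow_exponent hy a θ).mul_const _
  · have hzero {b : ℝ} (hb : 0 < b) : F.density θ y ^ b = 0 := F.density_rpow_of_notMem hy θ hb
    rw [powScoreDeriv, hzero ha, zero_mul, zero_mul]
    refine (hasDerivAt_const a (0 : ℝ)).congr_of_eventuallyEq ?_
    filter_upwards [lt_mem_nhds ha] with b hb
    rw [powScore, hzero hb, zero_mul]

lemma exists_abs_polynomial_le_weight (A₁ A₂ q : ℝ) : ∃ C ≥ 0, ∀ θ ∈ Icc A₁ A₂, ∀ a ∈ Icc 0 q,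
    ∀ y, |y - F.b₁ θ| ≤ C * weight y ∧ |(y - F.b₁ θ) ^ 2| ≤ C * weight y ∧
      |a * (y - F.b₁ θ) ^ 2 - F.b₂ θ| ≤ C * weight y ∧
      |a ^ 2 * (y - F.b₁ θ) ^ 3 - 3 * a * (y - F.b₁ θ) * F.b₂ θ - F.b₃ θ| ≤ C * weight y := by
  obtain ⟨M₁, h₁⟩ := isCompact_Icc.exists_bound_of_continuousOn
    (F.contDiff_b₁.continuous.continuousOn (s := Icc A₁ A₂))
  obtain ⟨M₂, h₂⟩ := isCompact_Icc.exists_bound_of_continuousOn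
    (F.contDiff_b₂.continuous.continuousOn (s := Icc A₁ A₂))
  obtain ⟨M₃, h₃⟩ := isCompact_Icc.exists_bound_of_continuousOn
    (F.continuous_b₃.continuousOn (s := Icc A₁ A₂))
  set M := 1 + |M₁| + |M₂| + |M₃| + |q| with hM
  have hM₁ := abs_nonneg M₁
  have hM₂ := abs_nonneg M₂
  have hM₃ := abs_nonneg M₃
  have hq := abs_nonneg q
  refine ⟨5 * M ^ 5, by positivity, fun θ hθ a ha y => ?_⟩
  have hMS : M ≤ M * (1 + |y|) :=
    le_mul_of_one_le_right (by positivity) (by linarith [abs_nonneg y])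
  have hyS : |M₁| + |y| ≤ M * (1 + |y|) := by
    nlinarith [mul_nonneg (by linarith : 0 ≤ M - 1) (abs_nonneg y)]
  rw [weight, mul_assoc, ← mul_pow]
  generalize M * (1 + |y|) = S at hMS hyS
  have hz : |y - F.b₁ θ| ≤ S := by
    linarith [abs_sub y (F.b₁ θ), h₁ θ hθ, Real.norm_eq_abs (F.b₁ θ), le_abs_self M₁]
  have hv : |F.b₂ θ| ≤ S := by linarith [h₂ θ hθ, Real.norm_eq_abs (F.b₂ θ), le_abs_self M₂]
  have hw : |F.b₃ θ| ≤ S := by linarith [h₃ θ hθ, Real.norm_eq_abs (F.b₃ θ), le_abs_self M₃]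
  have haS : |a| ≤ S := by rw [abs_of_nonneg ha.1]; linarith [ha.2, le_abs_self q]
  exact abs_polynomial_le_five_mul_pow (by linarith) hz hv hw haS

/-- `E` dominates the powers `f_θ^a` with `a ∈ [p, q]` and `θ ∈ [A₁, A₂]`, together with their
derivatives `f_θ^a log f_θ` in the exponent. -/
def PowBound (A₁ A₂ p q : ℝ) (E : ℝ → ℝ) : Prop :=
  ∀ a ∈ Icc p q, ∀ θ ∈ Icc A₁ A₂, ∀ y,
    F.density θ y ^ a * (1 + |Real.log (F.density θ y)|) ≤ E y

namespace PowBound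

variable {F} {A₁ A₂ p q : ℝ} {E : ℝ → ℝ}

lemma abs_rpow_mul_le (hE : F.PowBound A₁ A₂ p q E) {a θ y x K : ℝ} (ha : a ∈ Icc p q)
    (hθ : θ ∈ Icc A₁ A₂) (hx : |x| ≤ K) : |F.density θ y ^ a * x| ≤ E y * K := by
  have hf := F.density_rpow_nonneg θ y a
  have hfE : F.density θ y ^ a ≤ E y :=
    (le_mul_of_one_le_right hf (by linarith [abs_nonneg (Real.log (F.density θ y))])).trans
      (hE a ha θ hθ y)
  rw [abs_mul, abs_of_nonneg hf]
  exact mul_le_mul hfE hx (abs_nonneg x) (hf.trans hfE)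

lemma abs_rpow_mul_log_mul_le (hE : F.PowBound A₁ A₂ p q E) {a θ y x K : ℝ} (ha : a ∈ Icc p q)
    (hθ : θ ∈ Icc A₁ A₂) (hx : |x| ≤ K) :
    |F.density θ y ^ a * Real.log (F.density θ y) * x| ≤ E y * K := by
  have hf := F.density_rpow_nonneg θ y a
  have hfE : F.density θ y ^ a * |Real.log (F.density θ y)| ≤ E y :=
    (mul_le_mul_of_nonneg_left (by linarith) hf).trans (hE a ha θ hθ y)
  rw [abs_mul, abs_mul, abs_of_nonneg hf]
  exact mul_le_mul hfE hx (abs_nonneg x) ((mul_nonneg hf (abs_nonneg _)).trans hfE)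

lemma exists_abs_le (hp : 0 < p) (hE : F.PowBound A₁ A₂ p q E) :
    ∃ C ≥ 0, ∀ a ∈ Icc p q, ∀ θ ∈ Icc A₁ A₂, ∀ y,
      |F.powScore a θ y| ≤ C * (E y * weight y) ∧ |F.powScoreDeriv a θ y| ≤ C * (E y * weight y) ∧
      |F.powCurv a θ y| ≤ C * (E y * weight y) ∧ |F.powInfo a θ y| ≤ C * (E y * weight y) := by
  obtain ⟨C, hC0, hC⟩ := F.exists_abs_polynomial_le_weight A₁ A₂ q
  refine ⟨C, hC0, fun a ha θ hθ y => ?_⟩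
  obtain ⟨hz, hz2, haz, -⟩ := hC θ hθ a ⟨hp.le.trans ha.1, ha.2⟩ y
  rw [mul_left_comm]
  exact ⟨hE.abs_rpow_mul_le ha hθ hz, hE.abs_rpow_mul_log_mul_le ha hθ hz,
    hE.abs_rpow_mul_le ha hθ haz, hE.abs_rpow_mul_le ha hθ hz2⟩

lemma exists_abs_powCurv_sub_le (hp : 0 < p) (hE : F.PowBound A₁ A₂ p q E) :
    ∃ C ≥ 0, ∀ a ∈ Icc p q, ∀ a₀ ∈ Icc p q, ∀ θ ∈ Icc A₁ A₂, ∀ θ₀ ∈ Icc A₁ A₂,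
      ∀ y ∈ F.carrier, |F.powCurv a θ y - F.powCurv a₀ θ₀ y| ≤
        C * (E y * weight y) * (|θ - θ₀| + |a - a₀|) := by
  obtain ⟨C, hC0, hC⟩ := F.exists_abs_polynomial_le_weight A₁ A₂ q
  refine ⟨2 * C, by positivity, fun a ha a₀ ha₀ θ hθ θ₀ hθ₀ y hy => ?_⟩
  have hθdiff : |F.powCurv a θ y - F.powCurv a θ₀ y| ≤ E y * (C * weight y) * |θ - θ₀| :=
    (convex_Icc A₁ A₂).norm_image_sub_le_of_norm_hasDerivWithin_le
      (fun s _ => (hasDerivAt_powCurv_param hy a s).hasDerivWithinAt)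
      (fun s hs => hE.abs_rpow_mul_le ha hs (hC s hs a ⟨hp.le.trans ha.1, ha.2⟩ y).2.2.2) hθ₀ hθ
  have hadiff : |F.powCurv a θ₀ y - F.powCurv a₀ θ₀ y| ≤
      2 * (E y * (C * weight y)) * |a - a₀| := by
    refine (convex_Icc p q).norm_image_sub_le_of_norm_hasDerivWithin_le
      (fun s _ => (hasDerivAt_powCurv_exponent hy s θ₀).hasDerivWithinAt) (fun s hs => ?_) ha₀ ha
    obtain ⟨-, hz2, haz, -⟩ := hC θ₀ hθ₀ s ⟨hp.le.trans hs.1, hs.2⟩ y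
    rw [two_mul]
    exact (abs_add_le _ _).trans
      (add_le_add (hE.abs_rpow_mul_log_mul_le hs hθ₀ haz) (hE.abs_rpow_mul_le hs hθ₀ hz2))
  have hEw : 0 ≤ E y * (C * weight y) := (abs_nonneg _).trans
    (hE.abs_rpow_mul_le ha hθ (hC θ hθ a ⟨hp.le.trans ha.1, ha.2⟩ y).1)
  calc |F.powCurv a θ y - F.powCurv a₀ θ₀ y|
      ≤ |F.powCurv a θ y - F.powCurv a θ₀ y| + |F.powCurv a θ₀ y - F.powCurv a₀ θ₀ y| :=
        abs_sub_le _ _ _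
    _ ≤ 2 * (E y * (C * weight y)) * |θ - θ₀| + 2 * (E y * (C * weight y)) * |a - a₀| := by
        linarith [mul_nonneg hEw (abs_nonneg (θ - θ₀))]
    _ = 2 * C * (E y * weight y) * (|θ - θ₀| + |a - a₀|) := by ring

lemma exists_abs_taylor_le (hp : 0 < p) (hE : F.PowBound A₁ A₂ p q E) :
    ∃ C ≥ 0, ∀ a ∈ Icc p q, ∀ a₀ ∈ Icc p q, ∀ θ ∈ Icc A₁ A₂, ∀ θ₀ ∈ Icc A₁ A₂, ∀ y,
      |F.density θ y ^ a / a - F.density θ₀ y ^ a / a - F.powScore a θ₀ y * (θ - θ₀) -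
        F.powCurv a₀ θ₀ y / 2 * (θ - θ₀) ^ 2| ≤
      C * (E y * weight y) * ((|θ - θ₀| + |a - a₀|) * (θ - θ₀) ^ 2) := by
  obtain ⟨C, hC0, hC⟩ := hE.exists_abs_powCurv_sub_le hp
  refine ⟨C, hC0, fun a ha a₀ ha₀ θ hθ θ₀ hθ₀ y => ?_⟩
  have hEw : 0 ≤ E y * weight y := (abs_nonneg _).trans
    (hE.abs_rpow_mul_le (x := weight y) ha hθ (abs_of_nonneg (weight_nonneg y)).le)
  have ha0 : 0 < a := hp.trans_le ha.1
  by_cases hy : y ∈ F.carrier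
  · have hderiv (s : ℝ) : HasDerivAt (fun s => F.density s y ^ a / a) (F.powScore a s y) s :=
      ((hasDerivAt_density_rpow hy a s).div_const a).congr_deriv
        (mul_div_cancel_left₀ _ ha0.ne')
    rw [← mul_assoc (C * _)]
    refine abs_taylor_two_sub_le_of_hasDerivAt hderiv (hasDerivAt_powScore_param hy a)
      (by positivity) fun s hs =>
      (hC a ha a₀ ha₀ s (uIcc_subset_Icc hθ₀ hθ hs) θ₀ hθ₀ y hy).trans ?_
    gcongr C * _ * (?_ + _)
    exact abs_sub_left_of_mem_uIcc hs
  · simp only [powScore, powCurv, F.density_rpow_of_notMem hy _ ha0,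
      F.density_rpow_of_notMem hy _ (hp.trans_le ha₀.1), zero_div, zero_mul, sub_zero, abs_zero]
    positivity

end PowBound

lemma exists_powBound_const {B : ℝ} (hB : ∀ θ y, F.density θ y ≤ B) (A₁ A₂ : ℝ) {p : ℝ}
    (hp : 0 < p) (q : ℝ) : ∃ E ≥ 0, F.PowBound A₁ A₂ p q fun _ => E := by
  obtain ⟨E, hE0, hE⟩ := exists_rpow_mul_one_add_abs_log_le B hp q
  exact ⟨E, hE0, fun a ha θ _ y => hE _ (F.density_nonneg θ y) (hB θ y) a ha⟩

lemma exists_powBound_one_add {B : ℝ} (hB : ∀ θ y, F.density θ y ≤ B) (A₁ A₂ : ℝ) {p : ℝ}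
    (hp : 0 < p) (q : ℝ) : ∃ E ≥ 0, F.PowBound A₁ A₂ (1 + p) (1 + q) fun y =>
      E * (F.density A₁ y + F.density A₂ y) := by
  obtain ⟨E, hE0, hE⟩ := exists_rpow_mul_one_add_abs_log_le B hp q
  obtain ⟨C, hC0, hC⟩ := F.exists_density_le A₁ A₂
  refine ⟨C * E, by positivity, fun a ha θ hθ y => ?_⟩
  have hap : p ≤ a - 1 := by linarith [ha.1]
  have hsplit := F.density_rpow_one_add θ y (hp.trans_le hap)
  rw [add_sub_cancel] at hsplit
  rw [hsplit, mul_assoc]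
  calc _ ≤ C * (F.density A₁ y + F.density A₂ y) * E :=
        mul_le_mul (hC θ hθ y)
          (hE _ (F.density_nonneg θ y) (hB θ y) _ ⟨hap, by linarith [ha.2]⟩)
          (mul_nonneg (F.density_rpow_nonneg θ y _) (by positivity))
          (mul_nonneg hC0 (add_nonneg (F.density_nonneg _ _) (F.density_nonneg _ _)))
    _ = _ := by ring

lemma integrable_weight_law (θ : ℝ) : Integrable weight (F.law θ) := F.integrable_pow_law 5 θ

lemma integrable_law_of_abs_le_weight {θ C : ℝ} {g : ℝ → ℝ} (hg : Measurable g)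
    (h : ∀ y, |g y| ≤ C * weight y) : Integrable g (F.law θ) :=
  ((F.integrable_weight_law θ).const_mul C).mono' hg.aestronglyMeasurable (ae_of_all _ h)

lemma powScore_one_add (θ y : ℝ) {a : ℝ} (ha : 0 < a) :
    F.powScore (1 + a) θ y = F.density θ y * F.powScore a θ y := by
  rw [powScore, powScore, F.density_rpow_one_add θ y ha, mul_assoc]

lemma powCurv_one_add (θ y : ℝ) {a : ℝ} (ha : 0 < a) :
    F.powCurv (1 + a) θ y = F.density θ y * (F.powCurv a θ y + F.powInfo a θ y) := by
  rw [powCurv, powCurv, powInfo, F.density_rpow_one_add θ y ha]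
  ring

lemma integrable_density_rpow_one_add {B : ℝ} (hB : ∀ θ y, F.density θ y ≤ B) (θ : ℝ) {a : ℝ}
    (ha : 0 < a) : Integrable (fun y => F.density θ y ^ (1 + a)) F.ref := by
  refine ((F.integrable_density θ).mul_const (B ^ a)).mono'
    ((F.measurable_density θ).pow_const _).aestronglyMeasurable (ae_of_all _ fun y => ?_)
  rw [Real.norm_eq_abs, abs_of_nonneg (F.density_rpow_nonneg θ y _), F.density_rpow_one_add θ y ha]
  exact mul_le_mul_of_nonneg_left
    (Real.rpow_le_rpow (F.density_nonneg θ y) (hB θ y) ha.le) (F.density_nonneg θ y)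

section Bounded

variable {B : ℝ} (hB : ∀ θ y, F.density θ y ≤ B) {p : ℝ} (hp : 0 < p)
include hB hp

lemma exists_abs_le_weight (A₁ A₂ q : ℝ) : ∃ C ≥ 0, ∀ a ∈ Icc p q, ∀ θ ∈ Icc A₁ A₂, ∀ y,
    |F.powScore a θ y| ≤ C * weight y ∧ |F.powScoreDeriv a θ y| ≤ C * weight y ∧
      |F.powCurv a θ y| ≤ C * weight y ∧ |F.powInfo a θ y| ≤ C * weight y := by
  obtain ⟨E, hE0, hE⟩ := F.exists_powBound_const hB A₁ A₂ hp q
  obtain ⟨C, hC0, hC⟩ := hE.exists_abs_le hp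
  simp only [← mul_assoc] at hC
  exact ⟨C * E, by positivity, hC⟩

lemma integrable_powScore_law (θ : ℝ) : Integrable (F.powScore p θ) (F.law θ) := by
  obtain ⟨C, -, hC⟩ := F.exists_abs_le_weight hB hp θ θ p
  exact F.integrable_law_of_abs_le_weight (F.measurable_powScore p θ) fun y =>
    (hC p ⟨le_rfl, le_rfl⟩ θ ⟨le_rfl, le_rfl⟩ y).1

lemma integrable_powCurv_law (θ : ℝ) : Integrable (F.powCurv p θ) (F.law θ) := by
  obtain ⟨C, -, hC⟩ := F.exists_abs_le_weight hB hp θ θ p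
  exact F.integrable_law_of_abs_le_weight (F.measurable_powCurv p θ) fun y =>
    (hC p ⟨le_rfl, le_rfl⟩ θ ⟨le_rfl, le_rfl⟩ y).2.2.1

lemma integrable_powInfo_law (θ : ℝ) : Integrable (F.powInfo p θ) (F.law θ) := by
  obtain ⟨C, -, hC⟩ := F.exists_abs_le_weight hB hp θ θ p
  exact F.integrable_law_of_abs_le_weight (F.measurable_powInfo p θ) fun y =>
    (hC p ⟨le_rfl, le_rfl⟩ θ ⟨le_rfl, le_rfl⟩ y).2.2.2

lemma hasDerivAt_integral_powScore (θ : ℝ) :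
    HasDerivAt (fun a => ∫ y, F.powScore a θ y ∂F.law θ) (∫ y, F.powScoreDeriv p θ y ∂F.law θ)
      p := by
  have hp2 : 0 < p / 2 := by linarith
  obtain ⟨C, -, hC⟩ := F.exists_abs_le_weight hB hp2 θ θ (p + 1)
  refine (hasDerivAt_integral_of_dominated_loc_of_deriv_le (bound := fun y => C * weight y)
    (s := Icc (p / 2) (p + 1)) (Icc_mem_nhds (by linarith) (by linarith))
    (.of_forall fun a => (F.measurable_powScore a θ).aestronglyMeasurable)
    (F.integrable_powScore_law hB hp θ)
    ((F.measurable_uncurry_powScoreDeriv θ).comp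
      measurable_prodMk_left).aestronglyMeasurable
    (ae_of_all _ fun y a ha => (hC a ha θ ⟨le_rfl, le_rfl⟩ y).2.1)
    ((F.integrable_weight_law θ).const_mul C)
    (ae_of_all _ fun y a ha => F.hasDerivAt_powScore_exponent (hp2.trans_le ha.1) θ y)).2

lemma continuous_dpdLoss (y : ℝ) : Continuous (F.dpdLoss p y) := by
  refine Continuous.sub (continuous_iff_continuousAt.2 fun θ₀ => ?_)
    (((F.continuous_density y).rpow_const fun _ => .inr hp.le).const_mul _)
  obtain ⟨E, -, hE⟩ := F.exists_powBound_one_add hB (θ₀ - 1) (θ₀ + 1) hp p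
  refine continuousAt_of_dominated (bound := fun x =>
      E * (F.density (θ₀ - 1) x + F.density (θ₀ + 1) x) * 1)
    (.of_forall fun θ => ((F.measurable_density θ).pow_const _).aestronglyMeasurable) ?_
    ((((F.integrable_density _).add (F.integrable_density _)).const_mul _).mul_const _)
    (ae_of_all _ fun x =>
      ((F.continuous_density x).rpow_const fun _ => .inr (by linarith)).continuousAt)
  filter_upwards [Icc_mem_nhds (by linarith : θ₀ - 1 < θ₀) (by linarith : θ₀ < θ₀ + 1)]
    with θ hθ
  refine ae_of_all _ fun x => ?_
  simpa using hE.abs_rpow_mul_le (x := 1) ⟨le_rfl, le_rfl⟩ hθ (abs_one.le)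

lemma exists_abs_integral_taylor_le (A₁ A₂ q : ℝ) : ∃ C ≥ 0, ∀ α ∈ Icc p q, ∀ α₀ ∈ Icc p q,
    ∀ θ ∈ Icc A₁ A₂, ∀ θ₀ ∈ Icc A₁ A₂,
      |(∫ y, F.density θ y ^ (1 + α) ∂F.ref) / (1 + α) -
          (∫ y, F.density θ₀ y ^ (1 + α) ∂F.ref) / (1 + α) -
          (∫ y, F.powScore α θ₀ y ∂F.law θ₀) * (θ - θ₀) -
          (∫ y, F.powCurv α₀ θ₀ y + F.powInfo α₀ θ₀ y ∂F.law θ₀) / 2 * (θ - θ₀) ^ 2| ≤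
        C * ((|θ - θ₀| + |α - α₀|) * (θ - θ₀) ^ 2) := by
  obtain ⟨E, hE0, hE⟩ := F.exists_powBound_one_add hB A₁ A₂ hp q
  obtain ⟨C, hC0, hC⟩ := hE.exists_abs_taylor_le (by linarith : 0 < 1 + p)
  set D := ∫ y, C * (E * (F.density A₁ y + F.density A₂ y) * weight y) ∂F.ref with hD
  have hDint : Integrable (fun y => C * (E * (F.density A₁ y + F.density A₂ y) * weight y))
      F.ref := by
    simp only [mul_assoc, add_mul]
    exact (((F.integrable_density_mul_pow 5 A₁).add
      (F.integrable_density_mul_pow 5 A₂)).const_mul E).const_mul C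
  refine ⟨D, integral_nonneg fun y => ?_, fun α hα α₀ hα₀ θ hθ θ₀ hθ₀ => ?_⟩
  · have := weight_nonneg y
    have := F.density_nonneg A₁ y
    have := F.density_nonneg A₂ y
    dsimp only [Pi.zero_apply]
    positivity
  have hα0 : 0 < α := hp.trans_le hα.1
  have hα₀0 : 0 < α₀ := hp.trans_le hα₀.1
  have hpow (θ : ℝ) := (F.integrable_density_rpow_one_add hB θ hα0).div_const (1 + α)
  have hscore := ((F.integrable_law_iff θ₀ _).1 (F.integrable_powScore_law hB hα0 θ₀)).mul_const
    (θ - θ₀)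
  have hcurv := (((F.integrable_law_iff θ₀ _).1 ((F.integrable_powCurv_law hB hα₀0 θ₀).add
    (F.integrable_powInfo_law hB hα₀0 θ₀))).div_const 2).mul_const ((θ - θ₀) ^ 2)
  have hdiff := (hpow θ).sub (hpow θ₀)
  have hdiff' := hdiff.sub hscore
  simp only [Pi.add_apply, Pi.sub_def] at hcurv hdiff hdiff'
  rw [integral_law, integral_law, ← integral_div, ← integral_div, ← integral_div,
    ← integral_mul_const, ← integral_mul_const, ← integral_sub (hpow θ) (hpow θ₀),
    ← integral_sub hdiff hscore, ← integral_sub hdiff' hcurv, hD, ← integral_mul_const,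
    ← Real.norm_eq_abs]
  refine norm_integral_le_of_norm_le (hDint.mul_const _) (ae_of_all _ fun y => ?_)
  have h := hC (1 + α) ⟨by linarith [hα.1], by linarith [hα.2]⟩ (1 + α₀)
    ⟨by linarith [hα₀.1], by linarith [hα₀.2]⟩ θ hθ θ₀ hθ₀ y
  rwa [F.powScore_one_add θ₀ y hα0, F.powCurv_one_add θ₀ y hα₀0, add_sub_add_left_eq_sub] at h

/-- The deviation of `g` from its mean under `F_θ`. -/
def centered (θ : ℝ) (g : ℝ → ℝ) (y : ℝ) : ℝ := g y - ∫ x, g x ∂F.law θ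

lemma exists_abs_dpdLoss_taylor_le (A₁ A₂ q : ℝ) : ∃ C ≥ 0, ∀ α ∈ Icc p q, ∀ α₀ ∈ Icc p q,
    ∀ θ ∈ Icc A₁ A₂, ∀ θ₀ ∈ Icc A₁ A₂, ∀ y,
      |F.dpdLoss α y θ - F.dpdLoss α y θ₀ -
          (1 + α) * (((∫ x, F.powInfo α₀ θ₀ x ∂F.law θ₀) - F.centered θ₀ (F.powCurv α₀ θ₀) y) / 2 *
            (θ - θ₀) ^ 2 - F.centered θ₀ (F.powScore α θ₀) y * (θ - θ₀))| ≤
        (1 + α) * (C * weight y * ((|θ - θ₀| + |α - α₀|) * (θ - θ₀) ^ 2)) := by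
  obtain ⟨C₁, hC₁, hint⟩ := F.exists_abs_integral_taylor_le hB hp A₁ A₂ q
  obtain ⟨E, hE0, hE⟩ := F.exists_powBound_const hB A₁ A₂ hp q
  obtain ⟨C₂, hC₂, hpow⟩ := hE.exists_abs_taylor_le hp
  refine ⟨C₁ + C₂ * E, by positivity, fun α hα α₀ hα₀ θ hθ θ₀ hθ₀ y => ?_⟩
  have hα0 : 0 < α := hp.trans_le hα.1
  have hα₀0 : 0 < α₀ := hp.trans_le hα₀.1
  have hint := hint α hα α₀ hα₀ θ hθ θ₀ hθ₀
  rw [integral_add (F.integrable_powCurv_law hB hα₀0 θ₀) (F.integrable_powInfo_law hB hα₀0 θ₀)]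
    at hint
  have hpow := hpow α hα α₀ hα₀ θ hθ θ₀ hθ₀ y
  have hw := one_le_weight y
  have hloss (s : ℝ) : F.dpdLoss α y s =
      (1 + α) * ((∫ x, F.density s x ^ (1 + α) ∂F.ref) / (1 + α) - F.density s y ^ α / α) := by
    have hα1 : 1 + α ≠ 0 := by linarith
    rw [dpdLoss, mul_sub, mul_div_cancel₀ _ hα1]
    field_simp
    ring
  rw [hloss, hloss, ← mul_sub, ← mul_sub, abs_mul, abs_of_pos (by linarith : 0 < 1 + α)]
  refine mul_le_mul_of_nonneg_left ?_ (by linarith)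
  set r := (|θ - θ₀| + |α - α₀|) * (θ - θ₀) ^ 2
  have hr0 : 0 ≤ r := by positivity
  have hC₁w : C₁ * r ≤ C₁ * weight y * r := by
    gcongr
    exact le_mul_of_one_le_right hC₁ hw
  have hsplit := (abs_sub _ _).trans (add_le_add hint hpow)
  refine le_trans (le_of_eq ?_) (hsplit.trans ?_)
  · unfold centered
    congr 1
    ring
  · linarith

end Bounded

end ExponentialFamily

section RandomVectors

variable {Ω ι H : Type*} [MeasurableSpace Ω] {P : Measure Ω} [Fintype ι] [NormedAddCommGroup H]
  [InnerProductSpace ℝ H]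

lemma integral_sq_norm_sum_smul {ξ : ι → Ω → ℝ} (hξ : ∀ i, MemLp (ξ i) 2 P)
    (hmean : ∀ i, ∫ ω, ξ i ω ∂P = 0) (hindep : Pairwise fun i j => IndepFun (ξ i) (ξ j) P)
    (e : ι → H) :
    ∫ ω, ‖∑ i, ξ i ω • e i‖ ^ 2 ∂P = ∑ i, (∫ ω, ξ i ω ^ 2 ∂P) * ‖e i‖ ^ 2 := by
  have hexpand (ω : Ω) : ‖∑ i, ξ i ω • e i‖ ^ 2 =
      ∑ i, ∑ j, ξ i ω * ξ j ω * inner ℝ (e i) (e j) := by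
    simp only [← real_inner_self_eq_norm_sq, sum_inner, inner_sum, real_inner_smul_left,
      real_inner_smul_right, mul_assoc]
    exact Finset.sum_congr rfl fun i _ => Finset.sum_congr rfl fun j _ => by
      rw [real_inner_comm]
  have hint (i j : ι) : Integrable (fun ω => ξ i ω * ξ j ω * inner ℝ (e i) (e j)) P :=
    ((hξ i).integrable_mul (hξ j)).mul_const _
  have hcross {i j : ι} (hij : j ≠ i) : ∫ ω, ξ i ω * ξ j ω ∂P = 0 := by
    rw [(hindep hij.symm).integral_fun_mul_eq_mul_integral (hξ i).1 (hξ j).1, hmean, zero_mul]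
  simp only [hexpand]
  rw [integral_finsetSum _ fun i _ => integrable_finsetSum _ fun j _ => hint i j]
  refine Finset.sum_congr rfl fun i _ => ?_
  rw [integral_finsetSum _ fun j _ => hint i j, Finset.sum_eq_single_of_mem i (Finset.mem_univ i)]
  · rw [integral_mul_const, real_inner_self_eq_norm_sq]
    simp only [pow_two]
  · intro j _ hij
    rw [integral_mul_const, hcross hij, zero_mul]

lemma lintegral_enorm_le_sqrt_integral_sq [IsProbabilityMeasure P] {E : Type*}
    [NormedAddCommGroup E] {X : Ω → E} (hX : MemLp X 2 P) :
    ∫⁻ ω, ‖X ω‖ₑ ∂P ≤ ENNReal.ofReal √(∫ ω, ‖X ω‖ ^ 2 ∂P) := by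
  have h := eLpNorm_le_eLpNorm_of_exponent_le one_le_two hX.1
  rw [eLpNorm_one_eq_lintegral_enorm, hX.eLpNorm_eq_integral_rpow_norm two_ne_zero (by simp)] at h
  simpa [Real.sqrt_eq_rpow] using h

lemma lintegral_enorm_average_smul_le [IsProbabilityMeasure P] {n : ℕ} {ξ : Fin n → Ω → ℝ}
    (hξ : ∀ i, MemLp (ξ i) 2 P) (hmean : ∀ i, ∫ ω, ξ i ω ∂P = 0)
    (hindep : Pairwise fun i j => IndepFun (ξ i) (ξ j) P) {σ κ : ℝ} (hσ0 : 0 ≤ σ) (hκ0 : 0 ≤ κ)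
    (hσ : ∀ i, ∫ ω, ξ i ω ^ 2 ∂P ≤ σ ^ 2) {e : Fin n → H} (he : ∀ i, ‖e i‖ ≤ κ) :
    ∫⁻ ω, ‖(n : ℝ)⁻¹ • ∑ i, ξ i ω • e i‖ₑ ∂P ≤ ENNReal.ofReal (σ * κ / √n) := by
  have hL : MemLp (fun ω => ∑ i, ξ i ω • e i) 2 P := memLp_finsetSum _ fun i _ =>
    ((memLp_top_const (e i)).smul (hξ i) : MemLp (fun ω => ξ i ω • e i) 2 P)
  refine (lintegral_enorm_le_sqrt_integral_sq (hL.const_smul (n : ℝ)⁻¹)).trans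
    (ENNReal.ofReal_le_ofReal ?_)
  refine Real.sqrt_le_iff.2 ⟨by positivity, ?_⟩
  simp only [Pi.smul_apply, norm_smul, mul_pow]
  rw [integral_const_mul, integral_sq_norm_sum_smul hξ hmean hindep]
  have hsum : ∑ i, (∫ ω, ξ i ω ^ 2 ∂P) * ‖e i‖ ^ 2 ≤ n * (σ ^ 2 * κ ^ 2) := by
    have hterm (i : Fin n) : (∫ ω, ξ i ω ^ 2 ∂P) * ‖e i‖ ^ 2 ≤ σ ^ 2 * κ ^ 2 :=
      mul_le_mul (hσ i) (pow_le_pow_left₀ (norm_nonneg _) (he i) 2) (sq_nonneg _) (sq_nonneg _)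
    simpa using Finset.sum_le_sum fun i (_ : i ∈ Finset.univ) => hterm i
  calc _ ≤ ‖(n : ℝ)⁻¹‖ ^ 2 * (n * (σ ^ 2 * κ ^ 2)) := by gcongr
    _ = (σ * κ / √n) ^ 2 := by
      rw [Real.norm_eq_abs, sq_abs, div_pow, Real.sq_sqrt n.cast_nonneg]
      rcases n.eq_zero_or_pos with rfl | hn
      · simp
      · field_simp

lemma enorm_le_enorm_add_setLIntegral_enorm_deriv [CompleteSpace H] {g g' : ℝ → H} {p q a₀ a : ℝ}
    (hg : ∀ b ∈ Icc p q, HasDerivAt g (g' b) b) (hg' : AEStronglyMeasurable g')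
    (ha₀ : a₀ ∈ Icc p q) (ha : a ∈ Icc p q) :
    ‖g a‖ₑ ≤ ‖g a₀‖ₑ + ∫⁻ b in Icc p q, ‖g' b‖ₑ := by
  by_cases htop : ∫⁻ b in Icc p q, ‖g' b‖ₑ = ⊤
  · rw [htop, add_top]; exact le_top
  have hsub : uIoc a₀ a ⊆ Icc p q := uIoc_subset_uIcc.trans (uIcc_subset_Icc ha₀ ha)
  have hint : IntervalIntegrable g' volume a₀ a := intervalIntegrable_iff.2
    (IntegrableOn.mono_set (t := Icc p q) ⟨hg'.restrict, lt_top_iff_ne_top.2 htop⟩ hsub)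
  have hftc := intervalIntegral.integral_eq_sub_of_hasDerivAt
    (fun b hb => hg b (uIcc_subset_Icc ha₀ ha hb)) hint
  calc ‖g a‖ₑ = ‖g a₀ + ∫ b in a₀..a, g' b‖ₑ := by rw [hftc, add_sub_cancel]
    _ ≤ ‖g a₀‖ₑ + ‖∫ b in a₀..a, g' b‖ₑ := enorm_add_le _ _
    _ = ‖g a₀‖ₑ + ‖∫ b in uIoc a₀ a, g' b‖ₑ := by
      rw [← ofReal_norm (∫ b in a₀..a, g' b), intervalIntegral.norm_intervalIntegral_eq,
        ofReal_norm]
    _ ≤ ‖g a₀‖ₑ + ∫⁻ b in Icc p q, ‖g' b‖ₑ := by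
      gcongr
      exact (enorm_integral_le_lintegral_enorm _).trans (lintegral_mono_set hsub)

lemma measure_ofReal_le_le_div {S : Ω → ENNReal} (hS : AEMeasurable S P) {v x : ℝ} (hx : 0 < x)
    (hv : ∫⁻ ω, S ω ∂P ≤ ENNReal.ofReal v) :
    P {ω | ENNReal.ofReal x ≤ S ω} ≤ ENNReal.ofReal (v / x) := by
  rw [ENNReal.ofReal_div_of_pos hx]
  exact (meas_ge_le_lintegral_div hS (by simpa using hx) ENNReal.ofReal_ne_top).trans
    (ENNReal.div_le_div_right hv _)

lemma measure_exists_le_norm_le [SFinite P] [CompleteSpace H] {X X' : ℝ → Ω → H} {p q a₀ : ℝ}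
    (ha₀ : a₀ ∈ Icc p q) (hX : StronglyMeasurable (X a₀))
    (hX' : StronglyMeasurable (Function.uncurry X'))
    (hderiv : ∀ ω, ∀ a ∈ Icc p q, HasDerivAt (fun a => X a ω) (X' a ω) a) {v x : ℝ}
    (hv0 : 0 ≤ v) (hv : ∫⁻ ω, ‖X a₀ ω‖ₑ ∂P ≤ ENNReal.ofReal v)
    (hv' : ∀ a ∈ Icc p q, ∫⁻ ω, ‖X' a ω‖ₑ ∂P ≤ ENNReal.ofReal v) (hx : 0 < x) :
    P {ω | ∃ a ∈ Icc p q, x ≤ ‖X a ω‖} ≤ ENNReal.ofReal ((1 + (q - p)) * v / x) := by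
  have hpq : 0 ≤ q - p := sub_nonneg.2 (ha₀.1.trans ha₀.2)
  have hjoint : Measurable (Function.uncurry fun ω a => ‖X' a ω‖ₑ) :=
    (hX'.comp_measurable measurable_swap).enorm
  have hmeas : Measurable fun ω => ‖X a₀ ω‖ₑ + ∫⁻ a in Icc p q, ‖X' a ω‖ₑ :=
    hX.enorm.add hjoint.lintegral_prod_right
  have hint : ∫⁻ ω, (‖X a₀ ω‖ₑ + ∫⁻ a in Icc p q, ‖X' a ω‖ₑ) ∂P ≤
      ENNReal.ofReal ((1 + (q - p)) * v) := by
    rw [lintegral_add_left hX.enorm, lintegral_lintegral_swap hjoint.aemeasurable,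
      add_mul, one_mul, ENNReal.ofReal_add hv0 (by positivity), mul_comm, ENNReal.ofReal_mul hv0]
    refine add_le_add hv ((setLIntegral_mono' measurableSet_Icc hv').trans_eq ?_)
    rw [setLIntegral_const, Real.volume_Icc]
  refine (measure_mono ?_).trans (measure_ofReal_le_le_div hmeas.aemeasurable hx hint)
  rintro ω ⟨a, ha, hxa⟩
  calc ENNReal.ofReal x ≤ ‖X a ω‖ₑ := by
        rw [← ofReal_norm]; exact ENNReal.ofReal_le_ofReal hxa
    _ ≤ _ := enorm_le_enorm_add_setLIntegral_enorm_deriv (hderiv ω)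
        (hX'.comp_measurable measurable_prodMk_right).aestronglyMeasurable ha₀ ha

end RandomVectors

namespace ExponentialFamily

variable (F : ExponentialFamily) {H : Type*} [NormedAddCommGroup H] [InnerProductSpace ℝ H] {n : ℕ}

/-- The average `(1/n) ∑ᵢ (φ_{θᵢ}(yᵢ) - E φ_{θᵢ}) eᵢ`, the expectation being under `F_{θᵢ}`. -/
def centeredAverage (θ : Fin n → ℝ) (e : Fin n → H) (φ : ℝ → ℝ → ℝ) (y : Fin n → ℝ) : H :=
  (n : ℝ)⁻¹ • ∑ i, F.centered (θ i) (φ (θ i)) (y i) • e i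

lemma measurable_centered {θ : ℝ} {g : ℝ → ℝ} (hg : Measurable g) :
    Measurable (F.centered θ g) := hg.sub_const _

lemma stronglyMeasurable_centeredAverage {θ : Fin n → ℝ} (e : Fin n → H) {φ : ℝ → ℝ → ℝ}
    (hφ : ∀ i, Measurable (φ (θ i))) : StronglyMeasurable (F.centeredAverage θ e φ) :=
  (Finset.stronglyMeasurable_fun_sum _ fun i _ => ((F.measurable_centered (hφ i)).comp
    (measurable_pi_apply i)).stronglyMeasurable.smul_const (e i)).const_smul _

lemma stronglyMeasurable_uncurry_centeredAverage_powScoreDeriv (θ : Fin n → ℝ) (e : Fin n → H) :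
    StronglyMeasurable
      (Function.uncurry fun a => F.centeredAverage θ e (F.powScoreDeriv a)) := by
  refine (Finset.stronglyMeasurable_fun_sum _ fun i _ =>
    StronglyMeasurable.smul_const ?_ (e i)).const_smul _
  have hscore := F.measurable_uncurry_powScoreDeriv (θ i)
  have hmean : StronglyMeasurable fun a => ∫ y, F.powScoreDeriv a (θ i) y ∂F.law (θ i) :=
    hscore.stronglyMeasurable.integral_prod_right
  exact ((hscore.comp (measurable_fst.prodMk ((measurable_pi_apply i).comp
    measurable_snd))).sub (hmean.measurable.comp measurable_fst)).stronglyMeasurable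

lemma hasDerivAt_centeredAverage_powScore {B : ℝ} (hB : ∀ θ y, F.density θ y ≤ B)
    (θ : Fin n → ℝ) (e : Fin n → H) (y : Fin n → ℝ) {a : ℝ} (ha : 0 < a) :
    HasDerivAt (fun a => F.centeredAverage θ e (F.powScore a) y)
      (F.centeredAverage θ e (F.powScoreDeriv a) y) a :=
  (HasDerivAt.fun_sum fun i _ => ((F.hasDerivAt_powScore_exponent ha (θ i) (y i)).sub
    (F.hasDerivAt_integral_powScore hB ha (θ i))).smul_const (e i)).const_smul _

lemma exists_integral_sq_centered_le (A₁ A₂ : ℝ) : ∃ σ ≥ 0, ∀ θ ∈ Icc A₁ A₂, ∀ C : ℝ,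
    ∀ g : ℝ → ℝ, Measurable g → (∀ y, |g y| ≤ C * weight y) →
      MemLp (F.centered θ g) 2 (F.law θ) ∧ ∫ y, F.centered θ g y ∂F.law θ = 0 ∧
        ∫ y, F.centered θ g y ^ 2 ∂F.law θ ≤ (C * σ) ^ 2 := by
  obtain ⟨M, hM0, hM⟩ := F.exists_moment_le A₁ A₂ 10
  refine ⟨√M, Real.sqrt_nonneg M, fun θ hθ C g hg hgC => ?_⟩
  have hsq (y : ℝ) : g y ^ 2 ≤ C ^ 2 * (1 + |y|) ^ 10 := by
    calc g y ^ 2 = |g y| ^ 2 := (sq_abs _).symm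
      _ ≤ (C * weight y) ^ 2 := pow_le_pow_left₀ (abs_nonneg _) (hgC y) 2
      _ = C ^ 2 * (1 + |y|) ^ 10 := by rw [weight]; ring
  have hint := (F.integrable_pow_law 10 θ).const_mul (C ^ 2)
  have hint2 : Integrable (fun y => g y ^ 2) (F.law θ) :=
    hint.mono' (hg.pow_const 2).aestronglyMeasurable (ae_of_all _ fun y => by
      rw [Real.norm_of_nonneg (sq_nonneg _)]; exact hsq y)
  have hL : MemLp g 2 (F.law θ) := (memLp_two_iff_integrable_sq hg.aestronglyMeasurable).2 hint2
  refine ⟨hL.sub (memLp_const _), ?_, ?_⟩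
  · unfold centered
    rw [integral_sub (hL.integrable one_le_two) (integrable_const _), integral_const,
      probReal_univ, one_smul, sub_self]
  · unfold centered
    rw [← variance_eq_integral hg.aemeasurable, mul_pow, Real.sq_sqrt hM0]
    calc variance g (F.law θ) ≤ ∫ y, g y ^ 2 ∂F.law θ :=
          variance_le_expectation_sq hg.aestronglyMeasurable
      _ ≤ ∫ y, C ^ 2 * (1 + |y|) ^ 10 ∂F.law θ := integral_mono hint2 hint hsq
      _ ≤ C ^ 2 * M := by
        rw [integral_const_mul]
        exact mul_le_mul_of_nonneg_left (hM θ hθ) (sq_nonneg C)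

lemma exists_lintegral_enorm_centeredAverage_le (A₁ A₂ : ℝ) : ∃ σ ≥ 0, ∀ {n : ℕ}
    {θ : Fin n → ℝ} {e : Fin n → H} {φ : ℝ → ℝ → ℝ} {C κ : ℝ}, (∀ i, θ i ∈ Icc A₁ A₂) →
      0 ≤ κ → (∀ i, ‖e i‖ ≤ κ) → 0 ≤ C → (∀ i, Measurable (φ (θ i))) →
      (∀ i y, |φ (θ i) y| ≤ C * weight y) →
      ∫⁻ y, ‖F.centeredAverage θ e φ y‖ₑ ∂Measure.pi (fun i => F.law (θ i)) ≤
        ENNReal.ofReal (C * σ * κ / √n) := by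
  obtain ⟨σ, hσ0, hσ⟩ := F.exists_integral_sq_centered_le A₁ A₂
  refine ⟨σ, hσ0, fun {n θ e φ C κ} hθ hκ he hC hφ hφC => ?_⟩
  have hmp (i : Fin n) := measurePreserving_eval (fun i => F.law (θ i)) i
  have hc (i : Fin n) := F.measurable_centered (θ := θ i) (hφ i)
  have hb (i : Fin n) := hσ (θ i) (hθ i) C (φ (θ i)) (hφ i) (hφC i)
  refine lintegral_enorm_average_smul_le (fun i => (hb i).1.comp_measurePreserving (hmp i))
    (fun i => ?_) (fun i j hij => (iIndepFun_pi fun i => (hc i).aemeasurable).indepFun hij)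
    (by positivity) hκ (fun i => ?_) he
  · exact ((hmp i).hasLaw.integral_comp (hc i).aestronglyMeasurable).trans (hb i).2.1
  · exact ((hmp i).hasLaw.integral_comp ((hc i).pow_const 2).aestronglyMeasurable).trans_le
      (hb i).2.2

end ExponentialFamily

lemma measure_preimage_le_pi {Ω ι : Type*} [MeasurableSpace Ω] {P : Measure Ω} [Fintype ι]
    {Y : ι → Ω → ℝ} {μ : ι → Measure ℝ} [∀ i, SigmaFinite (μ i)]
    (hY : ∀ i, HasLaw (Y i) (μ i) P) (hindep : iIndepFun Y P) (S : Set (ι → ℝ)) :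
    P {ω | (fun i => Y i ω) ∈ S} ≤ Measure.pi μ S := by
  have hlaw := hindep.hasLaw_pi hY
  rw [← hlaw.map_eq]
  exact Measure.le_map_apply hlaw.aemeasurable S

namespace ExponentialFamily

variable (F : ExponentialFamily) (H : Type*) [NormedAddCommGroup H] [InnerProductSpace ℝ H]

lemma exists_measure_le_norm_centeredAverage_le (A₁ A₂ : ℝ) : ∃ σ ≥ 0, ∀ {n : ℕ}
    {θ : Fin n → ℝ} {e : Fin n → H} {φ : ℝ → ℝ → ℝ} {C κ x : ℝ}, (∀ i, θ i ∈ Icc A₁ A₂) →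
      0 ≤ κ → (∀ i, ‖e i‖ ≤ κ) → 0 ≤ C → (∀ i, Measurable (φ (θ i))) →
      (∀ i y, |φ (θ i) y| ≤ C * weight y) → 0 < x →
      Measure.pi (fun i => F.law (θ i)) {y | x ≤ ‖F.centeredAverage θ e φ y‖} ≤
        ENNReal.ofReal (C * σ * κ / √n / x) := by
  obtain ⟨σ, hσ0, hσ⟩ := F.exists_lintegral_enorm_centeredAverage_le (H := H) A₁ A₂
  refine ⟨σ, hσ0, fun {n θ e φ C κ x} hθ hκ he hC hφ hφC hx => ?_⟩
  refine (measure_mono fun y hy => ?_).trans (measure_ofReal_le_le_div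
    (F.stronglyMeasurable_centeredAverage e hφ).enorm.aemeasurable hx (hσ hθ hκ he hC hφ hφC))
  rw [mem_ofPred_eq, ← ofReal_norm]
  exact ENNReal.ofReal_le_ofReal hy

lemma exists_measure_exists_le_norm_centeredAverage_powScore_le [CompleteSpace H] {B : ℝ}
    (hB : ∀ θ y, F.density θ y ≤ B) {p q : ℝ} (hp : 0 < p) (hpq : p ≤ q) (A₁ A₂ : ℝ) :
    ∃ σ ≥ 0, ∀ {n : ℕ} {θ : Fin n → ℝ} {e : Fin n → H} {κ x : ℝ}, (∀ i, θ i ∈ Icc A₁ A₂) →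
      0 ≤ κ → (∀ i, ‖e i‖ ≤ κ) → 0 < x →
      Measure.pi (fun i => F.law (θ i))
          {y | ∃ a ∈ Icc p q, x ≤ ‖F.centeredAverage θ e (F.powScore a) y‖} ≤
        ENNReal.ofReal (σ * κ / √n / x) := by
  obtain ⟨σ, hσ0, hσ⟩ := F.exists_lintegral_enorm_centeredAverage_le (H := H) A₁ A₂
  obtain ⟨C, hC0, hC⟩ := F.exists_abs_le_weight hB hp A₁ A₂ q
  have hpq' : 0 ≤ q - p := sub_nonneg.2 hpq
  refine ⟨(1 + (q - p)) * (C * σ), by positivity, fun {n θ e κ x} hθ hκ he hx => ?_⟩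
  have hp' : p ∈ Icc p q := ⟨le_rfl, hpq⟩
  refine (measure_exists_le_norm_le hp'
    (F.stronglyMeasurable_centeredAverage e fun i => F.measurable_powScore p (θ i))
    (F.stronglyMeasurable_uncurry_centeredAverage_powScoreDeriv θ e)
    (fun y a ha => F.hasDerivAt_centeredAverage_powScore hB θ e y (hp.trans_le ha.1))
    (v := C * σ * κ / √n) (by positivity)
    (hσ hθ hκ he hC0 (fun i => F.measurable_powScore p (θ i)) fun i y => (hC p hp' _ (hθ i) y).1)
    (fun a ha => hσ hθ hκ he hC0
      (fun i => (F.measurable_uncurry_powScoreDeriv (θ i)).comp measurable_prodMk_left)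
      fun i y => (hC a ha _ (hθ i) y).2.1) hx).trans_eq ?_
  congr 2
  ring

end ExponentialFamily

/-- The quadrature rule with nodes `t i` and equal weights has error at most `κ ‖f'‖` for
`f ∈ W^{1,1}([0,1])`, the norm being that of `L¹([0,1])`. -/
def QuadratureBound {n : ℕ} (κ : ℝ) (t : Fin n → ℝ) : Prop :=
  ∀ f : ℝ → ℝ, MemSobolev 1 1 f → |(n : ℝ)⁻¹ * ∑ i, f (t i) - ∫ x in Icc (0 : ℝ) 1, f x| ≤
    κ * ∫ x in Icc (0 : ℝ) 1, |derivOn 1 f x|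

namespace MemSobolev

variable {m : ℕ} {f g g₀ : ℝ → ℝ}

lemma sub (hf : MemSobolev m 2 f) (hg : MemSobolev m 2 g) : MemSobolev m 2 (f - g) :=
  (sobolevSpace m).sub_mem hf hg

lemma sobolevNorm_sub_le {lam : ℝ} (hl : 0 ≤ lam) {h : ℝ → ℝ} (hf : MemSobolev m 2 f)
    (hg : MemSobolev m 2 g) (hh : MemSobolev m 2 h) :
    sobolevNorm m lam (f - h) ≤ sobolevNorm m lam (f - g) + sobolevNorm m lam (g - h) := by
  have key := norm_add_le (sobolevSpace.embedding m lam (⟨f, hf⟩ - ⟨g, hg⟩))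
    (sobolevSpace.embedding m lam (⟨g, hg⟩ - ⟨h, hh⟩))
  rwa [← map_add, sub_add_sub_cancel, sobolevSpace.norm_embedding hl,
    sobolevSpace.norm_embedding hl, sobolevSpace.norm_embedding hl] at key

lemma le_penalty_sub {lam : ℝ} (hl : 0 ≤ lam) (hg : MemSobolev m 2 g) (hg₀ : MemSobolev m 2 g₀) :
    lam * sqNorm (derivOn m (g - g₀)) -
        2 * √lam * √(sqNorm (derivOn m g₀)) * sobolevNorm m lam (g - g₀) ≤
      lam * sqNorm (derivOn m g) - lam * sqNorm (derivOn m g₀) := by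
  set u := (sobolevSpace.embedding m lam ⟨g₀, hg₀⟩).snd
  set v := (sobolevSpace.embedding m lam (⟨g, hg⟩ - ⟨g₀, hg₀⟩)).snd
  have hu : ‖u‖ ^ 2 = lam * sqNorm (derivOn m g₀) := sobolevSpace.sq_norm_snd_embedding hl _
  have hv : ‖v‖ ^ 2 = lam * sqNorm (derivOn m (g - g₀)) :=
    sobolevSpace.sq_norm_snd_embedding hl _
  have huv : ‖u + v‖ ^ 2 = lam * sqNorm (derivOn m g) := by
    rw [← sobolevSpace.sq_norm_snd_embedding hl ⟨g, hg⟩, ← WithLp.add_snd, ← map_add,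
      add_sub_cancel]
  have hu' : ‖u‖ = √lam * √(sqNorm (derivOn m g₀)) := by
    rw [← Real.sqrt_mul hl, ← hu, Real.sqrt_sq (norm_nonneg u)]
  have hv' : ‖v‖ ≤ sobolevNorm m lam (g - g₀) := by
    refine abs_le_of_sq_le_sq' ?_ (sobolevNorm_nonneg _ _ _) |>.2
    rw [hv, sobolevNorm_sq hl]
    exact le_add_of_nonneg_left (sqNorm_nonneg _)
  have hcross : -(‖u‖ * sobolevNorm m lam (g - g₀)) ≤ inner ℝ u v :=
    (neg_le_neg (mul_le_mul_of_nonneg_left hv' (norm_nonneg u))).trans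
      (neg_le_of_abs_le (abs_real_inner_le_norm u v))
  rw [← hv, ← huv, ← hu, mul_assoc 2, ← hu', norm_add_sq_real]
  linarith

lemma sq (hf : MemSobolev 1 2 f) : MemSobolev 1 2 fun x => f x ^ 2 :=
  memSobolev_one_iff.2 (memSobolev_one_iff.1 hf).sq.hasL2Deriv_derivOn

lemma abs_average_sq_sub_sqNorm_le {n : ℕ} {t : Fin n → ℝ} {κ : ℝ} (hκ : 0 ≤ κ)
    (ht : QuadratureBound κ t) (hf : MemSobolev 1 2 f) {s : ℝ} (hs : 0 < s) :
    |(n : ℝ)⁻¹ * ∑ i, f (t i) ^ 2 - sqNorm f| ≤ κ / s * sobolevNorm 1 (s ^ 2) f ^ 2 := by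
  have h := memSobolev_one_iff.1 hf
  have hL1 : MemSobolev 1 1 fun x => f x ^ 2 :=
    ⟨hf.sq.1, hf.sq.2.1, hf.sq.2.2.mono_exponent one_le_two⟩
  have hderiv : ∫ x in Icc (0 : ℝ) 1, |derivOn 1 (fun x => f x ^ 2) x| =
      2 * ∫ x in Icc (0 : ℝ) 1, |f x * derivOn 1 f x| := by
    rw [← integral_const_mul]
    refine integral_congr_ae (h.sq.derivOn_ae_eq.mono fun x hx => ?_)
    simp only [hx, abs_mul, abs_two]
  calc |(n : ℝ)⁻¹ * ∑ i, f (t i) ^ 2 - sqNorm f|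
      ≤ κ * (2 * ∫ x in Icc (0 : ℝ) 1, |f x * derivOn 1 f x|) := hderiv ▸ ht _ hL1
    _ ≤ κ * ((sqNorm f + s ^ 2 * sqNorm (derivOn 1 f)) / s) :=
        mul_le_mul_of_nonneg_left (two_mul_integral_abs_mul_le (h.memLp 2) h.memLp_deriv hs) hκ
    _ = κ / s * sobolevNorm 1 (s ^ 2) f ^ 2 := by
        rw [sobolevNorm_sq (sq_nonneg s)]
        ring

end MemSobolev

namespace IsEvaluationFamily

variable {H : Type*} [NormedAddCommGroup H] [InnerProductSpace ℝ H] {n : ℕ} {s : ℝ}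
  {t : Fin n → ℝ} {e : Fin n → H}

lemma abs_average_centered_le (he : IsEvaluationFamily s t e) (F : ExponentialFamily)
    (θ : Fin n → ℝ) (φ : ℝ → ℝ → ℝ) (y : Fin n → ℝ) {f : ℝ → ℝ} (hf : MemSobolev 1 2 f) :
    |(n : ℝ)⁻¹ * ∑ i, F.centered (θ i) (φ (θ i)) (y i) * f (t i)| ≤
      ‖F.centeredAverage θ e φ y‖ * sobolevNorm 1 (s ^ 2) f := by
  rw [ExponentialFamily.centeredAverage, norm_smul, abs_mul, mul_assoc, Real.norm_eq_abs]
  exact mul_le_mul_of_nonneg_left (he.abs_sum_le _ f hf) (abs_nonneg _)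

lemma le_average_quadratic (he : IsEvaluationFamily s t e) (F : ExponentialFamily)
    (θ : Fin n → ℝ) (φ ψ χ : ℝ → ℝ → ℝ) (y : Fin n → ℝ) (c : ℝ) {κ : ℝ}
    (hκ : κ ∈ Icc (0 : ℝ) 1) {h : ℝ → ℝ} (hh : MemSobolev 1 2 h) :
    c * ((n : ℝ)⁻¹ * ∑ i, h (t i) ^ 2) -
        (‖F.centeredAverage θ e φ y‖ + ‖F.centeredAverage θ e ψ y‖) *
          sobolevNorm 1 (s ^ 2) (fun x => h x ^ 2) -
        ‖F.centeredAverage θ e χ y‖ * sobolevNorm 1 (s ^ 2) h ≤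
      (n : ℝ)⁻¹ * ∑ i, ((c - F.centered (θ i) (φ (θ i)) (y i) / 2 -
        κ * F.centered (θ i) (ψ (θ i)) (y i)) * h (t i) ^ 2 -
          F.centered (θ i) (χ (θ i)) (y i) * h (t i)) := by
  have hexpand : (n : ℝ)⁻¹ * ∑ i, ((c - F.centered (θ i) (φ (θ i)) (y i) / 2 -
        κ * F.centered (θ i) (ψ (θ i)) (y i)) * h (t i) ^ 2 -
          F.centered (θ i) (χ (θ i)) (y i) * h (t i)) =
      c * ((n : ℝ)⁻¹ * ∑ i, h (t i) ^ 2) -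
        1 / 2 * ((n : ℝ)⁻¹ * ∑ i, F.centered (θ i) (φ (θ i)) (y i) * h (t i) ^ 2) -
        κ * ((n : ℝ)⁻¹ * ∑ i, F.centered (θ i) (ψ (θ i)) (y i) * h (t i) ^ 2) -
        (n : ℝ)⁻¹ * ∑ i, F.centered (θ i) (χ (θ i)) (y i) * h (t i) := by
    simp only [Finset.mul_sum, ← Finset.sum_sub_distrib]
    exact Finset.sum_congr rfl fun i _ => by ring
  have hφ := (abs_le.1 (he.abs_average_centered_le F θ φ y hh.sq)).2
  have hψ := (abs_le.1 (he.abs_average_centered_le F θ ψ y hh.sq)).2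
  have hχ := (abs_le.1 (he.abs_average_centered_le F θ χ y hh)).2
  have hφ0 := mul_nonneg (norm_nonneg (F.centeredAverage θ e φ y))
    (sobolevNorm_nonneg 1 (s ^ 2) fun x => h x ^ 2)
  have hψ0 := mul_nonneg (norm_nonneg (F.centeredAverage θ e ψ y))
    (sobolevNorm_nonneg 1 (s ^ 2) fun x => h x ^ 2)
  have hκψ := (mul_le_mul_of_nonneg_left hψ hκ.1).trans (mul_le_of_le_one_left hψ0 hκ.2)
  rw [hexpand]
  linarith

end IsEvaluationFamily

namespace ExponentialFamily

variable (F : ExponentialFamily) {B : ℝ} (hB : ∀ θ y, F.density θ y ≤ B) {p q α₀ c₀ : ℝ}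
include hB

lemma exists_le_dpdLoss_sub (hp : 0 < p) (hα₀ : α₀ ∈ Icc p q) (hc₀ : 0 < c₀) (A₁ A₂ : ℝ) :
    ∃ ρ > 0, ∃ κ ∈ Icc (0 : ℝ) 1, ∀ α ∈ Icc p q, |α - α₀| ≤ ρ → ∀ θ₀ ∈ Icc A₁ A₂,
      c₀ ≤ ∫ y, F.powInfo α₀ θ₀ y ∂F.law θ₀ → ∀ θ, |θ - θ₀| ≤ ρ → ∀ y,
        (1 + α) * ((c₀ / 4 - F.centered θ₀ (F.powCurv α₀ θ₀) y / 2 -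
            κ * F.centered θ₀ weight y) * (θ - θ₀) ^ 2 -
              F.centered θ₀ (F.powScore α θ₀) y * (θ - θ₀)) ≤
          F.dpdLoss α y θ - F.dpdLoss α y θ₀ := by
  obtain ⟨C, hC0, hC⟩ := F.exists_abs_dpdLoss_taylor_le hB hp (A₁ - 1) (A₂ + 1) q
  obtain ⟨M, hM0, hM⟩ := F.exists_moment_le A₁ A₂ 5
  set D := 8 * (C + 1) * (M + 1)
  have hD : 0 < D := by positivity
  set ρ := min 1 c₀ / D
  have hρ0 : 0 < ρ := div_pos (lt_min one_pos hc₀) hD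
  have hρD : ρ * D = min 1 c₀ := div_mul_cancel₀ _ hD.ne'
  have hCD : 8 * C ≤ D := by nlinarith
  have hCMD : 8 * (C * M) ≤ D := by nlinarith
  have hκ : 2 * C * ρ ≤ 1 := by nlinarith [min_le_left 1 c₀]
  have hκM : 2 * C * ρ * M ≤ c₀ / 4 := by nlinarith [min_le_right 1 c₀]
  have hρ1 : ρ ≤ 1 := by nlinarith [min_le_left 1 c₀, mul_nonneg hC0 hM0]
  refine ⟨ρ, hρ0, 2 * C * ρ, ⟨by positivity, hκ⟩, fun α hα hαρ θ₀ hθ₀ hinfo θ hθ y => ?_⟩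
  have hα1 : 0 ≤ 1 + α := by linarith [hα.1]
  obtain ⟨hθ₁, hθ₂⟩ := abs_le.1 hθ
  have htaylor := (abs_le.1 (hC α hα α₀ hα₀ θ ⟨by linarith [hθ₀.1], by linarith [hθ₀.2]⟩ θ₀
    ⟨by linarith [hθ₀.1], by linarith [hθ₀.2]⟩ y)).1
  have hrest : C * weight y * ((|θ - θ₀| + |α - α₀|) * (θ - θ₀) ^ 2) ≤
      2 * C * ρ * F.centered θ₀ weight y * (θ - θ₀) ^ 2 + c₀ / 4 * (θ - θ₀) ^ 2 :=
    calc C * weight y * ((|θ - θ₀| + |α - α₀|) * (θ - θ₀) ^ 2)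
        ≤ C * weight y * ((ρ + ρ) * (θ - θ₀) ^ 2) := by
          have := weight_nonneg y
          gcongr
      _ = 2 * C * ρ * F.centered θ₀ weight y * (θ - θ₀) ^ 2 +
          2 * C * ρ * (∫ x, weight x ∂F.law θ₀) * (θ - θ₀) ^ 2 := by rw [centered]; ring
      _ ≤ _ := by
          gcongr
          exact (mul_le_mul_of_nonneg_left (hM θ₀ hθ₀) (by positivity)).trans hκM
  have hquad := mul_le_mul_of_nonneg_right hinfo (sq_nonneg (θ - θ₀))
  refine le_trans ?_ (neg_le_sub_iff_le_add.1 htaylor |> sub_le_iff_le_add.2)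
  rw [← mul_sub]
  exact mul_le_mul_of_nonneg_left (by linarith) hα1

lemma exists_le_average_dpdLoss_sub (hp : 0 < p) (hα₀ : α₀ ∈ Icc p q) (hc₀ : 0 < c₀)
    (A₁ A₂ : ℝ) {H : Type*} [NormedAddCommGroup H] [InnerProductSpace ℝ H] :
    ∃ ρ > 0, ∀ {n : ℕ} {s : ℝ} {t : Fin n → ℝ} {e : Fin n → H} {θ : Fin n → ℝ},
      IsEvaluationFamily s t e → (∀ i, θ i ∈ Icc A₁ A₂) →
      (∀ i, c₀ ≤ ∫ y, F.powInfo α₀ (θ i) y ∂F.law (θ i)) →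
      ∀ α ∈ Icc p q, |α - α₀| ≤ ρ → ∀ h, MemSobolev 1 2 h → (∀ i, |h (t i)| ≤ ρ) →
        ∀ y : Fin n → ℝ,
          (1 + α) * (c₀ / 4 * ((n : ℝ)⁻¹ * ∑ i, h (t i) ^ 2) -
              (‖F.centeredAverage θ e (F.powCurv α₀) y‖ +
                ‖F.centeredAverage θ e (fun _ => weight) y‖) *
                  sobolevNorm 1 (s ^ 2) (fun x => h x ^ 2) -
              ‖F.centeredAverage θ e (F.powScore α) y‖ * sobolevNorm 1 (s ^ 2) h) ≤
            (n : ℝ)⁻¹ * ∑ i, (F.dpdLoss α (y i) (θ i + h (t i)) - F.dpdLoss α (y i) (θ i)) := by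
  obtain ⟨ρ, hρ0, κ, hκ, hρ⟩ := F.exists_le_dpdLoss_sub hB hp hα₀ hc₀ A₁ A₂
  refine ⟨ρ, hρ0, fun {n s t e θ} he hθ hinfo α hα hαρ h hh hhρ y => ?_⟩
  have hα1 : 0 ≤ 1 + α := by linarith [hα.1]
  have hloss (i : Fin n) := hρ α hα hαρ (θ i) (hθ i) (hinfo i) (θ i + h (t i))
    (by simpa using hhρ i) (y i)
  have hsum := mul_le_mul_of_nonneg_left (Finset.sum_le_sum fun i (_ : i ∈ Finset.univ) => hloss i)
    (inv_nonneg.2 n.cast_nonneg : (0 : ℝ) ≤ (n : ℝ)⁻¹)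
  simp only [add_sub_cancel_left] at hsum
  rw [← Finset.mul_sum, mul_left_comm] at hsum
  exact (mul_le_mul_of_nonneg_left (he.le_average_quadratic F θ (F.powCurv α₀) (fun _ => weight)
    (F.powScore α) y (c₀ / 4) hκ hh) hα1).trans hsum

end ExponentialFamily

lemma MemSobolev.abs_le_of_sobolevNorm_one_le {f : ℝ → ℝ} (hf : MemSobolev 1 2 f) {t : ℝ}
    (ht : t ∈ Icc (0 : ℝ) 1) {s r : ℝ} (hs : 0 < s) (hs1 : s ≤ 1) (hr : 0 ≤ r)
    (h : sobolevNorm 1 (s ^ 2) f ≤ r * √s) : |f t| ≤ 2 * r :=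
  calc |f t| ≤ √(2 / s) * (r * √s) := (hf.abs_le_sobolevNorm_one ht hs hs1).trans (by gcongr)
    _ = √2 * r := by
      rw [mul_left_comm, ← Real.sqrt_mul (by positivity), div_mul_cancel₀ _ hs.ne', mul_comm]
    _ ≤ 2 * r := by
      gcongr
      exact Real.sqrt_le_iff.2 ⟨by norm_num, by norm_num⟩

lemma MemSobolev.le_average_sq_sub {n : ℕ} {t : Fin n → ℝ} {κ s τ ν c : ℝ} {h : ℝ → ℝ}
    (hh : MemSobolev 1 2 h) (ht : QuadratureBound κ t) (hs : 0 < s) (hs1 : s ≤ 1) (hκ : 0 ≤ κ)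
    (hκτ : κ ≤ τ * s) (hντ : ν ≤ 2 * (τ * √s)) (hc : 0 ≤ c) :
    c * sqNorm h - (c + 6) * τ * sobolevNorm 1 (s ^ 2) h ^ 2 ≤
      c * ((n : ℝ)⁻¹ * ∑ i, h (t i) ^ 2) - ν * sobolevNorm 1 (s ^ 2) (fun x => h x ^ 2) := by
  have hτ : 0 ≤ τ := nonneg_of_mul_nonneg_left (hκ.trans hκτ) hs
  have hsqrt : √s * √(2 / s) = √2 := by rw [← Real.sqrt_mul hs.le, mul_div_cancel₀ _ hs.ne']
  have hquad := (abs_le.1 (hh.abs_average_sq_sub_sqNorm_le hκ ht hs)).1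
  have hκs : κ / s ≤ τ := (div_le_iff₀ hs).2 hκτ
  have hnoise : ν * sobolevNorm 1 (s ^ 2) (fun x => h x ^ 2) ≤
      6 * τ * sobolevNorm 1 (s ^ 2) h ^ 2 :=
    calc ν * sobolevNorm 1 (s ^ 2) (fun x => h x ^ 2)
        ≤ 2 * (τ * √s) * (2 * √(2 / s) * sobolevNorm 1 (s ^ 2) h ^ 2) :=
          mul_le_mul hντ (hh.sobolevNorm_one_sq_le hs hs1) (sobolevNorm_nonneg _ _ _)
            (by positivity)
      _ = 4 * √2 * τ * sobolevNorm 1 (s ^ 2) h ^ 2 := by rw [← hsqrt]; ring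
      _ ≤ 6 * τ * sobolevNorm 1 (s ^ 2) h ^ 2 := by
          gcongr
          nlinarith [Real.sq_sqrt (zero_le_two (α := ℝ)), Real.sqrt_nonneg 2]
  have hmul := mul_le_mul_of_nonneg_left
    (hquad.trans' (neg_le_neg (mul_le_mul_of_nonneg_right hκs (sq_nonneg _)))) hc
  linarith

lemma sub_mul_sq_le_of_coercive {k τ α q C R S D N Q Z x G : ℝ} (hk : 0 ≤ k) (hτ : 0 ≤ τ)
    (hα : 0 ≤ α) (hαq : α ≤ q) (hS : 0 ≤ S) (hD : 0 ≤ D) (hG : 0 ≤ G) (hZ : 0 ≤ Z) (hx : 0 ≤ x)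
    (hN : N ∈ Icc 0 (C * R)) (hR : 0 ≤ R) (hnorm : R ^ 2 = S + D)
    (hQ : k * S - (k + 6) * τ * N ^ 2 ≤ Q) (hZx : Z + x ≤ τ * R) :
    (min k 1 - ((1 + q) * ((k + 6) * C ^ 2) + ((1 + q) * C + 2 * G)) * τ) * R ^ 2 ≤
      (1 + α) * (Q - Z * N) + (D - 2 * x * G * R) := by
  obtain ⟨hN0, hN⟩ := hN
  have hq : 0 ≤ 1 + q := by linarith
  have hmain : min k 1 * R ^ 2 ≤ (1 + α) * (k * S) + D := by
    rw [hnorm]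
    nlinarith [mul_le_mul_of_nonneg_right (min_le_left k 1) hS,
      mul_le_mul_of_nonneg_right (min_le_right k 1) hD, mul_nonneg hα (mul_nonneg hk hS)]
  have hloss : (1 + α) * ((k + 6) * τ * N ^ 2) ≤ (1 + q) * ((k + 6) * τ * (C * R) ^ 2) := by
    gcongr
  have hnoise : (1 + α) * (Z * N) ≤ (1 + q) * (τ * R * (C * R)) := by
    have : Z ≤ τ * R := by linarith
    gcongr
  have hpenalty : 2 * x * G * R ≤ 2 * (τ * R) * G * R := by
    have : x ≤ τ * R := by linarith
    gcongr
  have := mul_le_mul_of_nonneg_left hQ (by linarith : 0 ≤ 1 + α)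
  linarith

namespace ExponentialFamily

variable (F : ExponentialFamily) {H : Type*} [NormedAddCommGroup H] [InnerProductSpace ℝ H] {n : ℕ}

/-- The random conditions, for the tolerance `τ`, under which the criterion exceeds its value at
`g₀` on the sphere of radius `R` around `g₀` in the norm `‖·‖_{m,s^{2m}}`. -/
structure IsGoodSample (m : ℕ) (g₀ : ℝ → ℝ) (α₀ τ s R : ℝ) (t : Fin n → ℝ) (e : Fin n → H)
    (α : ℝ) (y : Fin n → ℝ) : Prop where
  abs_sub_le : |α - α₀| ≤ τ
  norm_powCurv_lt : ‖F.centeredAverage (fun i => g₀ (t i)) e (F.powCurv α₀) y‖ < τ * √s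
  norm_weight_lt : ‖F.centeredAverage (fun i => g₀ (t i)) e (fun _ => weight) y‖ < τ * √s
  norm_powScore_add_lt :
    ‖F.centeredAverage (fun i => g₀ (t i)) e (F.powScore α) y‖ + s ^ m < τ * R

variable {F} {m : ℕ} {B p q α₀ c₀ : ℝ} {g₀ : ℝ → ℝ}

lemma dpdCriterion_sub_dpdCriterion (lam α : ℝ) (t y : Fin n → ℝ) (g : ℝ → ℝ) :
    dpdCriterion F m lam α t y g - dpdCriterion F m lam α t y g₀ =
      (n : ℝ)⁻¹ * ∑ i, (F.dpdLoss α (y i) (g (t i)) - F.dpdLoss α (y i) (g₀ (t i))) +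
        (lam * sqNorm (derivOn m g) - lam * sqNorm (derivOn m g₀)) := by
  simp only [dpdCriterion, sqNorm, sq_abs, one_div, Finset.sum_sub_distrib]
  ring

lemma exists_le_dpdCriterion_sub (hB : ∀ θ y, F.density θ y ≤ B) (hp : 0 < p)
    (hα₀ : α₀ ∈ Icc p q) (hc₀ : 0 < c₀) (hm : 1 ≤ m) (hg₀ : MemSobolev m 2 g₀) :
    ∃ ρ > 0, ∃ C > 0, ∀ {n : ℕ} {τ s κ R : ℝ} {t : Fin n → ℝ} {e : Fin n → H} {α : ℝ}
      {y : Fin n → ℝ}, 0 < s → s ≤ 1 → (∀ i, t i ∈ Icc (0 : ℝ) 1) →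
      IsEvaluationFamily s t e → QuadratureBound κ t → 0 ≤ κ → κ ≤ τ * s →
      (∀ i, c₀ ≤ ∫ y, F.powInfo α₀ (g₀ (t i)) y ∂F.law (g₀ (t i))) → τ ≤ ρ → R ≤ τ * √s →
      α ∈ Icc p q → F.IsGoodSample m g₀ α₀ τ s R t e α y → ∀ g, MemSobolev m 2 g →
        sobolevNorm m (s ^ (2 * m)) (g - g₀) = R → (min (c₀ / 4) 1 - C * τ) * R ^ 2 ≤
          dpdCriterion F m (s ^ (2 * m)) α t y g - dpdCriterion F m (s ^ (2 * m)) α t y g₀ := by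
  obtain ⟨b, hb0, hb⟩ := MemSobolev.exists_abs_le_sobolevNorm hm one_pos
  set A := b * sobolevNorm m 1 g₀
  obtain ⟨ρ, hρ0, hρ⟩ := F.exists_le_average_dpdLoss_sub hB hp hα₀ hc₀ (-A) A (H := H)
  obtain ⟨C, hC1, hC⟩ := MemSobolev.exists_sobolevNorm_one_le hm
  set G := √(sqNorm (derivOn m g₀))
  have hq : 0 < 1 + q := by linarith [hα₀.1, hα₀.2]
  refine ⟨ρ / (2 * C), by positivity, (1 + q) * ((c₀ / 4 + 6) * C ^ 2) + ((1 + q) * C + 2 * G),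
    by positivity, fun {n τ s κ R t e α y} hs hs1 ht he hquad hκ hκτ hinfo hτρ hRτ hα hy g hg hgR
    => ?_⟩
  have hh := hg.sub hg₀
  have hh1 : MemSobolev 1 2 (g - g₀) := memSobolev_one_iff.2 (hh.hasL2Deriv hm)
  have hN1 : sobolevNorm 1 (s ^ 2) (g - g₀) ≤ C * R := hgR ▸ hC _ hh s hs hs1
  have hτ : 0 ≤ τ := nonneg_of_mul_nonneg_left (hκ.trans hκτ) hs
  have hR : 0 ≤ R := hgR ▸ sobolevNorm_nonneg _ _ _
  have hρτ : 2 * (C * τ) ≤ ρ := by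
    rw [le_div_iff₀ (by positivity)] at hτρ
    linarith
  have hsup (i : Fin n) : |(g - g₀) (t i)| ≤ ρ := by
    refine (hh1.abs_le_of_sobolevNorm_one_le (ht i) hs hs1 (by positivity)
      (hN1.trans ?_)).trans hρτ
    rw [mul_assoc]
    gcongr
  have hbound (i : Fin n) : g₀ (t i) ∈ Icc (-A) A := abs_le.1 (hb g₀ hg₀ _ (ht i))
  have hfit := hρ he hbound hinfo α hα (hy.abs_sub_le.trans (by nlinarith)) _ hh1 hsup y
  have hcoercive := hh1.le_average_sq_sub hquad hs hs1 hκ hκτ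
    ((add_lt_add hy.norm_powCurv_lt hy.norm_weight_lt).le.trans_eq (two_mul _).symm)
    (by positivity : 0 ≤ c₀ / 4)
  have hpenalty := hg.le_penalty_sub (pow_nonneg hs.le (2 * m)) hg₀
  have hnorm := sobolevNorm_sq (pow_nonneg hs.le (2 * m)) (g - g₀) (m := m)
  rw [hgR] at hpenalty hnorm
  simp only [Pi.sub_apply, add_sub_cancel] at hfit
  rw [dpdCriterion_sub_dpdCriterion]
  refine le_trans ?_ (add_le_add hfit hpenalty)
  exact sub_mul_sq_le_of_coercive (by positivity) hτ (hp.le.trans hα.1) hα.2 (sqNorm_nonneg _)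
    (mul_nonneg (pow_nonneg hs.le _) (sqNorm_nonneg _)) (Real.sqrt_nonneg _) (norm_nonneg _)
    (Real.sqrt_nonneg _) ⟨sobolevNorm_nonneg _ _ _, hN1⟩ hR hnorm hcoercive
    (by rw [pow_mul', Real.sqrt_sq (by positivity)]; exact hy.norm_powScore_add_lt.le)

end ExponentialFamily

lemma sobolevNorm_zero (m : ℕ) (lam : ℝ) : sobolevNorm m lam 0 = 0 := by
  simp [sobolevNorm, derivOn_fun_zero]

namespace ExponentialFamily

variable {F : ExponentialFamily} {m n : ℕ} {B α₀ c₀ : ℝ} {g₀ : ℝ → ℝ}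

lemma exists_isSobolevLocalMin_of_forall_sphere_lt (hB : ∀ θ y, F.density θ y ≤ B) (hm : 1 ≤ m)
    (hg₀ : MemSobolev m 2 g₀) {lam α R : ℝ} (hlam : 0 < lam) (hα : 0 < α) (hR : 0 ≤ R)
    {t y : Fin n → ℝ} (ht : ∀ i, t i ∈ Icc (0 : ℝ) 1)
    (hsphere : ∀ g, MemSobolev m 2 g → sobolevNorm m lam (g - g₀) = R →
      dpdCriterion F m lam α t y g₀ < dpdCriterion F m lam α t y g) :
    ∃ g, IsSobolevLocalMin m lam (dpdCriterion F m lam α t y) g ∧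
      sobolevNorm m lam (g - g₀) ≤ R := by
  have hΦ : Continuous fun v : Fin n → ℝ => 1 / (n : ℝ) * ∑ i, F.dpdLoss α (y i) (v i) :=
    continuous_const.mul (continuous_finsetSum _ fun i _ =>
      (F.continuous_dpdLoss hB hα (y i)).comp (continuous_apply i))
  obtain ⟨g, hg, hgR, hmin⟩ := sobolevSpace.exists_forall_penalized_le hm hlam hR ht hΦ hg₀
  have hcrit (h : ℝ → ℝ) : dpdCriterion F m lam α t y h =
      1 / (n : ℝ) * ∑ i, F.dpdLoss α (y i) (h (t i)) + lam * sqNorm (derivOn m h) := by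
    simp only [dpdCriterion, sqNorm, sq_abs]
  simp only [← hcrit] at hmin
  have hlt : sobolevNorm m lam (g - g₀) < R := by
    refine lt_of_le_of_ne hgR fun h => (hmin g₀ hg₀ ?_).not_gt (hsphere g hg h)
    simpa only [sub_self, sobolevNorm_zero] using hR
  refine ⟨g, ⟨hg, R - sobolevNorm m lam (g - g₀), sub_pos.2 hlt, fun h hh hhg => hmin h hh ?_⟩,
    hgR⟩
  exact (MemSobolev.sobolevNorm_sub_le hlam.le hh hg hg₀).trans
    (by linarith [show sobolevNorm m lam (h - g) < _ from hhg])

end ExponentialFamily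

lemma noise_bound_add_le {N s R τ v w z : ℝ} (hN : 0 ≤ N) (hs : 0 < s) (hR : 0 < R) (hτ : 0 < τ)
    (hv : 0 ≤ v) (hw : 0 ≤ w) (hz : 0 ≤ z) :
    v * √(2 / s) / √N / (τ * √s) + (w * √(2 / s) / √N / (τ * √s) +
        z * √(2 / s) / √N / (τ * R / 2)) ≤
      √2 * (v + w + 2 * z) / τ / (√N * s) + √2 * (v + w + 2 * z) / τ / (√(N * s) * R) := by
  have hscale (c : ℝ) : c * √(2 / s) / √N / (τ * √s) = √2 * c / τ / (√N * s) := by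
    rw [Real.sqrt_div zero_le_two]
    nth_rw 3 [← Real.mul_self_sqrt hs.le]
    ring
  have hradius : z * √(2 / s) / √N / (τ * R / 2) = √2 * (2 * z) / τ / (√(N * s) * R) := by
    rw [Real.sqrt_div zero_le_two, Real.sqrt_mul hN]
    ring
  rw [hscale, hscale, hradius, ← add_assoc, ← add_div, ← add_div, ← mul_add]
  have hvw : v + w ≤ v + w + 2 * z := by linarith
  have hzz : 2 * z ≤ v + w + 2 * z := by linarith
  exact add_le_add (by gcongr) (by gcongr)

namespace ExponentialFamily

variable (F : ExponentialFamily) (H : Type*) [NormedAddCommGroup H] [InnerProductSpace ℝ H]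
  {m : ℕ} {B α₀ : ℝ} {g₀ : ℝ → ℝ}

lemma exists_isSobolevLocalMin_of_isGoodSample (hB : ∀ θ y, F.density θ y ≤ B) (hm : 1 ≤ m)
    (hα₀ : 0 < α₀) {c₀ : ℝ} (hc₀ : 0 < c₀) (hg₀ : MemSobolev m 2 g₀) :
    ∃ τ ∈ Ioc 0 (α₀ / 2), ∀ {n : ℕ} {s κ R : ℝ} {t : Fin n → ℝ} {e : Fin n → H} {α : ℝ}
      {y : Fin n → ℝ}, 0 < s → s ≤ 1 → (∀ i, t i ∈ Icc (0 : ℝ) 1) → IsEvaluationFamily s t e →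
      QuadratureBound κ t → 0 ≤ κ → κ ≤ τ * s →
      (∀ i, c₀ ≤ ∫ y, F.powInfo α₀ (g₀ (t i)) y ∂F.law (g₀ (t i))) → 0 < R → R ≤ τ * √s →
      F.IsGoodSample m g₀ α₀ τ s R t e α y →
        ∃ g, IsSobolevLocalMin m (s ^ (2 * m)) (dpdCriterion F m (s ^ (2 * m)) α t y) g ∧
          sobolevNorm m (s ^ (2 * m)) (g - g₀) ≤ R := by
  obtain ⟨ρ, hρ, C, hC, hgrowth⟩ := exists_le_dpdCriterion_sub (H := H) hB (half_pos hα₀)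
    (⟨by linarith, by linarith⟩ : α₀ ∈ Icc (α₀ / 2) (2 * α₀)) hc₀ hm hg₀
  have hd : 0 < min (c₀ / 4) 1 := by positivity
  refine ⟨min (α₀ / 2) (min ρ (min (c₀ / 4) 1 / (2 * C))), ⟨by positivity, min_le_left _ _⟩, ?_⟩
  set τ := min (α₀ / 2) (min ρ (min (c₀ / 4) 1 / (2 * C)))
  have hτα : τ ≤ α₀ / 2 := min_le_left _ _
  have hτρ : τ ≤ ρ := (min_le_right _ _).trans (min_le_left _ _)
  have hτC : C * τ < min (c₀ / 4) 1 := by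
    have : τ ≤ min (c₀ / 4) 1 / (2 * C) := (min_le_right _ _).trans (min_le_right _ _)
    rw [le_div_iff₀ (by positivity)] at this
    linarith
  intro n s κ R t e α y hs hs1 ht he hquad hκ hκτ hinfo hR hRτ hy
  obtain ⟨hα₁, hα₂⟩ := abs_le.1 hy.abs_sub_le
  have hα : α ∈ Icc (α₀ / 2) (2 * α₀) := ⟨by linarith, by linarith⟩
  refine exists_isSobolevLocalMin_of_forall_sphere_lt hB hm hg₀ (pow_pos hs _) (by linarith)
    hR.le ht fun g hg hgR => sub_pos.1 ?_
  exact (mul_pos (sub_pos.2 hτC) (pow_pos hR 2)).trans_le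
    (hgrowth hs hs1 ht he hquad hκ hκτ hinfo hτρ hRτ hα hy g hg hgR)

variable {F H} in
lemma isGoodSample_of_forall_norm_lt {n : ℕ} {τ s R : ℝ} {t : Fin n → ℝ} {e : Fin n → H} {α : ℝ}
    {y : Fin n → ℝ} (hτ : τ ≤ α₀ / 2) (hsR : 2 * s ^ m ≤ τ * R) (hα : |α - α₀| < τ)
    (hcurv : ‖F.centeredAverage (fun i => g₀ (t i)) e (F.powCurv α₀) y‖ < τ * √s)
    (hweight : ‖F.centeredAverage (fun i => g₀ (t i)) e (fun _ => weight) y‖ < τ * √s)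
    (hscore : ∀ a ∈ Icc (α₀ / 2) (2 * α₀),
      ‖F.centeredAverage (fun i => g₀ (t i)) e (F.powScore a) y‖ < τ * R / 2) :
    F.IsGoodSample m g₀ α₀ τ s R t e α y := by
  obtain ⟨hα₁, hα₂⟩ := abs_lt.1 hα
  exact ⟨hα.le, hcurv, hweight, by linarith [hscore α ⟨by linarith, by linarith⟩]⟩

lemma exists_measure_not_isGoodSample_le [CompleteSpace H] (hB : ∀ θ y, F.density θ y ≤ B)
    (hm : 1 ≤ m) (hg₀ : MemSobolev m 2 g₀) {τ : ℝ} (hτ : τ ∈ Ioc 0 (α₀ / 2)) :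
    ∃ σ ≥ 0, ∀ {Ω : Type*} [MeasurableSpace Ω] {P : Measure Ω} {n : ℕ} {s R : ℝ}
      {t : Fin n → ℝ} {e : Fin n → H} {Y : Fin n → Ω → ℝ} {αhat : Ω → ℝ}, 0 < s →
      (∀ i, t i ∈ Icc (0 : ℝ) 1) → IsEvaluationFamily s t e →
      (∀ i, HasLaw (Y i) (F.law (g₀ (t i))) P) → iIndepFun Y P → 0 < R → 2 * s ^ m ≤ τ * R →
        P {ω | ¬ F.IsGoodSample m g₀ α₀ τ s R t e (αhat ω) (fun i => Y i ω)} ≤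
          P {ω | τ ≤ |αhat ω - α₀|} + ENNReal.ofReal (σ / (√n * s) + σ / (√(n * s) * R)) := by
  obtain ⟨b, -, hb⟩ := MemSobolev.exists_abs_le_sobolevNorm hm one_pos
  set A := b * sobolevNorm m 1 g₀
  have hτ0 : 0 < τ := hτ.1
  have hα₀ : 0 < α₀ := by linarith [hτ.2]
  obtain ⟨C, hC0, hC⟩ := F.exists_abs_le_weight hB hα₀ (-A) A α₀
  obtain ⟨σ, hσ0, hσ⟩ := F.exists_measure_le_norm_centeredAverage_le H (-A) A
  obtain ⟨σ', hσ'0, hσ'⟩ := F.exists_measure_exists_le_norm_centeredAverage_powScore_le H hB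
    (half_pos hα₀) (by linarith : α₀ / 2 ≤ 2 * α₀) (-A) A
  refine ⟨√2 * (C * σ + 1 * σ + 2 * σ') / τ, by positivity,
    fun {Ω _ P n s R t e Y αhat} hs ht he hY hindep hR hsR => ?_⟩
  have hbound (i : Fin n) : g₀ (t i) ∈ Icc (-A) A := abs_le.1 (hb g₀ hg₀ _ (ht i))
  have hκ : 0 ≤ √(2 / s) := Real.sqrt_nonneg _
  have hx : 0 < τ * √s := mul_pos hτ0 (Real.sqrt_pos.2 hs)
  have hcurv := (measure_preimage_le_pi hY hindep _).trans (hσ (φ := F.powCurv α₀) hbound hκ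
    he.norm_le hC0 (fun i => F.measurable_powCurv α₀ _)
    (fun i y => (hC α₀ ⟨by linarith, le_rfl⟩ _ (hbound i) y).2.2.1) hx)
  have hweight := (measure_preimage_le_pi hY hindep _).trans (hσ (φ := fun _ => weight) hbound hκ
    he.norm_le zero_le_one (fun _ => measurable_weight)
    (fun _ y => by rw [one_mul, abs_of_nonneg (weight_nonneg y)]) hx)
  have hscore := (measure_preimage_le_pi hY hindep _).trans (hσ' (x := τ * R / 2) hbound hκ
    he.norm_le (by positivity))
  refine (measure_mono (t := _ ∪ (_ ∪ (_ ∪ _))) fun ω hω => ?_).trans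
    ((measure_union_le _ _).trans (add_le_add_right ((measure_union_le _ _).trans
      ((add_le_add hcurv ((measure_union_le _ _).trans (add_le_add hweight hscore))).trans ?_)) _))
  · by_contra hgood
    simp only [mem_union, mem_ofPred_eq, not_or, not_le, not_exists, not_and] at hgood
    exact hω (isGoodSample_of_forall_norm_lt hτ.2 hsR hgood.1 hgood.2.1 hgood.2.2.1 hgood.2.2.2)
  · rw [← ENNReal.ofReal_add, ← ENNReal.ofReal_add]
    · exact ENNReal.ofReal_le_ofReal (noise_bound_add_le n.cast_nonneg hs hR hτ0 (by positivity)
        (by positivity) hσ'0)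
    all_goals positivity

end ExponentialFamily

lemma QuasiUniformDesign.exists_quadratureBound {t : (n : ℕ) → Fin n → ℝ}
    (ht : QuasiUniformDesign t) :
    ∃ K ≥ 0, ∀ᶠ n : ℕ in atTop, QuadratureBound (K / n) (t n) := by
  obtain ⟨n₀, K, hK⟩ := ht
  refine ⟨|K|, abs_nonneg K, (eventually_ge_atTop n₀).mono fun n hn f hf => ?_⟩
  rw [← one_div]
  refine (hK n hn f hf).trans ?_
  gcongr
  exact le_abs_self K

/-- The radius around `g₀` in the norm `‖·‖_{m,s^{2m}}` with square `D ((n s)⁻¹ + s^{2m})`. -/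
def rateRadius (m n : ℕ) (D s : ℝ) : ℝ := √(D * ((n : ℝ)⁻¹ * s⁻¹ + s ^ (2 * m)))

section Rate

variable {m n : ℕ} {D s : ℝ}

lemma rateRadius_sq (hD : 0 ≤ D) (hs : 0 ≤ s) :
    rateRadius m n D s ^ 2 = D * ((n : ℝ)⁻¹ * s⁻¹ + s ^ (2 * m)) :=
  Real.sq_sqrt (by positivity)

lemma rateRadius_pos (hD : 0 < D) (hs : 0 < s) : 0 < rateRadius m n D s :=
  Real.sqrt_pos.2 (by positivity)

lemma sqrt_mul_pow_le_rateRadius (hD : 0 ≤ D) (hs : 0 ≤ s) : √D * s ^ m ≤ rateRadius m n D s := by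
  refine Real.le_sqrt_of_sq_le ?_
  rw [mul_pow, Real.sq_sqrt hD, ← pow_mul, mul_comm m]
  gcongr
  exact le_add_of_nonneg_left (by positivity)

lemma sqrt_le_sqrt_mul_rateRadius (hD : 0 ≤ D) (hs : 0 < s) (hn : 0 < n) :
    √D ≤ √(n * s) * rateRadius m n D s := by
  rw [rateRadius, ← Real.sqrt_mul (by positivity)]
  refine Real.sqrt_le_sqrt ?_
  calc D = n * s * (D * ((n : ℝ)⁻¹ * s⁻¹)) := by field_simp
    _ ≤ n * s * (D * ((n : ℝ)⁻¹ * s⁻¹ + s ^ (2 * m))) := by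
      gcongr
      exact le_add_of_nonneg_right (by positivity)

lemma rateRadius_sq_le (hm : 1 ≤ m) (hD : 0 ≤ D) (hs : 0 < s) (hs1 : s ≤ 1) :
    rateRadius m n D s ^ 2 ≤ D * (((n : ℝ) * s ^ 2)⁻¹ + s) * s := by
  have hpow : s ^ (2 * m) ≤ s ^ 2 := pow_le_pow_of_le_one hs.le hs1 (by lia)
  calc rateRadius m n D s ^ 2 = D * ((n : ℝ)⁻¹ * s⁻¹ + s ^ (2 * m)) := rateRadius_sq hD hs.le
    _ ≤ D * ((n : ℝ)⁻¹ * s⁻¹ + s ^ 2) := by gcongr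
    _ = D * (((n : ℝ) * s ^ 2)⁻¹ + s) * s := by field_simp

end Rate

section Asymptotics

variable {m : ℕ} {s : ℕ → ℝ} (hs : ∀ n, 0 < s n) (hs0 : Tendsto s atTop (𝓝 0))
  (hns : Tendsto (fun n : ℕ => (n : ℝ) * s n ^ 2) atTop atTop)
include hs hs0 hns

lemma eventually_rateRadius_le (hm : 1 ≤ m) {D τ : ℝ} (hD : 0 ≤ D) (hτ : 0 < τ) :
    ∀ᶠ n in atTop, rateRadius m n D (s n) ≤ τ * √(s n) := by
  have hlim := ((tendsto_inv_atTop_zero.comp hns).add hs0).const_mul D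
  rw [add_zero, mul_zero] at hlim
  filter_upwards [hlim.eventually_le_const (pow_pos hτ 2), hs0.eventually_le_const one_pos]
    with n hn hn1
  refine (sq_le_sq₀ (Real.sqrt_nonneg _) (by positivity)).1 ?_
  rw [mul_pow, Real.sq_sqrt (hs n).le]
  exact (rateRadius_sq_le hm hD (hs n) hn1).trans (mul_le_mul_of_nonneg_right hn (hs n).le)

lemma eventually_div_le_mul {K τ : ℝ} (hτ : 0 < τ) : ∀ᶠ n : ℕ in atTop, K / n ≤ τ * s n := by
  have hlim := (tendsto_inv_atTop_zero.comp hns).const_mul K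
  rw [mul_zero] at hlim
  filter_upwards [hlim.eventually_le_const hτ, hs0.eventually_le_const one_pos,
    eventually_gt_atTop 0] with n hn hn1 hn0
  have hsn := hs n
  have hsq : s n ^ 2 ≤ s n := by nlinarith
  calc K / n = K * ((n : ℝ) * s n ^ 2)⁻¹ * s n ^ 2 := by field_simp
    _ ≤ τ * s n ^ 2 := mul_le_mul_of_nonneg_right hn (sq_nonneg _)
    _ ≤ τ * s n := by gcongr

end Asymptotics

namespace ExponentialFamily

variable {F : ExponentialFamily} {m : ℕ} {B α₀ : ℝ} {g₀ : ℝ → ℝ} {t : (n : ℕ) → Fin n → ℝ}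
  {s : ℕ → ℝ}

lemma exists_eventually_exists_isSobolevLocalMin (H : Type*) [NormedAddCommGroup H]
    [InnerProductSpace ℝ H] (hB : ∀ θ y, F.density θ y ≤ B) (hm : 1 ≤ m) (hα₀ : 0 < α₀)
    {c₀ : ℝ} (hc₀ : 0 < c₀) (hg₀ : MemSobolev m 2 g₀) (ht : ∀ n i, t n i ∈ Icc (0 : ℝ) 1)
    (hdesign : QuasiUniformDesign t)
    (hinfo : ∀ n i, c₀ ≤ ∫ y, F.powInfo α₀ (g₀ (t n i)) y ∂F.law (g₀ (t n i)))
    (hs : ∀ n, 0 < s n) (hs0 : Tendsto s atTop (𝓝 0))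
    (hns : Tendsto (fun n : ℕ => (n : ℝ) * s n ^ 2) atTop atTop) :
    ∃ τ ∈ Ioc 0 (α₀ / 2), ∀ D > 0, ∀ᶠ n in atTop, ∀ (e : Fin n → H) (α : ℝ) (y : Fin n → ℝ),
      IsEvaluationFamily (s n) (t n) e →
      F.IsGoodSample m g₀ α₀ τ (s n) (rateRadius m n D (s n)) (t n) e α y →
        ∃ g, IsSobolevLocalMin m (s n ^ (2 * m)) (dpdCriterion F m (s n ^ (2 * m)) α (t n) y) g ∧
          sobolevNorm m (s n ^ (2 * m)) (g - g₀) ≤ rateRadius m n D (s n) := by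
  obtain ⟨K, hK0, hK⟩ := hdesign.exists_quadratureBound
  obtain ⟨τ, hτ, hmin⟩ := F.exists_isSobolevLocalMin_of_isGoodSample H hB hm hα₀ hc₀ hg₀
  refine ⟨τ, hτ, fun D hD => ?_⟩
  filter_upwards [hK, eventually_div_le_mul hs hs0 hns hτ.1, hs0.eventually_le_const one_pos,
    eventually_rateRadius_le hs hs0 hns hm hD.le hτ.1] with n hquad hκ hs1 hR e α y he hy
  exact hmin (hs n) hs1 (ht n) he hquad (by positivity) hκ (hinfo n)
    (rateRadius_pos hD (hs n)) hR hy

lemma exists_eventually_measure_not_isGoodSample_le {Ω : Type*} [MeasurableSpace Ω]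
    {P : Measure Ω} (H : Type*) [NormedAddCommGroup H] [InnerProductSpace ℝ H] [CompleteSpace H]
    (hB : ∀ θ y, F.density θ y ≤ B) (hm : 1 ≤ m) (hg₀ : MemSobolev m 2 g₀)
    (ht : ∀ n i, t n i ∈ Icc (0 : ℝ) 1) {Y : (n : ℕ) → Fin n → Ω → ℝ}
    (hY : ∀ n i, HasLaw (Y n i) (F.law (g₀ (t n i))) P) (hindep : ∀ n, iIndepFun (Y n) P)
    {αhat : ℕ → Ω → ℝ} (hαhat : TendstoInMeasure P αhat atTop fun _ => α₀)
    (hs : ∀ n, 0 < s n) (hns : Tendsto (fun n : ℕ => (n : ℝ) * s n ^ 2) atTop atTop)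
    {τ : ℝ} (hτ : τ ∈ Ioc 0 (α₀ / 2)) {ε : ℝ} (hε : 0 < ε) :
    ∃ D₀ > 0, ∀ D ≥ D₀, ∀ᶠ n in atTop, ∀ e : Fin n → H, IsEvaluationFamily (s n) (t n) e →
      P {ω | ¬ F.IsGoodSample m g₀ α₀ τ (s n) (rateRadius m n D (s n)) (t n) e (αhat n ω)
        (fun i => Y n i ω)} ≤ ENNReal.ofReal ε := by
  obtain ⟨σ, hσ, hbad⟩ := F.exists_measure_not_isGoodSample_le H hB hm hg₀ hτ
  have hτ0 : 0 < τ := hτ.1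
  refine ⟨max (2 / τ) (3 * (σ + 1) / ε) ^ 2, by positivity, fun D hD => ?_⟩
  have hD0 : 0 < D := lt_of_lt_of_le (by positivity) hD
  have hsqrt : max (2 / τ) (3 * (σ + 1) / ε) ≤ √D := Real.le_sqrt_of_sq_le hD
  have hDτ : 2 ≤ √D * τ := (div_le_iff₀ hτ0).1 ((le_max_left _ _).trans hsqrt)
  have hDε : σ / √D ≤ ε / 3 := by
    have := (div_le_iff₀ hε).1 ((le_max_right _ _).trans hsqrt)
    rw [div_le_iff₀ (Real.sqrt_pos.2 hD0)]
    linarith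
  have hlim : Tendsto (fun n : ℕ => σ / (√n * s n)) atTop (𝓝 0) := by
    refine ((tendsto_const_nhds (x := σ)).div_atTop
      (Real.tendsto_sqrt_atTop.comp hns)).congr fun n => ?_
    rw [Function.comp_apply, Real.sqrt_mul n.cast_nonneg, Real.sqrt_sq (hs n).le]
  filter_upwards [hlim.eventually_le_const (by positivity : 0 < ε / 3), eventually_gt_atTop 0,
    (tendstoInMeasure_iff_norm.1 hαhat τ hτ0).eventually_le_const
      (ENNReal.ofReal_pos.2 (by positivity : 0 < ε / 3))] with n hn hn0 hα e he
  have hR := rateRadius_pos (m := m) (n := n) hD0 (hs n)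
  refine (hbad (hs n) (ht n) he (hY n) (hindep n) hR ?_).trans ((add_le_add_left hα _).trans ?_)
  · have := sqrt_mul_pow_le_rateRadius (m := m) (n := n) hD0.le (hs n).le
    have := pow_pos (hs n) m
    nlinarith
  · have hradius : σ / (√(n * s n) * rateRadius m n D (s n)) ≤ σ / √D := by
      gcongr
      exact sqrt_le_sqrt_mul_rateRadius hD0.le (hs n) hn0
    have := hs n
    rw [← ENNReal.ofReal_add (by positivity) (by positivity)]
    exact ENNReal.ofReal_le_ofReal (by linarith)

end ExponentialFamily

lemma ExponentialFamily.integral_density_rpow_mul_sq_score (F : ExponentialFamily) {Ω : Type*}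
    [MeasurableSpace Ω] {P : Measure Ω} {Y : Ω → ℝ} {a θ : ℝ} (ha : 0 < a)
    (hY : HasLaw Y (F.law θ) P) :
    ∫ ω, F.density θ (Y ω) ^ a * |F.score θ (Y ω)| ^ 2 ∂P = ∫ y, F.powInfo a θ y ∂F.law θ := by
  simp only [F.density_rpow_mul_sq_score ha]
  exact hY.integral_comp (F.measurable_powInfo a θ).aestronglyMeasurable

section RpowScale

variable {m : ℕ} {lam : ℕ → ℝ}

lemma rpow_one_div_two_mul_pow (hm : 1 ≤ m) {l : ℝ} (hl : 0 ≤ l) :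
    (l ^ (1 / (2 * (m : ℝ)))) ^ (2 * m) = l := by
  have hm0 : 2 * m ≠ 0 := by lia
  simpa [one_div] using Real.rpow_inv_natCast_pow hl hm0

lemma rpow_one_div_two_mul_sq {l : ℝ} (hl : 0 ≤ l) :
    (l ^ (1 / (2 * (m : ℝ)))) ^ 2 = l ^ (1 / (m : ℝ)) := by
  rw [← Real.rpow_natCast, ← Real.rpow_mul hl]
  congr 1
  push_cast
  ring

lemma tendsto_rpow_one_div_two_mul (hm : 1 ≤ m) (hlam : Tendsto lam atTop (𝓝 0)) :
    Tendsto (fun n => lam n ^ (1 / (2 * (m : ℝ)))) atTop (𝓝 0) := by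
  have hpos : (0 : ℝ) < 1 / (2 * (m : ℝ)) := by positivity
  simpa only [Real.zero_rpow hpos.ne'] using hlam.rpow_const (Or.inr hpos.le)

end RpowScale

lemma tendsto_liminf_innerProb {Ω : Type*} [MeasurableSpace Ω] {P : Measure Ω}
    {E : ℝ → ℕ → Set Ω}
    (h : ∀ ε > 0, ∃ D₀, ∀ D ≥ D₀, ∀ᶠ n in atTop, P (E D n)ᶜ ≤ ENNReal.ofReal ε) :
    Tendsto (fun D => liminf (fun n => innerProb P (E D n)) atTop) atTop (𝓝 1) := by
  refine tendsto_order.2 ⟨fun a ha => ?_, fun a ha => .of_forall fun D => ?_⟩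
  · obtain ⟨b, hab, hb⟩ := exists_between ha
    have hb0 : 1 - b ≠ 0 := (tsub_pos_of_lt hb).ne'
    have hbtop : 1 - b ≠ ⊤ := ENNReal.sub_ne_top ENNReal.one_ne_top
    obtain ⟨D₀, hD₀⟩ := h (1 - b).toReal (ENNReal.toReal_pos hb0 hbtop)
    filter_upwards [eventually_ge_atTop D₀] with D hD
    refine hab.trans_le (le_liminf_of_le (by isBoundedDefault) ?_)
    filter_upwards [hD₀ D hD] with n hn
    rw [ENNReal.ofReal_toReal hbtop] at hn
    exact (ENNReal.sub_sub_cancel ENNReal.one_ne_top hb.le).symm.trans_le (tsub_le_tsub_left hn 1)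
  · exact (liminf_le_of_frequently_le' (.of_forall fun n => tsub_le_self)).trans_lt ha

theorem theorem1_general {Ω : Type*} [MeasurableSpace Ω] {P : Measure Ω} {F : ExponentialFamily}
    {B : ℝ} (hB : ∀ θ y, F.density θ y ≤ B) {m : ℕ} (hm : 1 ≤ m)
    {g₀ : ℝ → ℝ} (hg₀ : MemSobolev m 2 g₀)
    {t : (n : ℕ) → Fin n → ℝ} (ht : ∀ n i, t n i ∈ Icc (0 : ℝ) 1) (hdesign : QuasiUniformDesign t)
    {Y : (n : ℕ) → Fin n → Ω → ℝ} (hY : ∀ n i, HasLaw (Y n i) (F.law (g₀ (t n i))) P)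
    (hindep : ∀ n, iIndepFun (Y n) P) {αhat : ℕ → Ω → ℝ} {α₀ : ℝ} (hα₀ : 0 < α₀)
    (hαhat : TendstoInMeasure P αhat atTop fun _ => α₀) {c₀ : ℝ} (hc₀ : 0 < c₀)
    (hinfo : ∀ n i, c₀ ≤
      ∫ ω, F.density (g₀ (t n i)) (Y n i ω) ^ α₀ * |F.score (g₀ (t n i)) (Y n i ω)| ^ 2 ∂P)
    {lam : ℕ → ℝ} (hlam_pos : ∀ n, 0 < lam n) (hlam : Tendsto lam atTop (𝓝 0))
    (hnlam : Tendsto (fun n : ℕ => (n : ℝ) * lam n ^ (1 / (m : ℝ))) atTop atTop) :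
    Tendsto (fun D : ℝ => liminf (fun n : ℕ => innerProb P {ω | ∃ g : ℝ → ℝ,
        IsSobolevLocalMin m (lam n)
          (dpdCriterion F m (lam n) (αhat n ω) (t n) (fun i => Y n i ω)) g ∧
        sobolevNorm m (lam n) (fun x => g x - g₀ x) ^ 2 ≤
          D * ((n : ℝ)⁻¹ * lam n ^ (-(1 / (2 * (m : ℝ)))) + lam n)}) atTop)
      atTop (𝓝 1) := by
  let s n := lam n ^ (1 / (2 * (m : ℝ)))
  have hs n : 0 < s n := Real.rpow_pos_of_pos (hlam_pos n) _
  have hslam n : s n ^ (2 * m) = lam n := rpow_one_div_two_mul_pow hm (hlam_pos n).le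
  have hs0 : Tendsto s atTop (𝓝 0) := tendsto_rpow_one_div_two_mul hm hlam
  have hns : Tendsto (fun n : ℕ => (n : ℝ) * s n ^ 2) atTop atTop := hnlam.congr fun n =>
    congrArg ((n : ℝ) * ·) (rpow_one_div_two_mul_sq (hlam_pos n).le).symm
  obtain ⟨τ, hτ, hmin⟩ := ExponentialFamily.exists_eventually_exists_isSobolevLocalMin
    (WithLp 2 (UnitL2 × UnitL2)) hB hm hα₀ hc₀ hg₀ ht hdesign
    (fun n i => (hinfo n i).trans_eq (F.integral_density_rpow_mul_sq_score hα₀ (hY n i))) hs hs0 hns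
  refine tendsto_liminf_innerProb fun ε hε => ?_
  obtain ⟨D₀, hD₀, hbad⟩ := ExponentialFamily.exists_eventually_measure_not_isGoodSample_le
    (WithLp 2 (UnitL2 × UnitL2)) hB hm hg₀ ht hY hindep hαhat hs hns hτ hε
  refine ⟨D₀, fun D hD => ?_⟩
  have hD0 : 0 < D := hD₀.trans_le hD
  filter_upwards [hmin D hD0, hbad D hD, hs0.eventually_le_const one_pos] with n hmin hbad hs1
  obtain ⟨e, he⟩ := sobolevSpace.exists_isEvaluationFamily (ht n) (hs n) hs1
  refine (measure_mono ?_).trans (hbad e he)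
  intro ω hω hgood
  refine hω ?_
  obtain ⟨g, hg, hgR⟩ := hmin e _ _ he hgood
  have hrate := pow_le_pow_left₀ (sobolevNorm_nonneg _ _ _) hgR 2
  rw [rateRadius_sq hD0.le (hs n).le, hslam n, ← Real.rpow_neg (hlam_pos n).le] at hrate
  exact ⟨g, hslam n ▸ hg, hrate⟩

end

theorem theorem1
    {Ω : Type*} [MeasurableSpace Ω] (P : Measure Ω) [IsProbabilityMeasure P]
    (F : ExponentialFamily) (m : ℕ) (hm : 1 ≤ m)
    (g₀ : ℝ → ℝ) (hg₀ : MemSobolev m 2 g₀)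
    -- design points, independent responses, and the possibly data-driven tuning parameter
    (t : (n : ℕ) → Fin n → ℝ) (ht : ∀ n i, t n i ∈ Icc (0 : ℝ) 1)
    (Y : (n : ℕ) → Fin n → Ω → ℝ)
    (hY_law : ∀ n i, HasLaw (Y n i) (F.law (g₀ (t n i))) P)
    (hY_indep : ∀ n, iIndepFun (Y n) P)
    (αhat : ℕ → Ω → ℝ) (hαhat : ∀ n, AEMeasurable (αhat n) P)
    -- the regularity assumptions on the model, the tuning parameter and the design
    (S : Set ℝ) (hA1 : F.CommonSupport S)
    (α₀ : ℝ) (hα₀ : 0 < α₀) (hA2 : TendstoInMeasure P αhat atTop (fun _ => α₀))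
    (δ : ℝ) (hδ : 0 < δ)
    (hA3 : F.FirstOrderRegular S g₀ α₀ δ)
    (hA4 : F.SecondOrderRegular S g₀ α₀ δ)
    (hA5 : F.InformationBounds P t Y g₀ α₀ δ)
    (hA6 : QuasiUniformDesign t)
    -- the smoothing parameter
    (lam : ℕ → ℝ) (hlam_pos : ∀ n, 0 < lam n) (hlam : Tendsto lam atTop (𝓝 0))
    (hlam₁ : Tendsto (fun n : ℕ => (n : ℝ) * lam n ^ (1 / (m : ℝ))) atTop atTop)
    (hlam₂ : Tendsto (fun n : ℕ => (n : ℝ) * lam n ^ (1 / (2 * (m : ℝ))) *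
      Real.exp (-(lam n ^ (-(1 / (m : ℝ)))))) atTop (𝓝 0)) :
    Tendsto (fun D : ℝ => liminf (fun n : ℕ => innerProb P {ω | ∃ g : ℝ → ℝ,
        IsSobolevLocalMin m (lam n)
          (dpdCriterion F m (lam n) (αhat n ω) (t n) (fun i => Y n i ω)) g ∧
        sobolevNorm m (lam n) (fun x => g x - g₀ x) ^ 2 ≤
          D * ((n : ℝ)⁻¹ * lam n ^ (-(1 / (2 * (m : ℝ)))) + lam n)}) atTop)
      atTop (𝓝 1) := by
  obtain ⟨⟨B, hB⟩, -⟩ := hA3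
  obtain ⟨c₀, C₀, hc₀, -, hinfo⟩ := hA5
  exact theorem1_general hB hm hg₀ ht hA6 hY_law hY_indep hα₀ hA2 hc₀
    (fun n i => (hinfo α₀ (by simpa using hδ) n i).1) hlam_pos hlam hlam₁
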